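/- Let $X$ be a complex manifold of dimension $n$, $G$ a complex Lie group with Lie algebra $\mathfrak g$, and $(\mathbf P,\theta)$ a Higgs pair on $X$: $\mathbf P$ is a holomorphic principal $G$-bundle and $\theta\in H^0(X,\operatorname{ad}\mathbf P\otimes\Omega^1_X)$ satisfies $\theta\wedge\theta=0$. (This includes the case of $X$ compact Kähler and $G$ reductive.) Let $p\in\mathbb C[\mathfrak g]^G$ be an $\mathrm{Ad}(G)$-invariant homogeneous polynomial of degree $d$, and for $k\ge 1$ let $$\mathscr P_{dk}(p)(X_1,\dots,X_k;v)=\mathcal L_{X_1}\cdots\mathcal L_{X_k}(p)(v)$$ be the $k$-th iterated derivative of $p$ at $v\in\mathfrak g$ in the constant directions $X_1,\dots,X_k\in\mathfrak g$. Extend it to forms by $$\mathscr P_{dk}(p)(\alpha_1\otimes X_1,\dots,\alpha_k\otimes X_k;\theta)=\alpha_1\wedge\dots\wedge\alpha_k\,\mathscr P_{dk}(p)(X_1,\dots,X_k;\theta)\in A^{0,\bullet}(S^d\Omega^1_X)$$ for $\alpha_i\in A^{0,\bullet}$ and $X_i$ local sections of $\operatorname{ad}\mathbf P\otimes\Omega^1_X$.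 Consider the graded vector spaces $$\mathscr C^\bullet=\bigoplus_{r+s=\bullet}A^{0,r}(\operatorname{ad}\mathbf P\otimes\Omega^s_X),\qquad \mathscr B^\bullet=A^{0,\bullet}(S^d\Omega^1_X)[-1],$$ where $\mathscr C^\bullet$ has differential $\bar\partial_{\mathbf P}+\operatorname{ad}\theta$ and the bracket induced by the wedge product and the Lie bracket of $\mathfrak g$, and $\mathscr B^\bullet$ has differential $\bar\partial$ and zero bracket. A dgla is regarded as an $L_\infty$-algebra with $q_1(a)=-da$, $q_2(a\cdot b)=(-1)^{\deg a}[a,b]$ and $q_k=0$ for $k\ge3$. Then $\mathscr C^\bullet$ and $\mathscr B^\bullet$ are differential graded Lie algebras. Let $pr_0^k$ be the projection of $S^k(\mathscr C^\bullet[1])$ onto $S^k\big(A^{0,\bullet}(\operatorname{ad}\mathbf P\otimes\Omega^1_X)\big)$. Then the maps $$h^d_k=\mathscr P_{dk}(p)_\theta\circ pr_0^k:\ S^k(\mathscr C^\bullet[1])\longrightarrow A^{0,\bullet}(S^d\Omega^1_X)=\mathscr B^\bullet[1],\qquad k\ge1,$$ are well defined, graded symmetric and of degree $0$, and they define an $L_\infty$-morphism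 $h^d_\infty:\mathscr C^\bullet\to\mathscr B^\bullet$. -/

import Mathlib

open scoped Manifold ContDiff TensorProduct

universe u v w

noncomputable section

/-! ## Differential graded Lie algebras and L∞-morphisms -/

/-- The data of a graded vector space `⨁ i, gr i` (given by submodules of an ambient complex vector
space `V`) with a differential and a bracket. Only the values of `d` on the pieces `gr i` matter. -/
structure GradedBracket (V : Type*) [AddCommGroup V] [Module ℂ V] where
  /-- the homogeneous elements of degree `i` -/
  gr : ℤ → Submodule ℂ V
  /-- the differential -/
  d : V → V
  /-- the bracket -/
  br : V →ₗ[ℂ] V →ₗ[ℂ] V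

/-- The axioms of a differential graded Lie algebra. -/
structure GradedBracket.IsDGLA {V : Type*} [AddCommGroup V] [Module ℂ V]
    (A : GradedBracket V) : Prop where
  independent : iSupIndep A.gr
  d_mem : ∀ i, ∀ a ∈ A.gr i, A.d a ∈ A.gr (i + 1)
  d_add : ∀ i, ∀ a ∈ A.gr i, ∀ b ∈ A.gr i, A.d (a + b) = A.d a + A.d b
  d_smul : ∀ i, ∀ (c : ℂ), ∀ a ∈ A.gr i, A.d (c • a) = c • A.d a
  d_d : ∀ i, ∀ a ∈ A.gr i, A.d (A.d a) = 0
  br_mem : ∀ i j, ∀ a ∈ A.gr i, ∀ b ∈ A.gr j, A.br a b ∈ A.gr (i + j)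
  skew : ∀ i j, ∀ a ∈ A.gr i, ∀ b ∈ A.gr j, A.br a b = -((i * j).negOnePow • A.br b a)
  jacobi : ∀ i j k, ∀ a ∈ A.gr i, ∀ b ∈ A.gr j, ∀ c ∈ A.gr k,
    A.br a (A.br b c) = A.br (A.br a b) c + (i * j).negOnePow • A.br b (A.br a c)
  leibniz : ∀ i j, ∀ a ∈ A.gr i, ∀ b ∈ A.gr j,
    A.d (A.br a b) = A.br (A.d a) b + i.negOnePow • A.br a (A.d b)

/-- The L∞-operations `q_k : S^k(V[1]) → V[1]`, given on homogeneous elements: `q k n s` is the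
value of `q_k` on `s 0 · … · s (k-1)`, where `s i` has degree `n i` in `V[1]`, that is, degree
`n i + 1` in `V`. -/
structure LInftyOps (V : Type*) [AddCommGroup V] [Module ℂ V] where
  /-- the homogeneous elements of degree `i` of `V` (not shifted) -/
  gr : ℤ → Submodule ℂ V
  /-- the operations -/
  q : (k : ℕ) → (Fin k → ℤ) → (Fin k → V) → V

/-- A dgla as an L∞-algebra: `q_1(a) = -da`, `q_2(a · b) = (-1)^{deg a} [a, b]` with `deg a` the
degree in `V`, and `q_k = 0` for `k ≥ 3`. -/
def GradedBracket.toLInfty {V : Type*} [AddCommGroup V] [Module ℂ V] (A : GradedBracket V) :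
    LInftyOps V where
  gr := A.gr
  q
    | 1, _, s => -A.d (s 0)
    | 2, n, s => (n 0 + 1).negOnePow • A.br (s 0) (s 1)
    | _, _, _ => 0

/-- The Koszul sign `ε` with `s_0 · … · s_{k-1} = ε s_{σ 0} · … · s_{σ (k-1)}`, where the
right-hand side lists the `s_i` by increasing value of `f i` (and by increasing `i` where `f` is
constant), and `s_i` has degree `n i`. -/
def koszulSign {k : ℕ} {α : Type*} [LinearOrder α] (f : Fin k → α) (n : Fin k → ℤ) : ℤˣ :=
  ∏ i, ∏ j, if i < j ∧ f j < f i then (n i * n j).negOnePow else 1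

/-- The subfamily of `s` with indices in `S`, in increasing order. -/
def subfamily {k : ℕ} {β : Type*} (S : Finset (Fin k)) (s : Fin k → β) : Fin S.card → β :=
  fun i => s (S.orderEmbOfFin rfl i)

/-- The maps `h_k`, `k ≥ 1`, define an L∞-morphism: each `h_k` is a graded symmetric multilinear
map `S^k(V[1]) → W[1]` of degree `0`, and the induced coalgebra morphism `H` satisfies
`H ∘ Q = Q' ∘ H`. The latter is stated through its components
`∑_a h_a ∘ Q_k^a = ∑_a q'_a ∘ H_k^a`. In the coderivation `Q` the sum over
`(j, k - j)`-unshuffles is written as a sum over the `j`-element subsets `I` of the `k` arguments.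
In `H_k^a` the sum is over the ordered partitions of the arguments into `a` non-empty blocks, given
as surjections `f`, and is divided by `a!`. -/
structure IsLInftyMorphism {V W : Type*} [AddCommGroup V] [Module ℂ V] [AddCommGroup W]
    [Module ℂ W] (A : LInftyOps V) (B : LInftyOps W)
    (h : (k : ℕ) → MultilinearMap ℂ (fun _ : Fin k => V) W) : Prop where
  degree : ∀ k, 1 ≤ k → ∀ (n : Fin k → ℤ) (s : Fin k → V), (∀ i, s i ∈ A.gr (n i + 1)) →
    h k s ∈ B.gr ((∑ i, n i) + 1)
  symmetric : ∀ k, 1 ≤ k → ∀ (n : Fin k → ℤ) (s : Fin k → V), (∀ i, s i ∈ A.gr (n i + 1)) →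
    ∀ σ : Equiv.Perm (Fin k), h k (s ∘ σ) = koszulSign (σ⁻¹ : Equiv.Perm (Fin k)) n • h k s
  morphism : ∀ k, 1 ≤ k → ∀ (n : Fin k → ℤ) (s : Fin k → V), (∀ i, s i ∈ A.gr (n i + 1)) →
    ∑ I : Finset (Fin k), (if I.Nonempty then
      koszulSign (fun i => if i ∈ I then (0 : ℕ) else 1) n •
        h (Iᶜ.card + 1)
          (Fin.cons (A.q I.card (subfamily I n) (subfamily I s)) (subfamily Iᶜ s)) else 0)
    = ∑ a ∈ Finset.Icc 1 k, ((a.factorial : ℂ)⁻¹) •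
        ∑ f : {f : Fin k → Fin a // Function.Surjective f},
          koszulSign f.1 n • B.q a (fun b => ∑ i with f.1 i = b, n i)
            (fun b => h (Finset.univ.filter fun i => f.1 i = b).card
              (subfamily (Finset.univ.filter fun i => f.1 i = b) s))

/-! ## Homogeneous polynomials and polarisation -/

/-- `q` is a homogeneous polynomial of degree `d` on `W`: an element of `S^d(W^∨)`. -/
def IsHomogPoly {W : Type*} [AddCommGroup W] [Module ℂ W] (d : ℕ) (q : W → ℂ) : Prop :=
  ∃ F : MultilinearMap ℂ (fun _ : Fin d => W) ℂ, ∀ x, q x = F fun _ => x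

/-- The polarisation `P_{dk}(p)(X_1, …, X_k; v) = (L_{X_1} ⋯ L_{X_k} p)(v)`, where `L_X` is the
derivative in the constant direction `X`. -/
def polar {W : Type*} [AddCommGroup W] [Module ℂ W] (p : W → ℂ) :
    (k : ℕ) → (Fin k → W) → W → ℂ
  | 0, _, v => p v
  | k + 1, X, v => lineDeriv ℂ (polar p k (Fin.tail X)) v (X 0)

/-! ## Exterior forms on `ℂⁿ` -/

/-- The complexified cotangent space of `ℂⁿ`: complex-valued `ℝ`-linear forms. -/
abbrev Covector (n : ℕ) : Type := (Fin n → ℂ) →ₗ[ℝ] ℂ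

/-- The algebra of all complex exterior forms at a point of `ℂⁿ`. -/
abbrev Forms (n : ℕ) : Type := ExteriorAlgebra ℂ (Covector n)

instance covectorFinite (n : ℕ) : Module.Finite ℂ (Covector n) :=
  Module.Finite.of_restrictScalars_finite ℝ ℂ (Covector n)

instance formsFinite (n : ℕ) : Module.Finite ℂ (Forms n) :=
  Module.Finite.of_basis (Module.finBasis ℂ (Covector n)).ExteriorAlgebra

/-- Forms of type `(1, 0)`: the `ℂ`-linear ones. -/
def holCovector (n : ℕ) : Submodule ℂ (Covector n) where
  carrier := {l | ∀ x, l (Complex.I • x) = Complex.I * l x}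
  add_mem' ha hb x := by simp [ha x, hb x, mul_add]
  zero_mem' x := by simp
  smul_mem' c a ha x := by simp [ha x, mul_left_comm]

/-- Forms of type `(0, 1)`: the conjugate-linear ones. -/
def antiCovector (n : ℕ) : Submodule ℂ (Covector n) where
  carrier := {l | ∀ x, l (Complex.I • x) = -(Complex.I * l x)}
  add_mem' ha hb x := by simp [ha x, hb x, mul_add, add_comm]
  zero_mem' x := by simp
  smul_mem' c a ha x := by simp [ha x, mul_left_comm]

/-- `Λ^{0,r} ⊗ Λ^{s,0}`, spanned by the products of `r` forms of type `(0, 1)` followed by `s` forms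
of type `(1, 0)`. For a holomorphic bundle `F`, an element `α ⊗ (β ⊗ X)` of
`A^{0,r}(F ⊗ Ω^s)` is thus identified with `(α ∧ β) ⊗ X`. -/
def formsOfType (n r s : ℕ) : Submodule ℂ (Forms n) :=
  ((antiCovector n).map (ExteriorAlgebra.ι ℂ)) ^ r * ((holCovector n).map (ExteriorAlgebra.ι ℂ)) ^ s

/-- Pullback of covectors along a complex linear map. -/
def pullCovector {n : ℕ} (A : (Fin n → ℂ) →L[ℂ] (Fin n → ℂ)) : Covector n →ₗ[ℂ] Covector n where
  toFun l := l ∘ₗ (A.toLinearMap.restrictScalars ℝ)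
  map_add' _ _ := rfl
  map_smul' _ _ := rfl

/-- Pullback of forms along a complex linear map. -/
def pullForms {n : ℕ} (A : (Fin n → ℂ) →L[ℂ] (Fin n → ℂ)) : Forms n →ₐ[ℂ] Forms n :=
  ExteriorAlgebra.map (pullCovector A)

/-- The coordinate form `dz_j`. -/
def dz {n : ℕ} (j : Fin n) : Covector n := LinearMap.proj j

/-- The coordinate form `dz̄_j`. -/
def dzbar {n : ℕ} (j : Fin n) : Covector n :=
  Complex.conjAe.toLinearMap ∘ₗ (LinearMap.proj j : (Fin n → ℂ) →ₗ[ℝ] ℂ)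

/-! ## Calculus for functions with values in a finite-dimensional complex vector space -/

section Calculus

variable {n : ℕ} {M : Type*} [AddCommGroup M] [Module ℂ M]

/-- Smoothness (in the real sense) at a point of `ℂⁿ`, tested by linear functionals. -/
def SmoothAt (f : (Fin n → ℂ) → M) (z : Fin n → ℂ) : Prop :=
  ∀ l : Module.Dual ℂ M, ContDiffAt ℝ ∞ (fun w => l (f w)) z

/-- Holomorphy near a point of `ℂⁿ`, tested by linear functionals. -/
def HolomorphicAt (f : (Fin n → ℂ) → M) (z : Fin n → ℂ) : Prop :=
  ∀ l : Module.Dual ℂ M, AnalyticAt ℂ (fun w => l (f w)) z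

/-- The real directional derivative of `f` at `z` along `x`, computed in a basis of `M`. -/
def dirDeriv [Module.Finite ℂ M] (f : (Fin n → ℂ) → M) (z x : Fin n → ℂ) : M :=
  ∑ a, (fderiv ℝ (fun w => (Module.finBasis ℂ M).coord a (f w)) z x) • Module.finBasis ℂ M a

/-- `∂f/∂z̄_j = (∂f/∂x_j + i ∂f/∂y_j) / 2`. -/
def dzbarDeriv [Module.Finite ℂ M] (j : Fin n) (f : (Fin n → ℂ) → M) (z : Fin n → ℂ) : M :=
  (1 / 2 : ℂ) • (dirDeriv f z (Pi.single j 1) + Complex.I • dirDeriv f z (Pi.single j Complex.I))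

/-- The Dolbeault operator `∂̄f = ∑_j dz̄_j ∧ ∂f/∂z̄_j` on `ℂⁿ`, for functions with values in forms
(possibly with coefficients). -/
def localDbar [Module.Finite ℂ M] [Module (Forms n) M] (f : (Fin n → ℂ) → M)
    (z : Fin n → ℂ) : M :=
  ∑ j, ExteriorAlgebra.ι ℂ (dzbar j) • dzbarDeriv j f z

end Calculus

/-! ## Forms with values in a Lie algebra -/

section Fibre

variable (n : ℕ) (L : Type*)

/-- The bracket `[α ⊗ X, β ⊗ Y] = (α ∧ β) ⊗ [X, Y]`. -/
def formBracket [LieRing L] [LieAlgebra ℂ L] : Forms n ⊗[ℂ] L →ₗ[ℂ] Forms n ⊗[ℂ] L →ₗ[ℂ] Forms n ⊗[ℂ] L :=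
  TensorProduct.map₂ (LinearMap.mul ℂ (Forms n)) (LieModule.toEnd ℂ L L : L →ₗ[ℂ] L →ₗ[ℂ] L)

variable [AddCommGroup L] [Module ℂ L]

/-- `⨁_{r+s=i} Λ^{0,r} ⊗ (L ⊗ Λ^{s,0})`. -/
def lieFormsOfDegree (i : ℤ) : Submodule ℂ (Forms n ⊗[ℂ] L) :=
  ⨆ (r : ℕ) (s : ℕ) (_ : (r : ℤ) + s = i),
    Submodule.map₂ (TensorProduct.mk ℂ (Forms n) L) (formsOfType n r s) ⊤

variable {n L}

/-- An `L`-valued `(1, 0)`-form, as an element of `Forms n ⊗ L`. -/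
def toLieForm (φ : (Fin n → ℂ) →ₗ[ℂ] L) : Forms n ⊗[ℂ] L :=
  ∑ j, ExteriorAlgebra.ι ℂ (dz j) ⊗ₜ[ℂ] φ (Pi.single j 1)

/-- The value at `e` of the `(1, 0)`-part of a covector. -/
def evalHol (e : Fin n → ℂ) : Module.Dual ℂ (Covector n) where
  toFun l := (1 / 2 : ℂ) * (l e - Complex.I * l (Complex.I • e))
  map_add' a b := by simp only [LinearMap.add_apply]; ring
  map_smul' c a := by simp only [LinearMap.smul_apply, smul_eq_mul, RingHom.id_apply]; ring

/-- The `(0, 1)`-part of a covector. -/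
def antiPart : Covector n →ₗ[ℂ] Covector n where
  toFun l :=
    { toFun := fun x => (1 / 2 : ℂ) * (l x + Complex.I * l (Complex.I • x))
      map_add' := fun a b => by simp only [smul_add, map_add]; ring
      map_smul' := fun c a => by
        rw [smul_comm Complex.I c a, map_smul, map_smul]
        simp only [Complex.real_smul, RingHom.id_apply]; ring }
  map_add' a b := by ext x; simp; ring
  map_smul' c a := by ext x; simp; ring

/-- The projection `⨁_{r,s} Λ^{0,r} ⊗ Λ^{s,0} → ⨁_r Λ^{0,r} ⊗ Λ^{1,0}` followed by evaluation of the
factor in `Λ^{1,0}` at `e`. On `α ∧ β` with `α` of type `(0, r)` and `β` of type `(s, 0)` it is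
`β(e) α` if `s = 1`, and `0` otherwise. -/
def evalOneZero (e : Fin n → ℂ) : Forms n →ₗ[ℂ] Forms n :=
  (ExteriorAlgebra.map antiPart).toLinearMap ∘ₗ CliffordAlgebra.contractRight.flip (evalHol e)

variable [Module.Finite ℂ L]

/-- The extension of a `k`-linear form `D` on `L` to forms with values in `L`:
`(α_1 ⊗ X_1, …, α_k ⊗ X_k) ↦ D(X_1, …, X_k) α_1 ∧ … ∧ α_k`, computed in a basis of `L`. -/
def formExtend {k : ℕ} (D : (Fin k → L) → ℂ) :
    MultilinearMap ℂ (fun _ : Fin k => Forms n ⊗[ℂ] L) (Forms n) :=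
  ∑ J : Fin k → Fin (Module.finrank ℂ L), D (fun a => Module.finBasis ℂ L (J a)) •
    (MultilinearMap.mkPiAlgebraFin ℂ k (Forms n)).compLinearMap fun a =>
      (TensorProduct.rid ℂ (Forms n)).toLinearMap ∘ₗ
        LinearMap.lTensor (Forms n) ((Module.finBasis ℂ L).coord (J a))

end Fibre

/-! ## Lie groups and principal bundles -/

section Group

variable {m : ℕ} {G : Type v} [TopologicalSpace G] [ChartedSpace (Fin m → ℂ) G] [Group G]

/-- The Lie algebra of the complex Lie group `G`. -/
abbrev LieAlg (m : ℕ) (G : Type v) [TopologicalSpace G] [ChartedSpace (Fin m → ℂ) G] [Group G] :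
    Type := GroupLieAlgebra 𝓘(ℂ, Fin m → ℂ) G

instance lieAlgFinite : Module.Finite ℂ (LieAlg m G) :=
  inferInstanceAs (Module.Finite ℂ (Fin m → ℂ))

/-- The adjoint representation: `Ad g` is the derivative of `x ↦ g x g⁻¹` at the identity. -/
def Ad (g : G) : LieAlg m G →ₗ[ℂ] LieAlg m G :=
  (show LieAlg m G →L[ℂ] LieAlg m G from
    mfderiv 𝓘(ℂ, Fin m → ℂ) 𝓘(ℂ, Fin m → ℂ) (fun x : G => g * x * g⁻¹) 1).toLinearMap

end Group

/-- A holomorphic principal `G`-bundle on the complex manifold `X`, given by an open cover with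
holomorphic transition functions (local sections `σ_i` over `baseSet i` with
`σ_j = σ_i · trans i j`), together with a choice of a local section at each point. -/
structure HolPrincipalBundle (n m : ℕ) (X : Type u) [TopologicalSpace X]
    [ChartedSpace (Fin n → ℂ) X] (G : Type v) [TopologicalSpace G] [ChartedSpace (Fin m → ℂ) G]
    [Group G] where
  /-- the index set of the cover -/
  ι : Type w
  /-- the open sets of the cover -/
  baseSet : ι → Set X
  isOpen_baseSet : ∀ i, IsOpen (baseSet i)
  /-- a preferred index at each point -/
  indexAt : X → ι
  mem_baseSet_at : ∀ x, x ∈ baseSet (indexAt x)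
  /-- the transition functions -/
  trans : ι → ι → X → G
  holomorphic_trans : ∀ i j, ContMDiffOn 𝓘(ℂ, Fin n → ℂ) 𝓘(ℂ, Fin m → ℂ) ω (trans i j)
    (baseSet i ∩ baseSet j)
  trans_self : ∀ i, ∀ x ∈ baseSet i, trans i i x = 1
  trans_comp : ∀ i j k, ∀ x ∈ baseSet i ∩ baseSet j ∩ baseSet k,
    trans i j x * trans j k x = trans i k x

section Bundle

variable {n m : ℕ} {X : Type u} [TopologicalSpace X] [ChartedSpace (Fin n → ℂ) X]
  {G : Type v} [TopologicalSpace G] [ChartedSpace (Fin m → ℂ) G] [Group G]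

/-- The derivative at `y` of the change of coordinates from the preferred chart at `x` to the
preferred chart at `y`. -/
def chartJac [IsManifold 𝓘(ℂ, Fin n → ℂ) ω X] (x y : X) : (Fin n → ℂ) →L[ℂ] (Fin n → ℂ) :=
  tangentCoordChange 𝓘(ℂ, Fin n → ℂ) x y y

variable [IsManifold 𝓘(ℂ, Fin n → ℂ) ω X]

namespace HolPrincipalBundle

variable (P : HolPrincipalBundle.{u, v, w} n m X G)

/-! The frame at `x` consists of the preferred chart of `X` at `x` and the preferred local section
of the principal bundle at `x`. A section of a bundle associated with the tangent bundle and the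
principal bundle is a function on `X` whose value at `y` is expressed in the frame at `y`; its
local representative at `x` expresses it in the frame at `x`, near `x`, as a function of the
coordinates. -/

/-- Local representative at `x` of a form `s` with values in `ad P`. -/
def localRep (s : X → Forms n ⊗[ℂ] LieAlg m G) (x : X) :
    (Fin n → ℂ) → Forms n ⊗[ℂ] LieAlg m G := fun z =>
  let y := (chartAt (Fin n → ℂ) x).symm z
  TensorProduct.map (pullForms (chartJac x y)).toLinearMap
    (Ad (P.trans (P.indexAt x) (P.indexAt y) y)) (s y)

/-- Local representative at `x` of a section `θ` of `ad P ⊗ Ω^1`, evaluated at `e`. -/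
def localRepOneForm (θ : X → ((Fin n → ℂ) →ₗ[ℂ] LieAlg m G)) (x : X) (e : Fin n → ℂ) :
    (Fin n → ℂ) → LieAlg m G := fun z =>
  let y := (chartAt (Fin n → ℂ) x).symm z
  Ad (P.trans (P.indexAt x) (P.indexAt y) y) (θ y (chartJac x y e))

/-- The space of smooth forms of degree `i` with values in `ad P`, that is,
`⨁_{r+s=i} A^{0,r}(ad P ⊗ Ω^s)`. -/
def adForms (i : ℤ) : Submodule ℂ (X → Forms n ⊗[ℂ] LieAlg m G) where
  carrier := {s | ∀ x, s x ∈ lieFormsOfDegree n (LieAlg m G) i} ∩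
    {s | ∀ x, SmoothAt (P.localRep s x) (chartAt (Fin n → ℂ) x x)}
  add_mem' ha hb := ⟨fun x => add_mem (ha.1 x) (hb.1 x), fun x l => by
    simpa [localRep] using (ha.2 x l).add (hb.2 x l)⟩
  zero_mem' := ⟨fun x => zero_mem _, fun x l => by simpa [localRep] using contDiffAt_const⟩
  smul_mem' c a ha := ⟨fun x => Submodule.smul_mem _ c (ha.1 x), fun x l => by
    simpa [localRep] using contDiffAt_const.mul (ha.2 x l)⟩

/-- The Dolbeault operator `∂̄_P` on forms with values in `ad P`. -/
def dbar (s : X → Forms n ⊗[ℂ] LieAlg m G) : X → Forms n ⊗[ℂ] LieAlg m G := fun x =>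
  localDbar (P.localRep s x) (chartAt (Fin n → ℂ) x x)

end HolPrincipalBundle

variable [LieGroup 𝓘(ℂ, Fin m → ℂ) ω G]

/-- A Higgs field on `P`: a holomorphic section `θ` of `ad P ⊗ Ω^1` with `θ ∧ θ = 0`. -/
structure HiggsField (P : HolPrincipalBundle.{u, v, w} n m X G) where
  /-- the section, in the preferred frame at each point -/
  toFun : X → ((Fin n → ℂ) →ₗ[ℂ] LieAlg m G)
  holomorphic : ∀ x e, HolomorphicAt (P.localRepOneForm toFun x e) (chartAt (Fin n → ℂ) x x)
  integrable : ∀ x e e', ⁅toFun x e, toFun x e'⁆ = 0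

/-- The dgla `⨁ A^{0,r}(ad P ⊗ Ω^s)` of a Higgs pair, with differential `∂̄_P + ad θ`. -/
def higgsDGLA (P : HolPrincipalBundle.{u, v, w} n m X G) (θ : HiggsField P) :
    GradedBracket (X → Forms n ⊗[ℂ] LieAlg m G) where
  gr := P.adForms
  d s := P.dbar s + fun x => formBracket n (LieAlg m G) (toLieForm (θ.toFun x)) (s x)
  br := LinearMap.mk₂ ℂ (fun s t x => formBracket n (LieAlg m G) (s x) (t x))
    (fun _ _ _ => by ext; simp) (fun _ _ _ => by ext; simp)
    (fun _ _ _ => by ext; simp) (fun _ _ _ => by ext; simp)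

/-- The maps `h_k = P_{dk}(p)_θ ∘ pr_0`: the `Ω^1`-components of the arguments are inserted in the
polarised Taylor coefficient of `p` at `θ`. The value is a `(0, •)`-form with values in `S^d Ω^1`,
written as a polynomial function of the tangent vector `e`. -/
def hitchinMap {P : HolPrincipalBundle.{u, v, w} n m X G} (θ : HiggsField P)
    (p : LieAlg m G → ℂ) (k : ℕ) :
    MultilinearMap ℂ (fun _ : Fin k => X → Forms n ⊗[ℂ] LieAlg m G)
      (X → (Fin n → ℂ) → Forms n) :=
  MultilinearMap.pi fun x => MultilinearMap.pi fun e =>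
    (formExtend fun Y : Fin k → LieAlg m G => polar p k Y (θ.toFun x e)).compLinearMap fun _ =>
      (LinearMap.rTensor (LieAlg m G) (evalOneZero e)) ∘ₗ LinearMap.proj x

end Bundle

/-! ## Forms with values in the symmetric powers of the cotangent bundle -/

section SymBundle

variable {n : ℕ} {X : Type u} [TopologicalSpace X] [ChartedSpace (Fin n → ℂ) X]
  [IsManifold 𝓘(ℂ, Fin n → ℂ) ω X]

/-- The fibre `Λ^{0,r} ⊗ S^d((ℂⁿ)^∨)`, as a space of polynomial functions on `ℂⁿ` with values in
`Λ^{0,r}`. -/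
def symFibre (n d r : ℕ) : Submodule ℂ ((Fin n → ℂ) → Forms n) :=
  Submodule.span ℂ {t | ∃ q : (Fin n → ℂ) → ℂ, IsHomogPoly d q ∧ ∃ α ∈ formsOfType n r 0,
    t = fun e => q e • α}

/-- Local representative at `x` of a form `t` with values in `S^d Ω^1`, evaluated at `e`. -/
def symLocalRep (t : X → (Fin n → ℂ) → Forms n) (x : X) (e : Fin n → ℂ) :
    (Fin n → ℂ) → Forms n := fun z =>
  let y := (chartAt (Fin n → ℂ) x).symm z
  pullForms (chartJac x y) (t y (chartJac x y e))

/-- The degree `i` part `A^{0,i-1}(S^d Ω^1)` of `A^{0,•}(S^d Ω^1)[-1]`; it is `0` for `i < 1`. -/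
def symForms (n : ℕ) (X : Type u) [TopologicalSpace X] [ChartedSpace (Fin n → ℂ) X]
    [IsManifold 𝓘(ℂ, Fin n → ℂ) ω X] (d : ℕ) (i : ℤ) :
    Submodule ℂ (X → (Fin n → ℂ) → Forms n) where
  carrier := {t | ∀ x, t x ∈ ⨆ (r : ℕ) (_ : (r : ℤ) + 1 = i), symFibre n d r} ∩
    {t | ∀ x e, SmoothAt (symLocalRep t x e) (chartAt (Fin n → ℂ) x x)}
  add_mem' ha hb := ⟨fun x => add_mem (ha.1 x) (hb.1 x), fun x e l => by
    simpa [symLocalRep] using (ha.2 x e l).add (hb.2 x e l)⟩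
  zero_mem' := ⟨fun x => zero_mem _, fun x e l => by
    simpa [symLocalRep] using contDiffAt_const⟩
  smul_mem' c a ha := ⟨fun x => Submodule.smul_mem _ c (ha.1 x), fun x e l => by
    simpa [symLocalRep] using contDiffAt_const.mul (ha.2 x e l)⟩

/-- The abelian dgla `A^{0,•}(S^d Ω^1)[-1]` with differential `∂̄`. -/
def symDGLA (n : ℕ) (X : Type u) [TopologicalSpace X] [ChartedSpace (Fin n → ℂ) X]
    [IsManifold 𝓘(ℂ, Fin n → ℂ) ω X] (d : ℕ) :
    GradedBracket (X → (Fin n → ℂ) → Forms n) where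
  gr := symForms n X d
  d t x e := localDbar (symLocalRep t x e) (chartAt (Fin n → ℂ) x x)
  br := 0

end SymBundle

end

/-! The theorem rests on the infinitesimal form of invariance. On analytic functions on 𝔤, let `D Y`
be differentiation in the constant direction `Y`, and `V X` differentiation along the linear field
`v ↦ ⁅X, v⁆`. The operators `D Y` commute, `D Y * V X = V X * D Y + D ⁅X, Y⁆`, the operator `V X`
kills `p`, and at the point `v` it acts as `D ⁅X, v⁆`. Pushing `V X` rightwards through `D Y_1 ⋯ D
Y_r` until it meets `p` therefore expresses the polarisation with entries `⁅X, v⁆, Y_1, …, Y_r` at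
`v` as minus the sum of those in which one `Y_b` is replaced by `⁅X, Y_b⁆`. `exists_operators`
packages these facts, and `coordForm_lTensor_mul_prod` is the identity with form coefficients and
signs.

The target is abelian, so the right-hand side of the morphism equation is `-∂̄ h_k(s)`, and on the
left only subsets of one or two arguments contribute. Since `θ` is holomorphic, the polarised
coefficients at `θ` are holomorphic too, and `∂̄` falls on the arguments alone
(`symDGLA_d_hitchinMap`); this matches the `∂̄_P` part of the singletons. It remains to cancel the
`ad θ` part of the singletons against the brackets of pairs (`sum_listSign_smul_coordForm_bracket`).
The type `(1, •)` part of `[θ, s_a]` only involves the `(0, •)` part of `s_a`. The identity above,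
with `X` this part, `v = θ(e)` and `Y_b` the `(1, •)` part of `s_b`, gives a sum over ordered pairs,
and the two orders of a pair add up to the `(1, •)` part of `[s_a, s_b]`.

Signs are handled by replacing each argument by an operator-valued form in `Forms n ⊗ 𝔄`. These
graded-commute, and every Koszul sign becomes a `listSign` (`listSign_smul_prod_perm`).

That `V X` kills `p` follows by differentiating `p (Ad g v) = p v` at the identity; the required
fact, that the derivative of `Ad` is the bracket, is `fderiv_Ad`.

Sections are given by their values in a separate frame at each point, so `∂̄` must be shown to be
the usual operator in any fixed frame (`localDbar_changeFrame`, `localRep_dbar`,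
`symLocalRep_dbar`). This holds because the entries of a frame change, values of `Ad` on holomorphic
functions and pullbacks along holomorphic maps, are `∂̄`-closed. The dgla axioms then reduce to
identities at a point, and the maps `h_k` are compatible with frame changes because `p` is
invariant. -/

noncomputable section

/-! ## Integer powers of a submodule of an algebra -/

section IntPow

variable {A B : Type*} [Ring A] [Algebra ℂ A] [Ring B] [Algebra ℂ B]

/-- The power `S ^ i` of a submodule, with the convention `S ^ i = 0` for `i < 0`. -/
def intPow (S : Submodule ℂ A) (i : ℤ) : Submodule ℂ A := ⨆ (r : ℕ) (_ : (r : ℤ) = i), S ^ r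

theorem intPow_natCast (S : Submodule ℂ A) (r : ℕ) : intPow S (r : ℤ) = S ^ r := by
  refine le_antisymm (iSup₂_le fun r' h => ?_) (le_iSup₂_of_le r rfl le_rfl)
  rw [Nat.cast_inj.1 h]

theorem mem_intPow_iff {S : Submodule ℂ A} {i : ℤ} {a : A} :
    a ∈ intPow S i ↔ a = 0 ∨ ∃ r : ℕ, i = r ∧ a ∈ S ^ r := by
  constructor
  · intro h
    rcases le_or_gt 0 i with hi | hi
    · lift i to ℕ using hi
      rw [intPow_natCast] at h
      exact Or.inr ⟨i, rfl, h⟩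
    · left
      have : intPow S i = ⊥ := by
        refine eq_bot_iff.2 (iSup₂_le fun r h => ?_)
        omega
      rwa [this, Submodule.mem_bot] at h
  · rintro (rfl | ⟨r, rfl, h⟩)
    · exact zero_mem _
    · rwa [intPow_natCast]

theorem mul_mem_intPow {S : Submodule ℂ A} {i j : ℤ} {a b : A} (ha : a ∈ intPow S i)
    (hb : b ∈ intPow S j) : a * b ∈ intPow S (i + j) := by
  rcases mem_intPow_iff.1 ha with rfl | ⟨r, rfl, ha'⟩
  · simp
  rcases mem_intPow_iff.1 hb with rfl | ⟨s, rfl, hb'⟩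
  · simp
  rw [← Nat.cast_add, intPow_natCast, pow_add]
  exact Submodule.mul_mem_mul ha' hb'

theorem mem_intPow_one {S : Submodule ℂ A} {a : A} (ha : a ∈ S) : a ∈ intPow S 1 := by
  rw [← Nat.cast_one, intPow_natCast, pow_one]
  exact ha

theorem one_mem_intPow (S : Submodule ℂ A) : (1 : A) ∈ intPow S 0 := by
  rw [← Nat.cast_zero, intPow_natCast, pow_zero]
  exact Submodule.one_le.1 le_rfl

theorem map_mem_intPow (f : A →ₐ[ℂ] B) {S : Submodule ℂ A} {T : Submodule ℂ B}
    (h : ∀ a ∈ S, f a ∈ T) {i : ℤ} {a : A} (ha : a ∈ intPow S i) : f a ∈ intPow T i := by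
  rcases mem_intPow_iff.1 ha with rfl | ⟨r, rfl, ha'⟩
  · simp
  rw [intPow_natCast]
  have h' : S.map f.toLinearMap ≤ T := by
    rintro _ ⟨a, ha, rfl⟩
    exact h a ha
  have := pow_le_pow_left' h' r
  rw [← Submodule.map_pow] at this
  exact this ⟨a, ha', rfl⟩

theorem intPow_mono {S T : Submodule ℂ A} (h : S ≤ T) (i : ℤ) : intPow S i ≤ intPow T i :=
  fun _ ha => map_mem_intPow (AlgHom.id ℂ A) h ha

theorem negOnePow_smul_natCast {M : Type*} [AddCommGroup M] (i : ℕ) (x : M) :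
    (i : ℤ).negOnePow • x = (-1 : ℤ) ^ i • x := by
  rw [Units.smul_def, Int.coe_negOnePow_natCast]

/-- Anticommutation of the generators propagates by two inductions: `key` moves one generator past a
product, then the generators of `a` are moved one at a time. -/
theorem mul_comm_of_mem_pow {S : Submodule ℂ A}
    (hS : ∀ x ∈ S, ∀ y ∈ S, x * y = -(y * x)) {i j : ℕ} {a b : A} (ha : a ∈ S ^ i)
    (hb : b ∈ S ^ j) : a * b = (-1 : ℤ) ^ (i * j) • (b * a) := by
  have key : ∀ x ∈ S, ∀ (j : ℕ), ∀ b ∈ S ^ j, x * b = (-1 : ℤ) ^ j • (b * x) := by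
    intro x hx j b hb
    induction hb using Submodule.pow_induction_on_left' with
    | algebraMap r => simp [Algebra.commutes]
    | add a b i _ _ h1 h2 => rw [mul_add, h1, h2, add_mul, smul_add]
    | mem_mul y hy i b _ ih =>
      rw [← mul_assoc, hS x hx y hy, neg_mul, mul_assoc, ih, pow_succ, mul_smul_comm]
      simp [mul_assoc]
  induction ha using Submodule.pow_induction_on_left' with
  | algebraMap r => simp [Algebra.commutes]
  | add a b i _ _ h1 h2 => rw [mul_add, add_mul, h1, h2, smul_add]
  | mem_mul y hy i a _ ih =>
    rw [mul_assoc, ih, mul_smul_comm, ← mul_assoc, key y hy j b hb, smul_mul_assoc, smul_smul,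
      mul_assoc, ← pow_add]
    congr 2
    simp [Nat.succ_eq_add_one]
    ring

theorem mul_comm_of_mem_intPow {S : Submodule ℂ A}
    (hS : ∀ x ∈ S, ∀ y ∈ S, x * y = -(y * x)) {i j : ℤ} {a b : A} (ha : a ∈ intPow S i)
    (hb : b ∈ intPow S j) : a * b = (i * j).negOnePow • (b * a) := by
  rcases mem_intPow_iff.1 ha with rfl | ⟨r, rfl, ha'⟩
  · simp
  rcases mem_intPow_iff.1 hb with rfl | ⟨s, rfl, hb'⟩
  · simp
  rw [← Nat.cast_mul, negOnePow_smul_natCast]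
  exact mul_comm_of_mem_pow hS ha' hb'

end IntPow

/-! ## The exterior algebra of covectors -/

section ExteriorForms

variable {n : ℕ}

/-- Forms of total degree `i`. -/
abbrev formsDegree (n : ℕ) (i : ℤ) : Submodule ℂ (Forms n) :=
  intPow (LinearMap.range (ExteriorAlgebra.ι ℂ : Covector n →ₗ[ℂ] Forms n)) i

/-- Forms of type `(0, i)`. -/
abbrev antiForms (n : ℕ) (i : ℤ) : Submodule ℂ (Forms n) :=
  intPow ((antiCovector n).map (ExteriorAlgebra.ι ℂ : Covector n →ₗ[ℂ] Forms n)) i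

theorem ι_mul_ι_comm (a b : Covector n) : (ExteriorAlgebra.ι ℂ a * ExteriorAlgebra.ι ℂ b : Forms n)
    = -(ExteriorAlgebra.ι ℂ b * ExteriorAlgebra.ι ℂ a) :=
  eq_neg_of_add_eq_zero_left (ExteriorAlgebra.ι_add_mul_swap a b)

theorem forms_mul_comm {i j : ℤ} {a b : Forms n} (ha : a ∈ formsDegree n i)
    (hb : b ∈ formsDegree n j) : a * b = (i * j).negOnePow • (b * a) := by
  refine mul_comm_of_mem_intPow ?_ ha hb
  rintro _ ⟨x, rfl⟩ _ ⟨y, rfl⟩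
  exact ι_mul_ι_comm x y

theorem antiForms_le (i : ℤ) : antiForms n i ≤ formsDegree n i :=
  intPow_mono (LinearMap.map_le_range) i

theorem ι_mem_formsDegree (l : Covector n) : ExteriorAlgebra.ι ℂ l ∈ formsDegree n 1 :=
  mem_intPow_one ⟨l, rfl⟩

theorem ι_mem_antiForms {l : Covector n} (hl : l ∈ antiCovector n) :
    ExteriorAlgebra.ι ℂ l ∈ antiForms n 1 :=
  mem_intPow_one ⟨l, hl, rfl⟩

theorem antiPart_mem (l : Covector n) : antiPart l ∈ antiCovector n := by
  intro x
  have h : l (Complex.I • Complex.I • x) = - l x := by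
    rw [smul_smul, Complex.I_mul_I, neg_smul, one_smul, map_neg]
  simp only [antiPart, LinearMap.coe_mk, AddHom.coe_mk, h]
  linear_combination (1 / 2 : ℂ) * l (Complex.I • x) * Complex.I_mul_I

theorem antiPart_of_mem {l : Covector n} (hl : l ∈ antiCovector n) : antiPart l = l := by
  refine LinearMap.ext fun x => ?_
  simp only [antiPart, LinearMap.coe_mk, AddHom.coe_mk, hl x]
  linear_combination (-1 / 2 : ℂ) * l x * Complex.I_mul_I

theorem antiPart_of_mem_hol {l : Covector n} (hl : l ∈ holCovector n) : antiPart l = 0 := by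
  refine LinearMap.ext fun x => ?_
  simp only [antiPart, LinearMap.coe_mk, AddHom.coe_mk, hl x, LinearMap.zero_apply]
  linear_combination (1 / 2 : ℂ) * l x * Complex.I_mul_I

theorem sub_antiPart_mem (l : Covector n) : l - antiPart l ∈ holCovector n := by
  intro x
  have h : l (Complex.I • Complex.I • x) = - l x := by
    rw [smul_smul, Complex.I_mul_I, neg_smul, one_smul, map_neg]
  simp only [antiPart, LinearMap.coe_mk, AddHom.coe_mk, LinearMap.sub_apply, h]
  linear_combination (1 / 2 : ℂ) * l (Complex.I • x) * Complex.I_mul_I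

theorem evalHol_of_mem_anti (e : Fin n → ℂ) {l : Covector n} (hl : l ∈ antiCovector n) :
    evalHol e l = 0 := by
  simp only [evalHol, LinearMap.coe_mk, AddHom.coe_mk, hl e]
  linear_combination (1 / 2 : ℂ) * l e * Complex.I_mul_I

theorem evalHol_of_mem_hol (e : Fin n → ℂ) {l : Covector n} (hl : l ∈ holCovector n) :
    evalHol e l = l e := by
  simp only [evalHol, LinearMap.coe_mk, AddHom.coe_mk, hl e]
  linear_combination (-1 / 2 : ℂ) * l e * Complex.I_mul_I

theorem dzbar_mem (j : Fin n) : dzbar j ∈ antiCovector n := by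
  intro x
  simp [dzbar]

theorem dz_mem (j : Fin n) : dz j ∈ holCovector n := by
  intro x
  simp [dz]

theorem formsOfType_zero_right (r : ℕ) : formsOfType n r 0 = antiForms n r := by
  rw [formsOfType, pow_zero, mul_one, antiForms, intPow_natCast]

/-- Every covector is the sum of its `(0, 1)` and `(1, 0)` parts, so a product can be expanded by
induction on its length. A new `(1, 0)` factor on the left is carried past the `(0, 1)` factors by
`hBA`; this costs a sign, which a submodule does not see. -/
theorem iSup_formsOfType (n : ℕ) (i : ℤ) :
    ⨆ (r : ℕ) (s : ℕ) (_ : (r : ℤ) + s = i), formsOfType n r s = formsDegree n i := by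
  set A := (antiCovector n).map (ExteriorAlgebra.ι ℂ : Covector n →ₗ[ℂ] Forms n)
  set B := (holCovector n).map (ExteriorAlgebra.ι ℂ : Covector n →ₗ[ℂ] Forms n)
  set C := LinearMap.range (ExteriorAlgebra.ι ℂ : Covector n →ₗ[ℂ] Forms n)
  have hA : A ≤ C := LinearMap.map_le_range
  have hB : B ≤ C := LinearMap.map_le_range
  have hC : C ≤ A ⊔ B := by
    rintro _ ⟨l, rfl⟩
    rw [← add_sub_cancel (antiPart l) l, map_add]
    exact add_mem (Submodule.mem_sup_left ⟨_, antiPart_mem l, rfl⟩)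
      (Submodule.mem_sup_right ⟨_, sub_antiPart_mem l, rfl⟩)
  have hBA : ∀ r : ℕ, B * A ^ r ≤ A ^ r * B := by
    intro r
    refine Submodule.mul_le.2 ?_
    rintro _ ⟨b, hb, rfl⟩ a ha
    rw [mul_comm_of_mem_pow (S := C) (i := 1) (j := r) ?_ ?_ (pow_le_pow_left' hA r ha)]
    · exact Submodule.smul_of_tower_mem _ _ (Submodule.mul_mem_mul ha ⟨b, hb, rfl⟩)
    · rintro _ ⟨x, rfl⟩ _ ⟨y, rfl⟩
      exact ι_mul_ι_comm x y
    · rw [pow_one]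
      exact ⟨b, rfl⟩
  refine le_antisymm (iSup_le fun r => iSup₂_le fun s h => ?_) (iSup₂_le fun t ht => ?_)
  · rw [← h, ← Nat.cast_add, formsDegree, intPow_natCast, pow_add]
    exact mul_le_mul' (pow_le_pow_left' hA r) (pow_le_pow_left' hB s)
  · subst ht
    induction t with
    | zero =>
      refine le_iSup_of_le 0 (le_iSup₂_of_le 0 (by simp) ?_)
      simp [formsOfType]
    | succ t ih =>
      rw [pow_succ']
      refine (mul_le_mul' hC ih).trans ?_
      simp only [Submodule.mul_iSup, Submodule.sup_mul]
      refine iSup_le fun r => iSup₂_le fun s h => sup_le ?_ ?_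
      · refine le_iSup_of_le (r + 1) (le_iSup₂_of_le s (by push_cast; omega) ?_)
        rw [formsOfType, formsOfType, ← mul_assoc, pow_succ']
      · refine le_iSup_of_le r (le_iSup₂_of_le (s + 1) (by push_cast; omega) ?_)
        rw [formsOfType, formsOfType, ← mul_assoc, pow_succ', ← mul_assoc]
        exact mul_le_mul' (hBA r) le_rfl

/-- This is the natural grading of the exterior algebra; the pieces in negative degree are zero. -/
theorem iSupIndep_formsDegree (n : ℕ) : iSupIndep (formsDegree n) := by
  have h := (DirectSum.Decomposition.isInternal
    (fun i : ℕ => ⋀[ℂ]^i (Covector n))).submodule_iSupIndep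
  rw [iSupIndep_def] at h ⊢
  intro i
  rw [Submodule.disjoint_def]
  intro x hx hx'
  rcases mem_intPow_iff.1 hx with rfl | ⟨r, rfl, hr⟩
  · rfl
  refine (Submodule.disjoint_def.1 (h r)) x hr (SetLike.le_def.1 (iSup₂_le fun j hj => ?_) hx')
  refine iSup₂_le fun s hs => ?_
  exact le_iSup₂_of_le s (by rintro rfl; exact hj hs.symm) le_rfl

theorem forms_right_induction {C : Forms n → Prop}
    (algebraMap : ∀ c, C (algebraMap ℂ (Forms n) c)) (add : ∀ x y, C x → C y → C (x + y))
    (mul_ι : ∀ x l, C x → C (x * ExteriorAlgebra.ι ℂ l)) (x : Forms n) : C x :=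
  @CliffordAlgebra.right_induction _ _ _ _ _ (0 : QuadraticForm ℂ (Covector n)) C algebraMap add
    (fun l x => mul_ι x l) x

/-! ### Pullback -/

theorem pullForms_ι (A : (Fin n → ℂ) →L[ℂ] (Fin n → ℂ)) (l : Covector n) :
    pullForms A (ExteriorAlgebra.ι ℂ l) = ExteriorAlgebra.ι ℂ (pullCovector A l) :=
  ExteriorAlgebra.map_apply_ι _ _

theorem pullForms_id : pullForms (ContinuousLinearMap.id ℂ (Fin n → ℂ)) = AlgHom.id ℂ _ := by
  rw [pullForms, ← ExteriorAlgebra.map_id]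
  rfl

theorem pullForms_comp (A B : (Fin n → ℂ) →L[ℂ] (Fin n → ℂ)) (a : Forms n) :
    pullForms (A.comp B) a = pullForms B (pullForms A a) := by
  rw [pullForms, pullForms, pullForms, ← AlgHom.comp_apply, ExteriorAlgebra.map_comp_map]
  rfl

theorem pullForms_mem_formsDegree (A : (Fin n → ℂ) →L[ℂ] (Fin n → ℂ)) {i : ℤ} {a : Forms n}
    (ha : a ∈ formsDegree n i) : pullForms A a ∈ formsDegree n i := by
  refine map_mem_intPow _ ?_ ha
  rintro _ ⟨l, rfl⟩
  exact ⟨_, (pullForms_ι A l).symm⟩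

theorem pullCovector_mem_anti (A : (Fin n → ℂ) →L[ℂ] (Fin n → ℂ)) {l : Covector n}
    (hl : l ∈ antiCovector n) : pullCovector A l ∈ antiCovector n := by
  intro x
  have := hl (A x)
  simpa [pullCovector] using this

theorem pullForms_mem_antiForms (A : (Fin n → ℂ) →L[ℂ] (Fin n → ℂ)) {i : ℤ} {a : Forms n}
    (ha : a ∈ antiForms n i) : pullForms A a ∈ antiForms n i := by
  refine map_mem_intPow _ ?_ ha
  rintro _ ⟨l, hl, rfl⟩
  rw [pullForms_ι]
  exact ⟨_, pullCovector_mem_anti A hl, rfl⟩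

/-! ### The projections to types `(0, •)` and `(1, •)` -/

/-- The projection of forms onto the forms of type `(0, •)`. -/
def antiProj (n : ℕ) : Forms n →ₐ[ℂ] Forms n := ExteriorAlgebra.map antiPart

theorem antiProj_ι (l : Covector n) :
    antiProj n (ExteriorAlgebra.ι ℂ l) = ExteriorAlgebra.ι ℂ (antiPart l) :=
  ExteriorAlgebra.map_apply_ι _ _

theorem antiProj_mem {i : ℤ} {a : Forms n} (ha : a ∈ formsDegree n i) :
    antiProj n a ∈ antiForms n i := by
  refine map_mem_intPow _ ?_ ha
  rintro _ ⟨l, rfl⟩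
  rw [antiProj_ι]
  exact ⟨_, antiPart_mem l, rfl⟩

/-- Contraction of forms from the right. -/
def formContract (d : Module.Dual ℂ (Covector n)) : Forms n →ₗ[ℂ] Forms n :=
  CliffordAlgebra.contractRight.flip d

theorem evalOneZero_apply (e : Fin n → ℂ) (a : Forms n) :
    evalOneZero e a = antiProj n (formContract (evalHol e) a) := rfl

theorem formContract_mul_ι (d : Module.Dual ℂ (Covector n)) (b : Forms n) (l : Covector n) :
    formContract d (b * ExteriorAlgebra.ι ℂ l) = d l • b -
      formContract d b * ExteriorAlgebra.ι ℂ l :=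
  CliffordAlgebra.contractRight_mul_ι _ _ _

theorem formContract_one (d : Module.Dual ℂ (Covector n)) : formContract d (1 : Forms n) = 0 :=
  CliffordAlgebra.contractRight_one (Q := (0 : QuadraticForm ℂ (Covector n))) d

theorem formContract_ι (d : Module.Dual ℂ (Covector n)) (l : Covector n) :
    formContract d (ExteriorAlgebra.ι ℂ l) = algebraMap ℂ (Forms n) (d l) :=
  CliffordAlgebra.contractRight_ι (Q := (0 : QuadraticForm ℂ (Covector n))) d l

/-- Contraction from the right meets `b` first, so the sign sits on the term where it has to pass
`b` to reach `a`. -/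
theorem formContract_mul (d : Module.Dual ℂ (Covector n)) (a : Forms n) {j : ℤ} {b : Forms n}
    (hb : b ∈ formsDegree n j) :
    formContract d (a * b) = a * formContract d b + j.negOnePow • (formContract d a * b) := by
  rcases mem_intPow_iff.1 hb with rfl | ⟨r, rfl, hb'⟩
  · simp
  rw [negOnePow_smul_natCast]
  clear hb
  induction hb' using Submodule.pow_induction_on_right' with
  | algebraMap c =>
    simp [Algebra.algebraMap_eq_smul_one, formContract_one]
  | add x y i _ _ h1 h2 =>
    rw [mul_add, map_add, map_add, h1, h2, mul_add, mul_add, smul_add]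
    abel
  | mul_mem i x hx ih m hm =>
    obtain ⟨l, rfl⟩ := hm
    rw [← mul_assoc, formContract_mul_ι, formContract_mul_ι, ih, pow_succ]
    simp only [mul_sub, add_mul, smul_mul_assoc, mul_assoc, mul_smul_comm, mul_neg, mul_one,
      neg_smul]
    abel

theorem formContract_mem (d : Module.Dual ℂ (Covector n)) {j : ℤ} {b : Forms n}
    (hb : b ∈ formsDegree n (j + 1)) : formContract d b ∈ formsDegree n j := by
  rcases mem_intPow_iff.1 hb with rfl | ⟨r, hr, hb'⟩
  · simp
  -- For `r = 0` the target degree is `-1`, where the piece is zero; this is consistent because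
  -- constants contract to zero.
  obtain rfl : j = (r : ℤ) - 1 := by omega
  clear hr hb
  induction hb' using Submodule.pow_induction_on_right' with
  | algebraMap c =>
    simp [Algebra.algebraMap_eq_smul_one, formContract_one]
  | add x y i _ _ h1 h2 =>
    rw [map_add]
    exact add_mem h1 h2
  | mul_mem i x hx ih m hm =>
    obtain ⟨l, rfl⟩ := hm
    rw [formContract_mul_ι]
    refine sub_mem (Submodule.smul_mem _ _ ?_) ?_
    · rwa [Nat.succ_eq_add_one, Nat.cast_add, Nat.cast_one, add_sub_cancel_right, formsDegree,
        intPow_natCast]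
    · have := mul_mem_intPow ih (ι_mem_formsDegree l)
      rwa [sub_add_cancel, ← add_sub_cancel_right (i : ℤ) 1, ← Nat.cast_succ] at this

theorem evalOneZero_mem (e : Fin n → ℂ) {j : ℤ} {b : Forms n} (hb : b ∈ formsDegree n (j + 1)) :
    evalOneZero e b ∈ antiForms n j :=
  antiProj_mem (formContract_mem _ hb)

/-- A product has exactly one `(1, 0)` factor when one of the two forms supplies it and the other is
of type `(0, •)`. Formally, `antiProj` is multiplicative and is applied to the contraction rule. -/
theorem evalOneZero_mul (e : Fin n → ℂ) (a : Forms n) {j : ℤ} {b : Forms n}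
    (hb : b ∈ formsDegree n j) : evalOneZero e (a * b) =
      antiProj n a * evalOneZero e b + j.negOnePow • (evalOneZero e a * antiProj n b) := by
  simp only [evalOneZero_apply, formContract_mul _ a hb, map_add, map_mul, Units.smul_def,
    map_zsmul]

/-- A factor `dz̄_j` is invisible to `evalHol` and fixed by `antiPart`. No sign appears because the
contraction acts from the right while `dz̄_j` stands on the left; thus `∂̄` commutes with taking the
`(1, •)` part. -/
theorem evalOneZero_dzbar_mul (e : Fin n → ℂ) (j : Fin n) (a : Forms n) :
    evalOneZero e (ExteriorAlgebra.ι ℂ (dzbar j) * a) =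
      ExteriorAlgebra.ι ℂ (dzbar j) * evalOneZero e a := by
  have key : ∀ a : Forms n, formContract (evalHol e) (ExteriorAlgebra.ι ℂ (dzbar j) * a) =
      ExteriorAlgebra.ι ℂ (dzbar j) * formContract (evalHol e) a := by
    intro a
    induction a using forms_right_induction with
    | algebraMap c =>
      simp only [Algebra.algebraMap_eq_smul_one, mul_smul_comm, mul_one, map_smul,
        formContract_one, formContract_ι]
      simp [evalHol_of_mem_anti _ (dzbar_mem j)]
    | add x y hx hy => rw [mul_add, map_add, map_add, hx, hy, mul_add]
    | mul_ι x m hx =>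
      rw [← mul_assoc]
      rw [formContract_mul_ι, formContract_mul_ι, hx, mul_sub, mul_smul_comm, mul_assoc]
  rw [evalOneZero_apply, key, map_mul, antiProj_ι, antiPart_of_mem (dzbar_mem j),
    evalOneZero_apply]

/-- The projection kills `dz_j`, so only the term in which `dz_j` itself is contracted survives,
after passing `a`. -/
theorem evalOneZero_dz_mul (e : Fin n → ℂ) (j : Fin n) {i : ℤ} {a : Forms n}
    (ha : a ∈ formsDegree n i) : evalOneZero e (ExteriorAlgebra.ι ℂ (dz j) * a) =
      i.negOnePow • (e j • antiProj n a) := by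
  rw [evalOneZero_mul e _ ha, antiProj_ι, antiPart_of_mem_hol (dz_mem j), map_zero, zero_mul,
    zero_add, evalOneZero_apply, formContract_ι, evalHol_of_mem_hol _ (dz_mem j)]
  simp [dz, Algebra.algebraMap_eq_smul_one]

/-- A complex linear map respects types, so both the contraction and the projection are natural.
This is the part of the frame independence of `h_k` that concerns the forms. -/
theorem evalOneZero_pullForms (A : (Fin n → ℂ) →L[ℂ] (Fin n → ℂ)) (e : Fin n → ℂ) (a : Forms n) :
    evalOneZero e (pullForms A a) = pullForms A (evalOneZero (A e) a) := by
  have h1 : ∀ l : Covector n, evalHol e (pullCovector A l) = evalHol (A e) l := by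
    intro l
    simp [evalHol, pullCovector]
  have h2 : ∀ a : Forms n, formContract (evalHol e) (pullForms A a) =
      pullForms A (formContract (evalHol (A e)) a) := by
    intro a
    induction a using forms_right_induction with
    | algebraMap c =>
      simp only [Algebra.algebraMap_eq_smul_one, map_smul, map_one,
        formContract_one, smul_zero, map_zero]
    | add x y hx hy => rw [map_add, map_add, map_add, map_add, hx, hy]
    | mul_ι x m hx =>
      rw [formContract_mul_ι, map_mul, pullForms_ι, formContract_mul_ι, hx, h1, map_sub, map_smul,
        map_mul, pullForms_ι]
  have h3 : ∀ a : Forms n, antiProj n (pullForms A a) = pullForms A (antiProj n a) := by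
    intro a
    have : (antiProj n).comp (pullForms A) = (pullForms A).comp (antiProj n) := by
      refine ExteriorAlgebra.hom_ext (LinearMap.ext fun l => ?_)
      simp only [LinearMap.comp_apply, AlgHom.toLinearMap_apply, AlgHom.comp_apply, pullForms_ι,
        antiProj_ι]
      congr 1
      refine LinearMap.ext fun x => ?_
      simp [antiPart, pullCovector]
    exact DFunLike.congr_fun this a
  rw [evalOneZero_apply, h2, h3, evalOneZero_apply]

end ExteriorForms

/-! ## Koszul signs of lists -/

section ListSign

variable {α : Type*} [LinearOrder α]

/-- The Koszul sign of moving `x` past the smaller elements of `l`. -/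
def headSign (n : α → ℤ) (x : α) (l : List α) : ℤˣ :=
  (l.map fun y => if y < x then (n x * n y).negOnePow else 1).prod

/-- The Koszul sign of sorting `l`. -/
def listSign (n : α → ℤ) : List α → ℤˣ
  | [] => 1
  | x :: l => headSign n x l * listSign n l

theorem headSign_perm (n : α → ℤ) (x : α) {l l' : List α} (h : l.Perm l') :
    headSign n x l = headSign n x l' :=
  (h.map _).prod_eq

theorem headSign_cons (n : α → ℤ) (x y : α) (l : List α) :
    headSign n x (y :: l) = (if y < x then (n x * n y).negOnePow else 1) * headSign n x l :=
  List.prod_cons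

theorem units_mul_self_eq_one (a : ℤˣ) : a * a = 1 := Int.units_mul_self a

/-- Exactly one of the two orders is an inversion, and the sign of the pair is its own inverse, so
the same formula serves both cases. -/
theorem listSign_swap (n : α → ℤ) {x y : α} (hxy : x ≠ y) (l : List α) :
    listSign n (x :: y :: l) = (n x * n y).negOnePow * listSign n (y :: x :: l) := by
  simp only [listSign, headSign_cons, mul_comm (n y) (n x)]
  rcases lt_or_gt_of_ne hxy with h | h
  · simp only [h, h.asymm, if_true, if_false, one_mul]
    rw [mul_assoc (n x * n y).negOnePow, ← mul_assoc (n x * n y).negOnePow,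
      units_mul_self_eq_one, one_mul]
    ac_rfl
  · simp only [h, h.asymm, if_true, if_false, one_mul]
    ac_rfl

/-- `listSign` is the sign that compensates graded commutation, so the signed product does not
depend on the order of the factors; only the adjacent swap needs an argument. All reorderings of
operator-valued forms pass through here. -/
theorem listSign_smul_prod_perm {R : Type*} [Ring R] (n : α → ℤ) (U : α → R)
    (hU : ∀ x y, U x * U y = (n x * n y).negOnePow • (U y * U x)) {l l' : List α}
    (h : l.Perm l') (hl : l.Nodup) :
    listSign n l • (l.map U).prod = listSign n l' • (l'.map U).prod := by
  induction h with
  | nil => rfl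
  | cons x h ih =>
    have := ih (List.nodup_cons.1 hl).2
    simp only [listSign, List.map_cons, List.prod_cons, headSign_perm n x h, mul_smul]
    rw [← mul_smul_comm, this, mul_smul_comm]
  | swap x y l =>
    have hxy : y ≠ x := by
      rintro rfl
      simp at hl
    rw [listSign_swap n hxy, mul_comm (n y * n x).negOnePow, mul_smul]
    simp only [List.map_cons, List.prod_cons]
    rw [← mul_assoc, hU y x, smul_mul_assoc, smul_smul (n y * n x).negOnePow (n y * n x).negOnePow,
      units_mul_self_eq_one, one_smul, mul_assoc]
  | trans h1 h2 ih1 ih2 => exact (ih1 hl).trans (ih2 (h1.nodup hl))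

theorem listSign_eq_one_of_sorted (n : α → ℤ) {l : List α} (h : l.Pairwise (· ≤ ·)) :
    listSign n l = 1 := by
  induction l with
  | nil => rfl
  | cons x l ih =>
    rw [List.pairwise_cons] at h
    rw [listSign, ih h.2, mul_one, headSign]
    refine List.prod_eq_one fun a ha => ?_
    obtain ⟨y, hy, rfl⟩ := List.mem_map.1 ha
    rw [if_neg (h.1 y hy).not_gt]

/-- When `l` lists the indices by `f` and then by position, the pairs inverted by `f` are precisely
those standing in decreasing order in `l`. The proof peels off the head of `l`, which no later entry
precedes with respect to `f`. -/
theorem koszulSign_eq_listSign {k : ℕ} {β : Type*} [LinearOrder β] (f : Fin k → β)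
    (n : Fin k → ℤ) {l : List (Fin k)} (hl : l.Nodup) (hm : ∀ i, i ∈ l)
    (hs : l.Pairwise fun i j => f i < f j ∨ f i = f j ∧ i < j) :
    koszulSign f n = listSign n l := by
  have key : ∀ l : List (Fin k), (l.Pairwise fun i j => f i < f j ∨ f i = f j ∧ i < j) →
      (l.map fun x => (l.map fun y =>
        if y < x ∧ f x < f y then (n x * n y).negOnePow else 1).prod).prod = listSign n l := by
    intro l hs
    induction l with
    | nil => rfl
    | cons x l ih =>
      rw [List.pairwise_cons] at hs
      rw [listSign, ← ih hs.2, List.map_cons, List.prod_cons, List.map_cons, List.prod_cons]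
      congr 1
      · rw [if_neg (fun h => lt_irrefl _ h.1), one_mul, headSign]
        congr 1
        refine List.map_congr_left fun y hy => ?_
        rcases hs.1 y hy with h | ⟨h1, h2⟩
        · simp [h]
        · simp [h1, h2.not_gt]
      · congr 1
        refine List.map_congr_left fun y hy => ?_
        rw [List.map_cons, List.prod_cons, if_neg, one_mul]
        rintro ⟨h1, h2⟩
        rcases hs.1 y hy with h | ⟨h, _⟩
        · exact h.asymm h2
        · exact h2.ne' h
  have huniv : l.toFinset = Finset.univ := by
    ext i
    simp [hm]
  rw [← key l hs, koszulSign, Finset.prod_comm, ← huniv, List.prod_toFinset _ hl]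
  congr 1
  refine List.map_congr_left fun x _ => ?_
  rw [List.prod_toFinset _ hl]
  congr 1
  refine List.map_congr_left fun y _ => ?_
  rw [mul_comm (n y)]

end ListSign

/-! ## Forms with values in a Lie algebra -/

section LieForms

variable {n : ℕ} {L : Type*}

section Module

variable [AddCommGroup L] [Module ℂ L]

/-- The tensors with form components in `S`. -/
abbrev tensorIn (L : Type*) [AddCommGroup L] [Module ℂ L] (S : Submodule ℂ (Forms n)) :
    Submodule ℂ (Forms n ⊗[ℂ] L) :=
  Submodule.map₂ (TensorProduct.mk ℂ (Forms n) L) S ⊤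

theorem tmul_mem_tensorIn {S : Submodule ℂ (Forms n)} {a : Forms n} (ha : a ∈ S) (X : L) :
    a ⊗ₜ X ∈ tensorIn L S :=
  Submodule.apply_mem_map₂ _ ha trivial

/-- A scalar can be absorbed in the form factor of a pure tensor. Proving the claim for all
multiples of an element therefore removes the scalar case from the induction. -/
theorem tensorIn_induction {S : Submodule ℂ (Forms n)}
    {C : (u : Forms n ⊗[ℂ] L) → u ∈ tensorIn L S → Prop} (zero : C 0 (zero_mem _))
    (add : ∀ u w hu hw, C u hu → C w hw → C (u + w) (add_mem hu hw))
    (tmul : ∀ a (ha : a ∈ S) (X : L), C (a ⊗ₜ X) (tmul_mem_tensorIn ha X))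
    {u : Forms n ⊗[ℂ] L} (hu : u ∈ tensorIn L S) : C u hu := by
  have h : ∀ w ∈ tensorIn L S, ∀ c : ℂ, ∃ h, C (c • w) h := by
    intro w hw
    rw [tensorIn, Submodule.map₂_eq_span_image2] at hw
    induction hw using Submodule.span_induction with
    | mem u hu =>
      obtain ⟨a, ha, X, -, rfl⟩ := hu
      exact fun c => ⟨_, tmul (c • a) (S.smul_mem c ha) X⟩
    | zero =>
      intro c
      rw [smul_zero]
      exact ⟨_, zero⟩
    | add u w _ _ hu hw =>
      intro c
      obtain ⟨h1, h1'⟩ := hu c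
      obtain ⟨h2, h2'⟩ := hw c
      rw [smul_add]
      exact ⟨_, add _ _ h1 h2 h1' h2'⟩
    | smul c u _ hu =>
      intro c'
      rw [smul_smul]
      exact hu _
  obtain ⟨h, h'⟩ := h u hu 1
  simpa using h'

theorem map_mem_tensorIn {L' : Type*} [AddCommGroup L'] [Module ℂ L'] {S T : Submodule ℂ (Forms n)}
    {f : Forms n →ₗ[ℂ] Forms n} {g : L →ₗ[ℂ] L'} (h : ∀ a ∈ S, f a ∈ T) {u : Forms n ⊗[ℂ] L}
    (hu : u ∈ tensorIn L S) : TensorProduct.map f g u ∈ tensorIn L' T := by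
  induction hu using tensorIn_induction with
  | zero => simp
  | add u w _ _ hu hw =>
    rw [map_add]
    exact add_mem hu hw
  | tmul a ha X => exact tmul_mem_tensorIn (h a ha) _

/-- The bracket and its signs only see the total degree, so the bidegrees are discarded at once. -/
theorem lieFormsOfDegree_eq (i : ℤ) : lieFormsOfDegree n L i = tensorIn L (formsDegree n i) := by
  simp only [tensorIn, ← iSup_formsOfType, Submodule.map₂_iSup_left, lieFormsOfDegree]

/-- The coordinate of an `L`-valued form with respect to a linear functional on `L`. -/
def coordForm (l : Module.Dual ℂ L) : Forms n ⊗[ℂ] L →ₗ[ℂ] Forms n :=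
  (TensorProduct.rid ℂ (Forms n)).toLinearMap ∘ₗ LinearMap.lTensor (Forms n) l

theorem coordForm_tmul (l : Module.Dual ℂ L) (a : Forms n) (X : L) :
    coordForm l (a ⊗ₜ[ℂ] X) = l X • a := by
  simp [coordForm]

theorem sum_coordForm_tmul [Module.Finite ℂ L] (u : Forms n ⊗[ℂ] L) :
    ∑ b, coordForm ((Module.finBasis ℂ L).coord b) u ⊗ₜ[ℂ] Module.finBasis ℂ L b = u := by
  induction u with
  | zero => simp
  | add u w hu hw =>
    conv_rhs => rw [← hu, ← hw, ← Finset.sum_add_distrib]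
    simp [TensorProduct.add_tmul]
  | tmul a X =>
    simp only [coordForm_tmul, TensorProduct.smul_tmul, ← TensorProduct.tmul_sum]
    congr 1
    exact (Module.finBasis ℂ L).sum_repr X

/-- An `L`-valued form is determined by its coordinates in a basis of `L`, and these have the same
degree, so independence is inherited from scalar forms. -/
theorem iSupIndep_lieFormsOfDegree [Module.Finite ℂ L] : iSupIndep (lieFormsOfDegree n L) := by
  have h := iSupIndep_formsDegree n
  rw [iSupIndep_def] at h ⊢
  intro i
  rw [Submodule.disjoint_def]
  intro u hu hu'
  rw [← sum_coordForm_tmul u]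
  refine Finset.sum_eq_zero fun b _ => ?_
  have hmap : ∀ j, lieFormsOfDegree n L j ≤
      (formsDegree n j).comap (coordForm ((Module.finBasis ℂ L).coord b)) := by
    intro j
    rw [lieFormsOfDegree_eq, Submodule.map₂_le]
    intro a ha X _
    rw [Submodule.mem_comap, TensorProduct.mk_apply, coordForm_tmul]
    exact Submodule.smul_mem _ _ ha
  have h0 : coordForm ((Module.finBasis ℂ L).coord b) u = 0 := by
    refine Submodule.disjoint_def.1 (h i) _ (hmap i hu) ?_
    have := SetLike.le_def.1 (iSup₂_mono fun j (_ : j ≠ i) => hmap j) hu'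
    have hle : ⨆ j, ⨆ (_ : j ≠ i), (formsDegree n j).comap
        (coordForm ((Module.finBasis ℂ L).coord b)) ≤ (⨆ j, ⨆ (_ : j ≠ i), formsDegree n j).comap
        (coordForm ((Module.finBasis ℂ L).coord b)) :=
      iSup₂_le fun j hj => Submodule.comap_mono (le_iSup₂_of_le j hj le_rfl)
    exact hle this
  rw [h0, TensorProduct.zero_tmul]

/-- The projection of `L`-valued forms to type `(1, •)`, evaluated at `e`. -/
abbrev evalOneZeroL (L : Type*) [AddCommGroup L] [Module ℂ L] (e : Fin n → ℂ) :
    Forms n ⊗[ℂ] L →ₗ[ℂ] Forms n ⊗[ℂ] L :=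
  LinearMap.rTensor L (evalOneZero e)

/-- The projection of `L`-valued forms to type `(0, •)`. -/
abbrev antiProjL (L : Type*) [AddCommGroup L] [Module ℂ L] :
    Forms n ⊗[ℂ] L →ₗ[ℂ] Forms n ⊗[ℂ] L :=
  LinearMap.rTensor L (antiProj n).toLinearMap

theorem evalOneZeroL_mem (e : Fin n → ℂ) {i : ℤ} {u : Forms n ⊗[ℂ] L}
    (hu : u ∈ tensorIn L (formsDegree n (i + 1))) :
    evalOneZeroL L e u ∈ tensorIn L (antiForms n i) :=
  map_mem_tensorIn (fun _ => evalOneZero_mem e) hu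

theorem antiProjL_mem {i : ℤ} {u : Forms n ⊗[ℂ] L} (hu : u ∈ tensorIn L (formsDegree n i)) :
    antiProjL L u ∈ tensorIn L (antiForms n i) :=
  map_mem_tensorIn (fun _ => antiProj_mem) hu

theorem tensorIn_antiForms_le (i : ℤ) :
    tensorIn L (antiForms n i) ≤ tensorIn L (formsDegree n i) :=
  Submodule.map₂_le_map₂_left (antiForms_le i)

theorem smul_mem_tensorIn {i j : ℤ} {η : Forms n} (hη : η ∈ formsDegree n i) {u : Forms n ⊗[ℂ] L}
    (hu : u ∈ tensorIn L (formsDegree n j)) : η • u ∈ tensorIn L (formsDegree n (i + j)) := by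
  induction hu using tensorIn_induction with
  | zero => simp
  | add u w _ _ hu hw =>
    rw [smul_add]
    exact add_mem hu hw
  | tmul a ha X =>
    rw [TensorProduct.smul_tmul']
    exact tmul_mem_tensorIn (mul_mem_intPow hη ha) _

theorem evalOneZeroL_dzbar_smul (e : Fin n → ℂ) (j : Fin n) (u : Forms n ⊗[ℂ] L) :
    evalOneZeroL L e (ExteriorAlgebra.ι ℂ (dzbar j) • u) =
      ExteriorAlgebra.ι ℂ (dzbar j) • evalOneZeroL L e u := by
  induction u with
  | zero => simp
  | add u w hu hw => rw [smul_add, map_add, map_add, smul_add, hu, hw]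
  | tmul a X =>
    simp only [TensorProduct.smul_tmul', LinearMap.rTensor_tmul, smul_eq_mul,
      evalOneZero_dzbar_mul]

theorem map_pullForms_smul (A : (Fin n → ℂ) →L[ℂ] (Fin n → ℂ)) {L' : Type*} [AddCommGroup L']
    [Module ℂ L'] (g : L →ₗ[ℂ] L') (η : Forms n) (u : Forms n ⊗[ℂ] L) :
    TensorProduct.map (pullForms A).toLinearMap g (η • u) =
      pullForms A η • TensorProduct.map (pullForms A).toLinearMap g u := by
  induction u with
  | zero => simp
  | add u w hu hw => rw [smul_add, map_add, map_add, smul_add, hu, hw]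
  | tmul a X => simp [TensorProduct.smul_tmul']

theorem evalOneZeroL_map (A : (Fin n → ℂ) →L[ℂ] (Fin n → ℂ)) {L' : Type*} [AddCommGroup L']
    [Module ℂ L'] (g : L →ₗ[ℂ] L') (e : Fin n → ℂ) (u : Forms n ⊗[ℂ] L) :
    evalOneZeroL L' e (TensorProduct.map (pullForms A).toLinearMap g u) =
      TensorProduct.map (pullForms A).toLinearMap g (evalOneZeroL L (A e) u) := by
  induction u with
  | zero => simp
  | add u w hu hw => simp only [map_add, hu, hw]
  | tmul a X => simp [evalOneZero_pullForms]

theorem toLieForm_mem (φ : (Fin n → ℂ) →ₗ[ℂ] L) : toLieForm φ ∈ tensorIn L (formsDegree n 1) :=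
  sum_mem fun _ _ => tmul_mem_tensorIn (ι_mem_formsDegree _) _

theorem sum_smul_map_single (φ : (Fin n → ℂ) →ₗ[ℂ] L) (e : Fin n → ℂ) :
    ∑ j, e j • φ (Pi.single j 1) = φ e := by
  conv_rhs => rw [pi_eq_sum_univ' e, map_sum]
  refine Finset.sum_congr rfl fun j _ => ?_
  rw [map_smul]

/-- Although written with the coordinate forms `dz_j`, the element `∑ dz_j ⊗ φ(e_j)` is natural: the
matrix of `A` can be moved from the forms to the argument of `φ`. -/
theorem map_toLieForm (A : (Fin n → ℂ) →L[ℂ] (Fin n → ℂ)) {L' : Type*} [AddCommGroup L']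
    [Module ℂ L'] (g : L →ₗ[ℂ] L') (φ : (Fin n → ℂ) →ₗ[ℂ] L) :
    TensorProduct.map (pullForms A).toLinearMap g (toLieForm φ) =
      toLieForm (g ∘ₗ φ ∘ₗ A.toLinearMap) := by
  have h : ∀ j : Fin n, pullCovector A (dz j) = ∑ k, A (Pi.single k 1) j • dz k := by
    intro j
    refine LinearMap.ext fun x => ?_
    have := congrFun (sum_smul_map_single A.toLinearMap x) j
    simp only [ContinuousLinearMap.coe_coe, Finset.sum_apply, Pi.smul_apply, smul_eq_mul] at this
    simp [pullCovector, dz, ← this, mul_comm]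
  simp only [toLieForm, map_sum, TensorProduct.map_tmul, AlgHom.toLinearMap_apply, pullForms_ι, h,
    TensorProduct.sum_tmul, map_smul, LinearMap.comp_apply, ContinuousLinearMap.coe_coe]
  rw [Finset.sum_comm]
  refine Finset.sum_congr rfl fun k _ => ?_
  conv_rhs => rw [← sum_smul_map_single φ (A (Pi.single k 1))]
  simp only [map_sum, map_smul, TensorProduct.tmul_sum, TensorProduct.tmul_smul,
    TensorProduct.smul_tmul']

end Module

variable [LieRing L] [LieAlgebra ℂ L]

@[simp]
theorem formBracket_tmul (a b : Forms n) (X Y : L) :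
    formBracket n L (a ⊗ₜ X) (b ⊗ₜ Y) = (a * b) ⊗ₜ ⁅X, Y⁆ := rfl

theorem formBracket_mem {i j : ℤ} {u w : Forms n ⊗[ℂ] L}
    (hu : u ∈ tensorIn L (formsDegree n i)) (hw : w ∈ tensorIn L (formsDegree n j)) :
    formBracket n L u w ∈ tensorIn L (formsDegree n (i + j)) := by
  induction hu using tensorIn_induction with
  | zero => simp
  | add u u' _ _ hu hu' =>
    rw [map_add, LinearMap.add_apply]
    exact add_mem hu hu'
  | tmul a ha X =>
    induction hw using tensorIn_induction with
    | zero => simp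
    | add u u' _ _ hu hu' =>
      rw [map_add]
      exact add_mem hu hu'
    | tmul b hb Y => exact tmul_mem_tensorIn (mul_mem_intPow ha hb) _

theorem formBracket_skew {i j : ℤ} {u w : Forms n ⊗[ℂ] L}
    (hu : u ∈ tensorIn L (formsDegree n i)) (hw : w ∈ tensorIn L (formsDegree n j)) :
    formBracket n L u w = -((i * j).negOnePow • formBracket n L w u) := by
  induction hu using tensorIn_induction with
  | zero => simp
  | add u u' _ _ hu hu' =>
      rw [map_add, LinearMap.add_apply, map_add, smul_add, hu, hu', neg_add]
  | tmul a ha X =>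
    induction hw using tensorIn_induction with
    | zero => simp
    | add u u' _ _ hu hu' =>
      simp only [map_add, LinearMap.add_apply, smul_add, hu, hu', neg_add]
    | tmul b hb Y =>
      rw [formBracket_tmul, formBracket_tmul, forms_mul_comm ha hb, ← lie_skew Y X,
        TensorProduct.tmul_neg, Units.smul_def, Units.smul_def, smul_neg, neg_neg,
        TensorProduct.smul_tmul']

theorem formBracket_jacobi {i j : ℤ} {u v w : Forms n ⊗[ℂ] L}
    (hu : u ∈ tensorIn L (formsDegree n i)) (hv : v ∈ tensorIn L (formsDegree n j)) :
    formBracket n L u (formBracket n L v w) = formBracket n L (formBracket n L u v) w +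
      (i * j).negOnePow • formBracket n L v (formBracket n L u w) := by
  induction hu using tensorIn_induction with
  | zero => simp
  | add u u' _ _ hu hu' =>
    simp only [map_add, LinearMap.add_apply, smul_add, hu, hu']
    abel
  | tmul a ha X =>
    induction hv using tensorIn_induction with
    | zero => simp
    | add u u' _ _ hu hu' =>
      simp only [map_add, LinearMap.add_apply, smul_add, hu, hu']
      abel
    | tmul b hb Y =>
      induction w with
      | zero => simp
      | add u u' hu hu' =>
        simp only [map_add, smul_add, hu, hu']
        abel
      | tmul c Z =>
        simp only [formBracket_tmul]
        rw [← mul_assoc b a c, Units.smul_def, TensorProduct.smul_tmul', ← smul_mul_assoc,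
          ← Units.smul_def, ← forms_mul_comm ha hb, ← mul_assoc, ← TensorProduct.tmul_add,
          leibniz_lie]

theorem formBracket_smul_left (η : Forms n) (u w : Forms n ⊗[ℂ] L) :
    formBracket n L (η • u) w = η • formBracket n L u w := by
  induction u with
  | zero => simp
  | add u u' hu hu' => simp only [smul_add, map_add, LinearMap.add_apply, hu, hu']
  | tmul a X =>
    induction w with
    | zero => simp
    | add u u' hu hu' => simp only [map_add, hu, hu', smul_add]
    | tmul b Y => simp [TensorProduct.smul_tmul', mul_assoc]

theorem formBracket_smul_right {i : ℤ} {η : Forms n} (hη : η ∈ formsDegree n 1)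
    {u : Forms n ⊗[ℂ] L} (hu : u ∈ tensorIn L (formsDegree n i)) (w : Forms n ⊗[ℂ] L) :
    formBracket n L u (η • w) = i.negOnePow • (η • formBracket n L u w) := by
  induction hu using tensorIn_induction with
  | zero => simp
  | add u u' _ _ hu hu' =>
      simp only [smul_add, map_add, LinearMap.add_apply, hu, hu']
  | tmul a ha X =>
    induction w with
    | zero => simp
    | add u u' hu hu' => simp only [map_add, hu, hu', smul_add]
    | tmul b Y =>
      have := forms_mul_comm ha hη
      rw [mul_one] at this
      simp only [TensorProduct.smul_tmul', formBracket_tmul, smul_eq_mul, Units.smul_def]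
      rw [← mul_assoc, this, Units.smul_def, smul_mul_assoc, mul_assoc]

/-- By `evalOneZero_mul`, the single `(1, 0)` factor of a bracket comes from one of the two entries.
These two terms later become the two orders of a pair of arguments. -/
theorem evalOneZeroL_formBracket (e : Fin n → ℂ) {j : ℤ} (u : Forms n ⊗[ℂ] L)
    {w : Forms n ⊗[ℂ] L} (hw : w ∈ tensorIn L (formsDegree n j)) :
    evalOneZeroL L e (formBracket n L u w) =
      formBracket n L (antiProjL L u) (evalOneZeroL L e w) +
        j.negOnePow • formBracket n L (evalOneZeroL L e u) (antiProjL L w) := by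
  induction hw using tensorIn_induction with
  | zero => simp
  | add w w' _ _ hw hw' =>
    simp only [map_add, hw, hw', smul_add]
    abel
  | tmul b hb Y =>
    induction u with
    | zero => simp
    | add w w' hw hw' =>
      simp only [map_add, hw, hw', smul_add, LinearMap.add_apply]
      abel
    | tmul a X =>
      simp only [formBracket_tmul, LinearMap.rTensor_tmul, evalOneZero_mul e a hb,
        TensorProduct.add_tmul, Units.smul_def, TensorProduct.smul_tmul', AlgHom.toLinearMap_apply]

/-- The form `φ` is purely of type `(1, 0)`, so it supplies the contracted factor and only the `(0,
•)` part of `u` remains; the sign comes from contracting through `u`. -/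
theorem evalOneZeroL_toLieForm_bracket (φ : (Fin n → ℂ) →ₗ[ℂ] L) (e : Fin n → ℂ) {i : ℤ}
    {u : Forms n ⊗[ℂ] L} (hu : u ∈ tensorIn L (formsDegree n i)) :
    evalOneZeroL L e (formBracket n L (toLieForm φ) u) =
      i.negOnePow • formBracket n L (1 ⊗ₜ φ e) (antiProjL L u) := by
  induction hu using tensorIn_induction with
  | zero => simp
  | add w w' _ _ hw hw' =>
      simp only [map_add, hw, hw', smul_add]
  | tmul b hb Y =>
    rw [toLieForm, map_sum, LinearMap.sum_apply, map_sum, ← sum_smul_map_single φ e]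
    rw [TensorProduct.tmul_sum, map_sum, LinearMap.sum_apply, Finset.smul_sum]
    refine Finset.sum_congr rfl fun j _ => ?_
    simp only [formBracket_tmul, LinearMap.rTensor_tmul, evalOneZero_dz_mul e _ hb, smul_mul_assoc,
      one_mul, TensorProduct.tmul_smul, Units.smul_def, TensorProduct.smul_tmul',
      AlgHom.toLinearMap_apply]

/-- The forms `dz_i`, `dz_j` anticommute, whereas the operators `ad φ(e_i)`, `ad φ(e_j)` commute by
`hφ`. The double sum equals its own negative. This is where `θ ∧ θ = 0` enters the dgla. -/
theorem toLieForm_bracket_bracket {φ : (Fin n → ℂ) →ₗ[ℂ] L} (hφ : ∀ e e', ⁅φ e, φ e'⁆ = 0)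
    (u : Forms n ⊗[ℂ] L) :
    formBracket n L (toLieForm φ) (formBracket n L (toLieForm φ) u) = 0 := by
  induction u with
  | zero => simp
  | add u u' hu hu' => simp only [map_add, hu, hu', add_zero]
  | tmul a X =>
    simp only [toLieForm, map_sum, LinearMap.sum_apply, formBracket_tmul]
    set S := ∑ i, ∑ j, (ExteriorAlgebra.ι ℂ (dz i) * (ExteriorAlgebra.ι ℂ (dz j) * a)) ⊗ₜ[ℂ]
      ⁅φ (Pi.single i 1), ⁅φ (Pi.single j 1), X⁆⁆ with hS
    have h : S = -S := by
      conv_lhs => rw [hS, Finset.sum_comm]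
      rw [hS, ← Finset.sum_neg_distrib]
      refine Finset.sum_congr rfl fun i _ => ?_
      rw [← Finset.sum_neg_distrib]
      refine Finset.sum_congr rfl fun j _ => ?_
      rw [← mul_assoc, ← mul_assoc, ι_mul_ι_comm, neg_mul, TensorProduct.neg_tmul, leibniz_lie, hφ]
      simp
    have h2 : (2 : ℂ) • S = 0 := by
      rw [two_smul]
      exact add_eq_zero_iff_eq_neg.2 h
    have hS0 : S = 0 := (smul_eq_zero_iff_right two_ne_zero).1 h2
    rw [← hS0, hS]
    exact Finset.sum_comm

theorem map_formBracket (A : (Fin n → ℂ) →L[ℂ] (Fin n → ℂ)) {g : L →ₗ[ℂ] L}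
    (hg : ∀ X Y, g ⁅X, Y⁆ = ⁅g X, g Y⁆) (u w : Forms n ⊗[ℂ] L) :
    TensorProduct.map (pullForms A).toLinearMap g (formBracket n L u w) =
      formBracket n L (TensorProduct.map (pullForms A).toLinearMap g u)
        (TensorProduct.map (pullForms A).toLinearMap g w) := by
  induction u with
  | zero => simp
  | add u u' hu hu' => simp only [map_add, LinearMap.add_apply, hu, hu']
  | tmul a X =>
    induction w with
    | zero => simp
    | add u u' hu hu' => simp only [map_add, hu, hu']
    | tmul b Y => simp [hg]

end LieForms

/-! ## Differential operators on a finite-dimensional Lie algebra -/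

section Operators

/-! ### First and second derivatives along vector fields. -/

section Normed

variable {E : Type*} [NormedAddCommGroup E] [NormedSpace ℂ E]

theorem contDiff_fderiv_apply {f : E → ℂ} (hf : ContDiff ℂ ω f) {g : E → E} (hg : ContDiff ℂ ω g) :
    ContDiff ℂ ω fun v => fderiv ℂ f v (g v) :=
  (hf.fderiv_right le_rfl).clm_apply hg

theorem fderiv_fderiv_apply {f : E → ℂ} (hf : ContDiff ℂ ω f) {g : E → E} (hg : ContDiff ℂ ω g)
    (v Y : E) : fderiv ℂ (fun v => fderiv ℂ f v (g v)) v Y =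
      fderiv ℂ (fderiv ℂ f) v Y (g v) + fderiv ℂ f v (fderiv ℂ g v Y) := by
  have h1 : DifferentiableAt ℂ (fderiv ℂ f) v :=
    (hf.fderiv_right (m := ω) le_rfl).differentiable (by simp) v
  have h2 : DifferentiableAt ℂ g v := hg.differentiable (by simp) v
  rw [(h1.hasFDerivAt.clm_apply h2.hasFDerivAt).fderiv]
  simp [add_comm]

theorem fderiv_fderiv_comm {f : E → ℂ} (hf : ContDiff ℂ ω f) (v Y Z : E) :
    fderiv ℂ (fderiv ℂ f) v Y Z = fderiv ℂ (fderiv ℂ f) v Z Y :=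
  (hf.contDiffAt.isSymmSndFDerivAt_of_omega) Y Z

end Normed

/-! ### Vector fields acting on analytic functions, in linear coordinates. -/

section Functions

variable {L : Type*} [AddCommGroup L] [Module ℂ L] [Module.Finite ℂ L]

variable (L) in
/-- Coordinates on a finite-dimensional space. -/
abbrev finCoord : L ≃ₗ[ℂ] (Fin (Module.finrank ℂ L) → ℂ) := (Module.finBasis ℂ L).equivFun

/-- A function in coordinates. -/
abbrev inCoord (f : L → ℂ) (x : Fin (Module.finrank ℂ L) → ℂ) : ℂ := f ((finCoord L).symm x)

variable (L) in
/-- The analytic functions on `L`. -/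
def smoothFun : Submodule ℂ (L → ℂ) where
  carrier := {f | ContDiff ℂ ω (inCoord f)}
  add_mem' {f g} (hf : ContDiff ℂ ω (inCoord f)) (hg : ContDiff ℂ ω (inCoord g)) :=
    (hf.add hg : ContDiff ℂ ω (inCoord f + inCoord g))
  zero_mem' := (contDiff_const : ContDiff ℂ ω fun _ => (0 : ℂ))
  smul_mem' c f (hf : ContDiff ℂ ω (inCoord f)) :=
    ((contDiff_const (c := c)).smul hf : ContDiff ℂ ω ((fun _ => c) • inCoord f))

theorem smoothFun_contDiff (f : smoothFun L) : ContDiff ℂ ω (inCoord f.1) := f.2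

theorem smoothFun_differentiableAt (f : smoothFun L) (x : Fin (Module.finrank ℂ L) → ℂ) :
    DifferentiableAt ℂ (inCoord f.1) x :=
  (smoothFun_contDiff f).differentiable (by simp) x

theorem lineDeriv_eq_fderiv_inCoord (f : smoothFun L) (v Y : L) :
    lineDeriv ℂ f.1 v Y = fderiv ℂ (inCoord f.1) (finCoord L v) (finCoord L Y) := by
  rw [← (smoothFun_differentiableAt f _).lineDeriv_eq_fderiv]
  simp only [lineDeriv, inCoord, map_add, map_smul, LinearEquiv.symm_apply_apply]

/-- The derivative of `f` along the vector field which is `g` in coordinates. -/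
def fieldDeriv {g : (Fin (Module.finrank ℂ L) → ℂ) → Fin (Module.finrank ℂ L) → ℂ}
    (hg : ContDiff ℂ ω g) : Module.End ℂ (smoothFun L) where
  toFun f := ⟨fun v => fderiv ℂ (inCoord f.1) (finCoord L v) (g (finCoord L v)), by
    have := contDiff_fderiv_apply (smoothFun_contDiff f) hg
    have h : ContDiff ℂ ω (inCoord fun v => fderiv ℂ (inCoord f.1) (finCoord L v)
        (g (finCoord L v))) := by
      convert this using 1
      funext x
      simp only [inCoord, LinearEquiv.apply_symm_apply]
    exact h⟩
  map_add' f g := by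
    ext v
    exact DFunLike.congr_fun (fderiv_add (smoothFun_differentiableAt f (finCoord L v))
      (smoothFun_differentiableAt g _)) _
  map_smul' c f := by
    ext v
    exact DFunLike.congr_fun
      (fderiv_const_smul (smoothFun_differentiableAt f (finCoord L v)) c) _

theorem fieldDeriv_apply {g : (Fin (Module.finrank ℂ L) → ℂ) → Fin (Module.finrank ℂ L) → ℂ}
    (hg : ContDiff ℂ ω g) (f : smoothFun L) (v : L) : (fieldDeriv hg f).1 v =
      fderiv ℂ (inCoord f.1) (finCoord L v) (g (finCoord L v)) := rfl

/-- The composite has a Hessian term and the derivative of the inner field along the outer one. The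
first is symmetric in the two fields, so commutators only see the second. -/
theorem fieldDeriv_fieldDeriv {g h : (Fin (Module.finrank ℂ L) → ℂ) → Fin (Module.finrank ℂ L) → ℂ}
    (hg : ContDiff ℂ ω g) (hh : ContDiff ℂ ω h) (f : smoothFun L) (v : L) :
    (fieldDeriv hg (fieldDeriv hh f)).1 v =
      fderiv ℂ (fderiv ℂ (inCoord f.1)) (finCoord L v) (g (finCoord L v)) (h (finCoord L v)) +
      fderiv ℂ (inCoord f.1) (finCoord L v) (fderiv ℂ h (finCoord L v) (g (finCoord L v))) := by
  rw [fieldDeriv_apply, ← fderiv_fderiv_apply (smoothFun_contDiff f) hh]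
  congr 3
  funext x
  simp only [inCoord, fieldDeriv_apply, LinearEquiv.apply_symm_apply]

/-- The derivative in a constant direction, as an operator. -/
def dirOp : L →ₗ[ℂ] Module.End ℂ (smoothFun L) where
  toFun Y := fieldDeriv (g := fun _ => finCoord L Y) contDiff_const
  map_add' Y Z := by
    ext f v
    simp [fieldDeriv_apply]
  map_smul' c Y := by
    ext f v
    simp [fieldDeriv_apply]

theorem dirOp_comm (Y Z : L) : dirOp Y * dirOp Z = dirOp Z * dirOp Y := by
  ext f v
  have h : ∀ Y Z : L, (dirOp Y (dirOp Z f)).1 v =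
      fderiv ℂ (fderiv ℂ (inCoord f.1)) (finCoord L v) (finCoord L Y) (finCoord L Z) := by
    intro Y Z
    refine (fieldDeriv_fieldDeriv _ _ f v).trans ?_
    rw [fderiv_const_apply, zero_apply, map_zero, add_zero]
  exact (h Y Z).trans ((fderiv_fderiv_comm (smoothFun_contDiff f) _ _ _).trans (h Z Y).symm)

theorem lineDeriv_eq_dirOp (f : smoothFun L) (v Y : L) :
    lineDeriv ℂ f.1 v Y = (dirOp Y f).1 v :=
  lineDeriv_eq_fderiv_inCoord f v Y

theorem mem_smoothFun_of_isHomogPoly {d : ℕ} {p : L → ℂ} (hp : IsHomogPoly d p) :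
    p ∈ smoothFun L := by
  obtain ⟨F, hF⟩ := hp
  have h : inCoord p = fun x => ∑ J : Fin d → Fin (Module.finrank ℂ L),
      (∏ a, x (J a)) • F fun a => Module.finBasis ℂ L (J a) := by
    funext x
    rw [inCoord, hF, Module.Basis.equivFun_symm_apply, F.map_sum]
    exact Finset.sum_congr rfl fun J _ => F.map_smul_univ _ _
  have h' : ContDiff ℂ ω (inCoord p) := by
    rw [h]
    exact ContDiff.sum fun J _ =>
      (contDiff_prod fun a _ => contDiff_apply ℂ ℂ (J a)).smul contDiff_const
  exact h'

/-- The recursion differentiates last in the direction `X 0`, which is the leftmost factor of the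
product. All polarisations thus become words in one commutative family of operators. -/
theorem polar_eq_prod_dirOp (p : smoothFun L) {k : ℕ} (X : Fin k → L) (v : L) :
    polar p.1 k X v = ((List.ofFn fun a => dirOp (X a)).prod p).1 v := by
  induction k generalizing v with
  | zero => rfl
  | succ k ih =>
    have : polar p.1 k (Fin.tail X) = ((List.ofFn fun a => dirOp (Fin.tail X a)).prod p).1 :=
      funext fun v => ih _ v
    rw [polar, this, lineDeriv_eq_dirOp, List.ofFn_succ, List.prod_cons]
    rfl

end Functions

/-! ### The linear vector fields `v ↦ ⁅X, v⁆` and infinitesimal invariance. -/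

variable {L : Type w} [LieRing L] [LieAlgebra ℂ L] [Module.Finite ℂ L]

/-- The linear vector field `v ↦ [X, v]` in coordinates. -/
def adCoord (X : L) : (Fin (Module.finrank ℂ L) → ℂ) →L[ℂ] (Fin (Module.finrank ℂ L) → ℂ) :=
  LinearMap.toContinuousLinearMap
    ((finCoord L).toLinearMap ∘ₗ (LieModule.toEnd ℂ L L X) ∘ₗ (finCoord L).symm.toLinearMap)

theorem adCoord_apply (X v : L) : adCoord X (finCoord L v) = finCoord L ⁅X, v⁆ := by
  simp [adCoord]

/-- The derivative along the linear vector field `v ↦ [X, v]`, as an operator. -/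
def adOp : L →ₗ[ℂ] Module.End ℂ (smoothFun L) where
  toFun X := fieldDeriv (adCoord X).contDiff
  map_add' Y Z := by
    ext f v
    simp only [fieldDeriv_apply, adCoord_apply, add_lie, map_add, LinearMap.add_apply,
      Submodule.coe_add, Pi.add_apply]
  map_smul' c Y := by
    ext f v
    simp only [fieldDeriv_apply, adCoord_apply, smul_lie, map_smul, LinearMap.smul_apply,
      Submodule.coe_smul, Pi.smul_apply, RingHom.id_apply]

theorem adOp_apply (X : L) (f : smoothFun L) (v : L) : (adOp X f).1 v = (dirOp ⁅X, v⁆ f).1 v := by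
  change fderiv ℂ (inCoord f.1) (finCoord L v) (adCoord X (finCoord L v)) = _
  rw [adCoord_apply]
  rfl

/-- The Hessian terms of the two composites agree. The constant field has derivative zero, and the
linear field `v ↦ ⁅X, v⁆` has derivative `⁅X, Y⁆` in the direction `Y`. -/
theorem dirOp_mul_adOp (X Y : L) :
    dirOp Y * adOp X = adOp X * dirOp Y + dirOp ⁅X, Y⁆ := by
  ext f v
  have h1 := fieldDeriv_fieldDeriv (g := fun _ => finCoord L Y) contDiff_const
    (adCoord X).contDiff f v
  have h2 := fieldDeriv_fieldDeriv (adCoord X).contDiff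
    (h := fun _ => finCoord L Y) contDiff_const f v
  rw [(adCoord X).fderiv, adCoord_apply, adCoord_apply,
    fderiv_fderiv_comm (smoothFun_contDiff f)] at h1
  rw [fderiv_const_apply, zero_apply, map_zero, add_zero, adCoord_apply] at h2
  rw [← h2] at h1
  exact h1

/-- Application of an operator to `p`, followed by evaluation at `v`. -/
def applyAt (p : smoothFun L) (v : L) : Module.End ℂ (smoothFun L) →ₗ[ℂ] ℂ :=
  (LinearMap.proj v ∘ₗ (smoothFun L).subtype) ∘ₗ LinearMap.applyₗ p

/-- The polarisations of an invariant polynomial are given by a functional on an algebra generated by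
commuting operators `D Y` and by operators `V X` which annihilate the polynomial. -/
theorem exists_operators {d : ℕ} {p : L → ℂ} (hp : IsHomogPoly d p)
    (hinv : ∀ X v : L, lineDeriv ℂ p v ⁅X, v⁆ = 0) :
    ∃ (𝔄 : Type w) (_ : Ring 𝔄) (_ : Algebra ℂ 𝔄) (D V : L →ₗ[ℂ] 𝔄) (E : L → 𝔄 →ₗ[ℂ] ℂ),
      (∀ X Y, D X * D Y = D Y * D X) ∧ (∀ X Y, D Y * V X = V X * D Y + D ⁅X, Y⁆) ∧
      (∀ v T X, E v (T * V X) = 0) ∧ (∀ v X T, E v (V X * T) = E v (D ⁅X, v⁆ * T)) ∧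
      ∀ (k : ℕ) (X : Fin k → L) (v : L), polar p k X v = E v (List.ofFn fun a => D (X a)).prod := by
  let q : smoothFun L := ⟨p, mem_smoothFun_of_isHomogPoly hp⟩
  -- The functional applies an operator to `p` and evaluates at `v`. Hence a rightmost `V X` acts on
  -- `p` itself, while a leftmost one is evaluated at `v`, where it agrees with differentiation in
  -- the direction `⁅X, v⁆`.
  refine ⟨Module.End ℂ (smoothFun L), inferInstance, inferInstance, dirOp, adOp, applyAt q,
    dirOp_comm, dirOp_mul_adOp, fun v T X => ?_, fun v X T => adOp_apply X (T q) v, fun k X v =>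
    polar_eq_prod_dirOp q X v⟩
  have : adOp X q = 0 := by
    ext v
    exact (adOp_apply X q v).trans ((lineDeriv_eq_dirOp q v ⁅X, v⁆).symm.trans (hinv X v))
  change (T (adOp X q)).1 v = 0
  rw [this, LinearMap.map_zero]
  rfl

end Operators

/-! ## Operators with coefficients in forms -/

section FormOperators

variable {n : ℕ} {L : Type*} [LieRing L] [LieAlgebra ℂ L] {𝔄 : Type*} [Ring 𝔄] [Algebra ℂ 𝔄]
  {D V : L →ₗ[ℂ] 𝔄} {E : Module.Dual ℂ 𝔄}

/-- Since the operators `D X` commute, all signs come from the form factors. -/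
theorem lTensor_mul_comm (hD : ∀ X Y, D X * D Y = D Y * D X) {i j : ℤ} {u w : Forms n ⊗[ℂ] L}
    (hu : u ∈ tensorIn L (formsDegree n i)) (hw : w ∈ tensorIn L (formsDegree n j)) :
    D.lTensor (Forms n) u * D.lTensor (Forms n) w = (i * j).negOnePow • (D.lTensor (Forms n) w * D.lTensor (Forms n) u) := by
  induction hu using tensorIn_induction with
  | zero => simp
  | add u u' _ _ hu hu' => simp only [map_add, add_mul, mul_add, smul_add, hu, hu']
  | tmul a ha X =>
    induction hw using tensorIn_induction with
    | zero => simp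
    | add u u' _ _ hu hu' => simp only [map_add, add_mul, mul_add, smul_add, hu, hu']
    | tmul b hb Y =>
      rw [LinearMap.lTensor_tmul, LinearMap.lTensor_tmul, Algebra.TensorProduct.tmul_mul_tmul,
        Algebra.TensorProduct.tmul_mul_tmul, forms_mul_comm ha hb, hD X Y, Units.smul_def,
        Units.smul_def, TensorProduct.smul_tmul']

/-- The commutation relation tensored with forms: the commutator is absorbed by the bracket of
`L`-valued forms. -/
theorem lTensor_mul_lTensor_of_bracket (hV : ∀ X Y, D Y * V X = V X * D Y + D ⁅X, Y⁆) {i j : ℤ} {c u : Forms n ⊗[ℂ] L}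
    (hc : c ∈ tensorIn L (formsDegree n i)) (hu : u ∈ tensorIn L (formsDegree n j)) :
    V.lTensor (Forms n) c * D.lTensor (Forms n) u = (i * j).negOnePow • (D.lTensor (Forms n) u * V.lTensor (Forms n) c) -
      D.lTensor (Forms n) (formBracket n L c u) := by
  induction hc using tensorIn_induction with
  | zero => simp
  | add u u' _ _ hu hu' =>
    simp only [map_add, add_mul, mul_add, smul_add, hu, hu', LinearMap.add_apply]
    abel
  | tmul a ha X =>
    induction hu using tensorIn_induction with
    | zero => simp
    | add u u' _ _ hu hu' =>
      simp only [map_add, add_mul, mul_add, smul_add, hu, hu']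
      abel
    | tmul b hb Y =>
      rw [LinearMap.lTensor_tmul, LinearMap.lTensor_tmul, formBracket_tmul, LinearMap.lTensor_tmul,
        Algebra.TensorProduct.tmul_mul_tmul, Algebra.TensorProduct.tmul_mul_tmul, hV,
        Units.smul_def, TensorProduct.smul_tmul', ← Units.smul_def, ← forms_mul_comm ha hb,
        TensorProduct.tmul_add, add_sub_cancel_right]

theorem coordForm_mul_lTensor_eq_zero (hE : ∀ T X, E (T * V X) = 0) (T : Forms n ⊗[ℂ] 𝔄) (c : Forms n ⊗[ℂ] L) : coordForm E (T * V.lTensor (Forms n) c) = 0 := by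
  induction c with
  | zero => simp
  | add u u' hu hu' => rw [map_add, mul_add, map_add, hu, hu', add_zero]
  | tmul a X =>
    induction T with
    | zero => simp
    | add u u' hu hu' => rw [add_mul, map_add, hu, hu', add_zero]
    | tmul b T =>
      rw [LinearMap.lTensor_tmul, Algebra.TensorProduct.tmul_mul_tmul, coordForm_tmul, hE, zero_smul]

theorem coordForm_lTensor_mul {v : L} (hEv : ∀ X T, E (V X * T) = E (D ⁅X, v⁆ * T)) (T : Forms n ⊗[ℂ] 𝔄) (c : Forms n ⊗[ℂ] L) :
    coordForm E (V.lTensor (Forms n) c * T) = coordForm E (D.lTensor (Forms n) (formBracket n L c (1 ⊗ₜ v)) * T) := by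
  induction c with
  | zero => simp
  | add u u' hu hu' => simp only [map_add, add_mul, LinearMap.add_apply, hu, hu']
  | tmul a X =>
    induction T with
    | zero => simp
    | add u u' hu hu' => rw [mul_add, mul_add, map_add, map_add, hu, hu']
    | tmul b T =>
      simp only [LinearMap.lTensor_tmul, formBracket_tmul, LinearMap.lTensor_tmul,
        Algebra.TensorProduct.tmul_mul_tmul, coordForm_tmul, mul_one, hEv]

theorem coordForm_lTensor_smul_mul (T : Forms n ⊗[ℂ] 𝔄) (η : Forms n)
    (w : Forms n ⊗[ℂ] L) :
    coordForm E (D.lTensor (Forms n) (η • w) * T) = η * coordForm E (D.lTensor (Forms n) w * T) := by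
  induction w with
  | zero => simp
  | add u u' hu hu' => simp only [map_add, add_mul, smul_add, mul_add, hu, hu']
  | tmul a X =>
    induction T with
    | zero => simp
    | add u u' hu hu' => simp only [mul_add, map_add, hu, hu']
    | tmul b T =>
      simp only [TensorProduct.smul_tmul', LinearMap.lTensor_tmul, Algebra.TensorProduct.tmul_mul_tmul,
        coordForm_tmul, smul_eq_mul, mul_smul_comm, mul_assoc]

/-- Commuting the operator of a linear vector field past a product of constant vector fields. -/
theorem coordForm_lTensor_mul_prod {α : Type*} [LinearOrder α] (hD : ∀ X Y, D X * D Y = D Y * D X)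
    (hV : ∀ X Y, D Y * V X = V X * D Y + D ⁅X, Y⁆) (hE : ∀ T X, E (T * V X) = 0) (d : α → ℤ) (u : α → Forms n ⊗[ℂ] L)
    (hu : ∀ i, u i ∈ tensorIn L (formsDegree n (d i))) {m : ℤ} {c : Forms n ⊗[ℂ] L}
    (hc : c ∈ tensorIn L (formsDegree n m)) (T : Forms n ⊗[ℂ] 𝔄) {l : List α} (hl : l.Nodup) :
    listSign d l • coordForm E (T * (V.lTensor (Forms n) c * (l.map fun i => D.lTensor (Forms n) (u i)).prod)) =
      -(l.map fun j => listSign d (j :: l.erase j) • coordForm E (T * (D.lTensor (Forms n)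
        (formBracket n L c (u j)) * ((l.erase j).map fun i => D.lTensor (Forms n) (u i)).prod))).sum := by
  -- `T` collects the factors that the linear field has already passed. Moving past the head
  -- produces its own summand and the induction hypothesis with `T` enlarged by the head.
  induction l generalizing T with
  | nil => simp [coordForm_mul_lTensor_eq_zero hE]
  | cons a l ih =>
    rw [List.nodup_cons] at hl
    rw [List.map_cons, List.prod_cons, ← mul_assoc (V.lTensor (Forms n) c), lTensor_mul_lTensor_of_bracket hV hc (hu a),
      sub_mul, mul_sub, map_sub, smul_sub, List.map_cons, List.sum_cons, List.erase_cons_head,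
      neg_add, sub_eq_neg_add]
    congr 1
    have h1 : T * ((m * d a).negOnePow • (D.lTensor (Forms n) (u a) * V.lTensor (Forms n) c) *
        (l.map fun i => D.lTensor (Forms n) (u i)).prod) = (m * d a).negOnePow • ((T * D.lTensor (Forms n) (u a)) *
        (V.lTensor (Forms n) c * (l.map fun i => D.lTensor (Forms n) (u i)).prod)) := by
      simp only [Units.smul_def, smul_mul_assoc, mul_smul_comm, mul_assoc]
    have h2 : listSign d (a :: l) = headSign d a l * listSign d l := rfl
    rw [h1, Units.smul_def (m * d a).negOnePow, map_zsmul, ← Units.smul_def, h2,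
      smul_comm, mul_smul, ih _ hl.2, smul_neg, smul_neg, List.smul_sum, List.smul_sum]
    congr 2
    rw [List.map_map, List.map_map]
    refine List.map_congr_left fun j hj => ?_
    have haj : a ≠ j := by
      rintro rfl
      exact hl.1 hj
    have h3 : formBracket n L c (u j) ∈ tensorIn L (formsDegree n (m + d j)) :=
      formBracket_mem hc (hu j)
    have h4 : headSign d a l = headSign d a (j :: l.erase j) :=
      headSign_perm d a (List.perm_cons_erase hj)
    have h5 := listSign_swap d haj (l.erase j)
    rw [listSign] at h5
    -- In the claim the bracket precedes `u a`, in the induction hypothesis it follows. Exchanging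
    -- them costs the sign for degrees `m + d j` and `d a`, whose part `m * d a` matches the sign
    -- from passing `c`.
    have h6 : T * (D.lTensor (Forms n) (formBracket n L c (u j)) *
        (D.lTensor (Forms n) (u a) * ((l.erase j).map fun i => D.lTensor (Forms n) (u i)).prod)) =
        ((m + d j) * d a).negOnePow • (T * D.lTensor (Forms n) (u a) * (D.lTensor (Forms n) (formBracket n L c (u j)) *
          ((l.erase j).map fun i => D.lTensor (Forms n) (u i)).prod)) := by
      rw [← mul_assoc (D.lTensor (Forms n) _), lTensor_mul_comm hD h3 (hu a)]
      simp only [Units.smul_def, smul_mul_assoc, mul_smul_comm, mul_assoc]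
    rw [List.erase_cons_tail (by simpa using haj), List.map_cons, List.prod_cons, h6,
      Units.smul_def ((m + d j) * d a).negOnePow, map_zsmul, ← Units.smul_def]
    simp only [Function.comp_apply, smul_smul, h4]
    congr 1
    rw [h5, add_mul, Int.negOnePow_add, mul_comm (d a) (d j)]
    ac_rfl

end FormOperators

theorem prod_ofFn_tmul {n : ℕ} {𝔄 : Type*} [Ring 𝔄] [Algebra ℂ 𝔄] {k : ℕ} (a : Fin k → Forms n)
    (T : Fin k → 𝔄) :
    (List.ofFn fun i => a i ⊗ₜ[ℂ] T i).prod = (List.ofFn a).prod ⊗ₜ[ℂ] (List.ofFn T).prod := by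
  induction k with
  | zero => rfl
  | succ k ih =>
    rw [List.ofFn_succ, List.prod_cons, ih, List.ofFn_succ, List.ofFn_succ, List.prod_cons,
      List.prod_cons, Algebra.TensorProduct.tmul_mul_tmul]

/-- Expanding each factor of the product in a basis of `L` and multiplying out gives the defining
sum of `formExtend`. This turns `h_k` into a functional of a product in `Forms n ⊗ 𝔄`. -/
theorem formExtend_eq_coordForm {n : ℕ} {L : Type*} [AddCommGroup L] [Module ℂ L]
    [Module.Finite ℂ L] {𝔄 : Type*} [Ring 𝔄] [Algebra ℂ 𝔄] {D : L →ₗ[ℂ] 𝔄} {E : Module.Dual ℂ 𝔄}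
    {k : ℕ} {Q : (Fin k → L) → ℂ} (hQ : ∀ X, Q X = E (List.ofFn fun a => D (X a)).prod)
    (u : Fin k → Forms n ⊗[ℂ] L) :
    formExtend Q u = coordForm E (List.ofFn fun a => D.lTensor (Forms n) (u a)).prod := by
  have h : (fun a => D.lTensor (Forms n) (u a)) = fun a => ∑ b,
      coordForm ((Module.finBasis ℂ L).coord b) (u a) ⊗ₜ[ℂ] D (Module.finBasis ℂ L b) := by
    funext a
    conv_lhs => rw [← sum_coordForm_tmul (u a)]
    simp
  rw [← MultilinearMap.mkPiAlgebraFin_apply (R := ℂ), h, MultilinearMap.map_sum, map_sum]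
  simp only [formExtend, sum_apply, smul_apply,
    MultilinearMap.compLinearMap_apply, MultilinearMap.mkPiAlgebraFin_apply, prod_ofFn_tmul, coordForm_tmul, hQ]
  rfl

/-! ## The Cauchy–Riemann derivative -/

section ScalarCalculus

variable {n k : ℕ}

/-- The conjugate-linear part of the real derivative of `g` at `z`, applied to `v`. -/
def conjDeriv (g : (Fin n → ℂ) → ℂ) (z v : Fin n → ℂ) : ℂ :=
  (1 / 2 : ℂ) * (fderiv ℝ g z v + Complex.I * fderiv ℝ g z (Complex.I • v))

theorem conjDeriv_congr {f g : (Fin n → ℂ) → ℂ} {z : Fin n → ℂ} (h : f =ᶠ[nhds z] g)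
    (v : Fin n → ℂ) : conjDeriv f z v = conjDeriv g z v := by
  rw [conjDeriv, conjDeriv, h.fderiv_eq]

theorem conjDeriv_add_right (g : (Fin n → ℂ) → ℂ) (z v w : Fin n → ℂ) :
    conjDeriv g z (v + w) = conjDeriv g z v + conjDeriv g z w := by
  simp only [conjDeriv, smul_add, map_add]
  ring

theorem conjDeriv_smul_right (g : (Fin n → ℂ) → ℂ) (z : Fin n → ℂ) (c : ℂ) (v : Fin n → ℂ) :
    conjDeriv g z (c • v) = (starRingEnd ℂ) c * conjDeriv g z v := by
  have h : c • v = c.re • v + c.im • (Complex.I • v) := by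
    conv_lhs => rw [← Complex.re_add_im c]
    ext i
    simp only [Pi.smul_apply, smul_eq_mul, Pi.add_apply, Complex.real_smul]
    ring
  have h' : Complex.I • (c • v) = c.re • (Complex.I • v) - c.im • v := by
    conv_lhs => rw [← Complex.re_add_im c]
    ext i
    simp only [Pi.smul_apply, smul_eq_mul, Pi.sub_apply, Complex.real_smul]
    linear_combination (c.im : ℂ) * v i * Complex.I_mul_I
  rw [conjDeriv, conjDeriv, h', h]
  simp only [map_add, map_sub, map_smul, Complex.real_smul]
  conv_rhs => rw [← Complex.re_add_im c]
  simp only [map_add, map_mul, Complex.conj_ofReal, Complex.conj_I]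
  linear_combination (1 / 2 : ℂ) * (c.im : ℂ) * fderiv ℝ g z (Complex.I • v) * Complex.I_mul_I

theorem conjDeriv_sum_right {ι : Type*} (s : Finset ι) (g : (Fin n → ℂ) → ℂ) (z : Fin n → ℂ)
    (v : ι → Fin n → ℂ) : conjDeriv g z (∑ i ∈ s, v i) = ∑ i ∈ s, conjDeriv g z (v i) := by
  classical
  induction s using Finset.induction_on with
  | empty => simp [conjDeriv]
  | insert a s ha ih => rw [Finset.sum_insert ha, Finset.sum_insert ha, conjDeriv_add_right, ih]

theorem conjDeriv_sum_mul {ι : Type*} (s : Finset ι) {f g : ι → (Fin n → ℂ) → ℂ}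
    {z : Fin n → ℂ} (hf : ∀ i ∈ s, DifferentiableAt ℝ (f i) z)
    (hg : ∀ i ∈ s, DifferentiableAt ℝ (g i) z) (v : Fin n → ℂ) :
    conjDeriv (fun w => ∑ i ∈ s, f i w * g i w) z v =
      ∑ i ∈ s, (conjDeriv (f i) z v * g i z + f i z * conjDeriv (g i) z v) := by
  have h : fderiv ℝ (fun w => ∑ i ∈ s, f i w * g i w) z =
      ∑ i ∈ s, (f i z • fderiv ℝ (g i) z + g i z • fderiv ℝ (f i) z) := by
    refine (HasFDerivAt.fun_sum fun i hi => ?_).fderiv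
    exact (hf i hi).hasFDerivAt.mul (hg i hi).hasFDerivAt
  simp only [conjDeriv, h, sum_apply, add_apply, smul_apply, smul_eq_mul,
    Finset.mul_sum, ← Finset.sum_add_distrib]
  refine Finset.sum_congr rfl fun i _ => ?_
  ring

theorem conjDeriv_const (c : ℂ) (z v : Fin n → ℂ) : conjDeriv (fun _ => c) z v = 0 := by
  simp [conjDeriv]

theorem conjDeriv_of_holomorphic {g : (Fin n → ℂ) → ℂ} {z : Fin n → ℂ}
    (hg : DifferentiableAt ℂ g z) (v : Fin n → ℂ) : conjDeriv g z v = 0 := by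
  rw [conjDeriv, hg.fderiv_restrictScalars ℝ]
  simp only [ContinuousLinearMap.coe_restrictScalars', map_smul, smul_eq_mul]
  linear_combination (1 / 2 : ℂ) * fderiv ℂ g z v * Complex.I_mul_I

/-- The derivative of a holomorphic map commutes with multiplication by `I`, so the conjugate-linear
part satisfies the plain chain rule. -/
theorem conjDeriv_comp {g : (Fin k → ℂ) → ℂ} {τ : (Fin n → ℂ) → Fin k → ℂ} {z : Fin n → ℂ}
    (hτ : DifferentiableAt ℂ τ z) (hg : DifferentiableAt ℝ g (τ z)) (v : Fin n → ℂ) :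
    conjDeriv (fun w => g (τ w)) z v = conjDeriv g (τ z) (fderiv ℂ τ z v) := by
  have h : fderiv ℝ (fun w => g (τ w)) z =
      (fderiv ℝ g (τ z)).comp ((fderiv ℂ τ z).restrictScalars ℝ) := by
    rw [← hτ.fderiv_restrictScalars ℝ]
    exact fderiv_comp z hg (hτ.restrictScalars ℝ)
  rw [conjDeriv, conjDeriv, h]
  simp

theorem contDiffAt_conjDeriv {g : (Fin n → ℂ) → ℂ} {z : Fin n → ℂ} (hg : ContDiffAt ℝ ∞ g z)
    (v : Fin n → ℂ) : ContDiffAt ℝ ∞ (fun w => conjDeriv g w v) z := by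
  have h : ContDiffAt ℝ ∞ (fderiv ℝ g) z := hg.fderiv_right (by simp)
  exact contDiffAt_const.mul ((h.clm_apply contDiffAt_const).add
    (contDiffAt_const.mul (h.clm_apply contDiffAt_const)))

/-- Both sides are the same complex combination of entries of the real Hessian, which is symmetric.
-/
theorem conjDeriv_conjDeriv_comm {g : (Fin n → ℂ) → ℂ} {z : Fin n → ℂ} (hg : ContDiffAt ℝ ∞ g z)
    (v w : Fin n → ℂ) :
    conjDeriv (fun x => conjDeriv g x v) z w = conjDeriv (fun x => conjDeriv g x w) z v := by
  have h : DifferentiableAt ℝ (fderiv ℝ g) z :=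
    (hg.fderiv_right (m := 1) (by norm_cast)).differentiableAt one_ne_zero
  have hsymm : IsSymmSndFDerivAt ℝ g z :=
    hg.isSymmSndFDerivAt (by
      rw [minSmoothness_of_isRCLikeNormedField]; exact WithTop.coe_le_coe.2 le_top)
  have key : ∀ v w, fderiv ℝ (fun x => conjDeriv g x v) z w = (1 / 2 : ℂ) *
      (fderiv ℝ (fderiv ℝ g) z w v + Complex.I * fderiv ℝ (fderiv ℝ g) z w (Complex.I • v)) := by
    intro v w
    have h1 : ∀ v, HasFDerivAt (fun x => fderiv ℝ g x v)
        ((fderiv ℝ (fderiv ℝ g) z).flip v) z := fun v => by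
      simpa using h.hasFDerivAt.clm_apply (hasFDerivAt_const v z)
    have h2 := ((h1 v).add ((h1 (Complex.I • v)).const_mul Complex.I)).const_mul (1 / 2 : ℂ)
    have h3 : HasFDerivAt (fun x => conjDeriv g x v) _ z := h2
    rw [h3.fderiv]
    simp
    ring
  rw [conjDeriv, conjDeriv, key, key, key, key, hsymm.eq v w, hsymm.eq (Complex.I • v) w,
    hsymm.eq v (Complex.I • w), hsymm.eq (Complex.I • v) (Complex.I • w)]
  ring

end ScalarCalculus

/-! ### The Cauchy–Riemann derivative of vector-valued functions. -/

section VectorCalculus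

variable {n k : ℕ} {M N K : Type*} [AddCommGroup M] [Module ℂ M] [AddCommGroup N] [Module ℂ N]
  [AddCommGroup K] [Module ℂ K]

/-- Real differentiability at a point, tested by linear functionals. -/
def WeakDiffAt (f : (Fin n → ℂ) → M) (z : Fin n → ℂ) : Prop :=
  ∀ l : Module.Dual ℂ M, DifferentiableAt ℝ (fun w => l (f w)) z

theorem SmoothAt.weakDiffAt {f : (Fin n → ℂ) → M} {z : Fin n → ℂ} (hf : SmoothAt f z) :
    WeakDiffAt f z :=
  fun l => (hf l).differentiableAt (by simp)

theorem HolomorphicAt.smoothAt {f : (Fin n → ℂ) → M} {z : Fin n → ℂ} (hf : HolomorphicAt f z) :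
    SmoothAt f z :=
  fun l => ((hf l).contDiffAt (n := ∞)).restrict_scalars ℝ

theorem SmoothAt.congr {f g : (Fin n → ℂ) → M} {z : Fin n → ℂ} (hf : SmoothAt f z)
    (h : g =ᶠ[nhds z] f) : SmoothAt g z :=
  fun l => (hf l).congr_of_eventuallyEq (h.fun_comp l)

theorem smoothAt_const (c : M) (z : Fin n → ℂ) : SmoothAt (fun _ => c) z := fun _ => contDiffAt_const

theorem SmoothAt.add {f g : (Fin n → ℂ) → M} {z : Fin n → ℂ} (hf : SmoothAt f z)
    (hg : SmoothAt g z) : SmoothAt (fun w => f w + g w) z := fun l => by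
  simpa using (hf l).add (hg l)

theorem smoothAt_sum {ι : Type*} (s : Finset ι) {f : ι → (Fin n → ℂ) → M} {z : Fin n → ℂ}
    (hf : ∀ i ∈ s, SmoothAt (f i) z) : SmoothAt (fun w => ∑ i ∈ s, f i w) z := fun l => by
  simpa using ContDiffAt.sum fun i hi => hf i hi l

theorem SmoothAt.map {f : (Fin n → ℂ) → M} {z : Fin n → ℂ} (hf : SmoothAt f z) (T : M →ₗ[ℂ] N) :
    SmoothAt (fun w => T (f w)) z := fun l => hf (l ∘ₗ T)

theorem HolomorphicAt.map {f : (Fin n → ℂ) → M} {z : Fin n → ℂ} (hf : HolomorphicAt f z)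
    (T : M →ₗ[ℂ] N) : HolomorphicAt (fun w => T (f w)) z := fun l => hf (l ∘ₗ T)

theorem WeakDiffAt.map {f : (Fin n → ℂ) → M} {z : Fin n → ℂ} (hf : WeakDiffAt f z)
    (T : M →ₗ[ℂ] N) : WeakDiffAt (fun w => T (f w)) z := fun l => hf (l ∘ₗ T)

variable [Module.Finite ℂ M]

theorem apply_eq_sum_coord (l : Module.Dual ℂ M) (x : M) :
    l x = ∑ a, (Module.finBasis ℂ M).coord a x * l (Module.finBasis ℂ M a) := by
  conv_lhs => rw [← (Module.finBasis ℂ M).sum_repr x]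
  simp only [map_sum, map_smul, smul_eq_mul, Module.Basis.coord_apply]

theorem apply₂_eq_sum_coord (B : M →ₗ[ℂ] N →ₗ[ℂ] K) (l : Module.Dual ℂ K) (x : M) (y : N) :
    l (B x y) = ∑ a, (Module.finBasis ℂ M).coord a x * (l ∘ₗ B (Module.finBasis ℂ M a)) y := by
  conv_lhs => rw [← (Module.finBasis ℂ M).sum_repr x]
  simp only [map_sum, map_smul, LinearMap.sum_apply, LinearMap.smul_apply, smul_eq_mul,
    Module.Basis.coord_apply, LinearMap.comp_apply]

theorem SmoothAt.map₂ {f : (Fin n → ℂ) → M} {g : (Fin n → ℂ) → N} {z : Fin n → ℂ}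
    (hf : SmoothAt f z) (hg : SmoothAt g z) (B : M →ₗ[ℂ] N →ₗ[ℂ] K) :
    SmoothAt (fun w => B (f w) (g w)) z := fun l => by
  simp only [apply₂_eq_sum_coord]
  exact ContDiffAt.sum fun a _ => (hf _).mul (hg _)

theorem WeakDiffAt.map₂ {f : (Fin n → ℂ) → M} {g : (Fin n → ℂ) → N} {z : Fin n → ℂ}
    (hf : WeakDiffAt f z) (hg : WeakDiffAt g z) (B : M →ₗ[ℂ] N →ₗ[ℂ] K) :
    WeakDiffAt (fun w => B (f w) (g w)) z := fun l => by
  simp only [apply₂_eq_sum_coord]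
  exact DifferentiableAt.fun_sum fun a _ => (hf _).mul (hg _)

theorem WeakDiffAt.of_coord {f : (Fin n → ℂ) → M} {z : Fin n → ℂ}
    (hf : ∀ a, DifferentiableAt ℝ (fun w => (Module.finBasis ℂ M).coord a (f w)) z) :
    WeakDiffAt f z := fun l => by
  rw [funext fun w => apply_eq_sum_coord l (f w)]
  exact DifferentiableAt.fun_sum fun a _ => (hf a).mul (differentiableAt_const _)

theorem SmoothAt.eventually_weakDiffAt {f : (Fin n → ℂ) → M} {z : Fin n → ℂ} (hf : SmoothAt f z) :
    ∀ᶠ w in nhds z, WeakDiffAt f w := by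
  have h : ∀ᶠ w in nhds z, ∀ a,
      DifferentiableAt ℝ (fun w => (Module.finBasis ℂ M).coord a (f w)) w := by
    refine Filter.eventually_all.2 fun a => ?_
    have := ((hf ((Module.finBasis ℂ M).coord a)).of_le (m := 1) (by norm_cast)).eventually
      (by simp)
    exact this.mono fun w hw => hw.differentiableAt one_ne_zero
  exact h.mono fun w hw => WeakDiffAt.of_coord hw

/-- The conjugate-linear part of the real derivative of a vector-valued function. -/
def conjDerivV (f : (Fin n → ℂ) → M) (z v : Fin n → ℂ) : M :=
  ∑ a, conjDeriv (fun w => (Module.finBasis ℂ M).coord a (f w)) z v • Module.finBasis ℂ M a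

theorem dzbarDeriv_eq (j : Fin n) (f : (Fin n → ℂ) → M) (z : Fin n → ℂ) :
    dzbarDeriv j f z = conjDerivV f z (Pi.single j 1) := by
  have h : (Pi.single j Complex.I : Fin n → ℂ) = Complex.I • Pi.single j 1 := by
    rw [← Pi.single_smul, smul_eq_mul, mul_one]
  simp only [dzbarDeriv, dirDeriv, conjDerivV, conjDeriv, h, Finset.smul_sum,
    ← Finset.sum_add_distrib, smul_smul, ← add_smul, mul_add]

theorem localDbar_eq [Module (Forms n) M] (f : (Fin n → ℂ) → M) (z : Fin n → ℂ) :
    localDbar f z = ∑ j, ExteriorAlgebra.ι ℂ (dzbar j) • conjDerivV f z (Pi.single j 1) := by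
  simp only [localDbar, dzbarDeriv_eq]

theorem conjDerivV_congr {f g : (Fin n → ℂ) → M} {z : Fin n → ℂ} (h : f =ᶠ[nhds z] g)
    (v : Fin n → ℂ) : conjDerivV f z v = conjDerivV g z v :=
  Finset.sum_congr rfl fun a _ => by
    rw [conjDeriv_congr (f := fun w => (Module.finBasis ℂ M).coord a (f w))
      (g := fun w => (Module.finBasis ℂ M).coord a (g w)) (h.fun_comp _)]

theorem localDbar_congr [Module (Forms n) M] {f g : (Fin n → ℂ) → M} {z : Fin n → ℂ}
    (h : f =ᶠ[nhds z] g) : localDbar f z = localDbar g z := by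
  simp only [localDbar_eq, conjDerivV_congr h]

/-- Testing against all functionals frees the definition from the chosen basis; the rules of
calculus below are reduced to scalars this way. -/
theorem conjDerivV_eq {f : (Fin n → ℂ) → M} {z v : Fin n → ℂ} {x : M}
    (h : ∀ l : Module.Dual ℂ M, conjDeriv (fun w => l (f w)) z v = l x) : conjDerivV f z v = x := by
  simp only [conjDerivV, h]
  exact (Module.finBasis ℂ M).sum_repr x

theorem apply_conjDerivV {f : (Fin n → ℂ) → M} {z : Fin n → ℂ} (hf : WeakDiffAt f z)
    (l : Module.Dual ℂ M) (v : Fin n → ℂ) :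
    l (conjDerivV f z v) = conjDeriv (fun w => l (f w)) z v := by
  rw [funext fun w => apply_eq_sum_coord l (f w)]
  rw [conjDeriv_sum_mul _ (fun a _ => hf _) fun _ _ => differentiableAt_const _]
  simp [conjDerivV, conjDeriv_const]

theorem conjDerivV_of_holomorphicAt {f : (Fin n → ℂ) → M} {z : Fin n → ℂ} (hf : HolomorphicAt f z)
    (v : Fin n → ℂ) : conjDerivV f z v = 0 :=
  conjDerivV_eq fun l => by rw [conjDeriv_of_holomorphic (hf l).differentiableAt, map_zero]

theorem conjDerivV_map [Module.Finite ℂ N] {f : (Fin n → ℂ) → M} {z : Fin n → ℂ}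
    (hf : WeakDiffAt f z) (T : M →ₗ[ℂ] N) (v : Fin n → ℂ) :
    conjDerivV (fun w => T (f w)) z v = T (conjDerivV f z v) :=
  conjDerivV_eq fun l => (apply_conjDerivV hf (l ∘ₗ T) v).symm

theorem conjDerivV_map₂ [Module.Finite ℂ N] [Module.Finite ℂ K] {f : (Fin n → ℂ) → M}
    {g : (Fin n → ℂ) → N} {z : Fin n → ℂ} (hf : WeakDiffAt f z) (hg : WeakDiffAt g z)
    (B : M →ₗ[ℂ] N →ₗ[ℂ] K) (v : Fin n → ℂ) :
    conjDerivV (fun w => B (f w) (g w)) z v =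
      B (conjDerivV f z v) (g z) + B (f z) (conjDerivV g z v) :=
  conjDerivV_eq fun l => by
    simp only [apply₂_eq_sum_coord B l]
    rw [conjDeriv_sum_mul _ (fun a _ => hf _) fun _ _ => hg _, map_add, apply₂_eq_sum_coord B l,
      apply₂_eq_sum_coord B l, ← Finset.sum_add_distrib]
    refine Finset.sum_congr rfl fun a _ => ?_
    rw [apply_conjDerivV hf, apply_conjDerivV hg]

theorem conjDerivV_add {f g : (Fin n → ℂ) → M} {z : Fin n → ℂ} (hf : WeakDiffAt f z)
    (hg : WeakDiffAt g z) (v : Fin n → ℂ) :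
    conjDerivV (fun w => f w + g w) z v = conjDerivV f z v + conjDerivV g z v :=
  conjDerivV_eq fun l => by
    have := conjDeriv_sum_mul (Finset.univ : Finset (Fin 2))
      (f := fun i w => if i = 0 then l (f w) else l (g w)) (g := fun _ _ => 1) (z := z)
      (fun i _ => by fin_cases i <;> simp [hf l, hg l]) (fun _ _ => differentiableAt_const _) v
    simp only [Fin.sum_univ_two, conjDeriv_const, mul_one, mul_zero, add_zero] at this
    simpa [apply_conjDerivV hf, apply_conjDerivV hg] using this

theorem conjDerivV_sum_right {ι : Type*} (s : Finset ι) (f : (Fin n → ℂ) → M) (z : Fin n → ℂ)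
    (c : ι → ℂ) (v : ι → Fin n → ℂ) : conjDerivV f z (∑ i ∈ s, c i • v i) =
      ∑ i ∈ s, (starRingEnd ℂ) (c i) • conjDerivV f z (v i) := by
  simp only [conjDerivV, conjDeriv_sum_right, conjDeriv_smul_right, Finset.smul_sum,
    Finset.sum_smul, smul_smul]
  exact Finset.sum_comm

theorem SmoothAt.conjDerivV {f : (Fin n → ℂ) → M} {z : Fin n → ℂ} (hf : SmoothAt f z)
    (v : Fin n → ℂ) : SmoothAt (fun w => conjDerivV f w v) z := fun l => by
  have h : (fun w => l (_root_.conjDerivV f w v)) =ᶠ[nhds z]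
      fun w => conjDeriv (fun x => l (f x)) w v :=
    hf.eventually_weakDiffAt.mono fun w hw => apply_conjDerivV hw l v
  exact (contDiffAt_conjDeriv (hf l) v).congr_of_eventuallyEq h

theorem conjDerivV_conjDerivV_comm {f : (Fin n → ℂ) → M} {z : Fin n → ℂ} (hf : SmoothAt f z)
    (v w : Fin n → ℂ) :
    conjDerivV (fun x => conjDerivV f x v) z w = conjDerivV (fun x => conjDerivV f x w) z v := by
  refine conjDerivV_eq fun l => ?_
  have h : ∀ v, (fun w => l (conjDerivV f w v)) =ᶠ[nhds z]
      fun w => conjDeriv (fun x => l (f x)) w v :=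
    fun v => hf.eventually_weakDiffAt.mono fun w hw => apply_conjDerivV hw l v
  rw [apply_conjDerivV (hf.conjDerivV w).weakDiffAt, conjDeriv_congr (h v), conjDeriv_congr (h w),
    conjDeriv_conjDeriv_comm (hf l)]

/-- Modulo `S` the function vanishes near `z`, and the derivative commutes with the quotient map. -/
theorem conjDerivV_mem {S : Submodule ℂ M} {f : (Fin n → ℂ) → M} {z : Fin n → ℂ}
    (hf : WeakDiffAt f z) (h : ∀ᶠ w in nhds z, f w ∈ S) (v : Fin n → ℂ) :
    conjDerivV f z v ∈ S := by
  rw [← S.ker_mkQ, LinearMap.mem_ker, ← conjDerivV_map hf]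
  have h' : (fun w => S.mkQ (f w)) =ᶠ[nhds z] fun _ => 0 :=
    h.mono fun w hw => (Submodule.Quotient.mk_eq_zero S).2 hw
  rw [conjDerivV_congr h']
  exact conjDerivV_of_holomorphicAt (fun l => analyticAt_const) v

/-! ### Holomorphic changes of frame and of coordinates -/

theorem apply_eq_sum_coord_family (T : (Fin n → ℂ) → M →ₗ[ℂ] N) (l : Module.Dual ℂ N)
    (w : Fin n → ℂ) (x : M) : l (T w x) = ∑ a, (Module.finBasis ℂ M).coord a x *
      l (T w (Module.finBasis ℂ M a)) :=
  apply_eq_sum_coord (l ∘ₗ T w) x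

theorem conjDerivV_comp {τ : (Fin n → ℂ) → Fin k → ℂ} {g : (Fin k → ℂ) → M} {z : Fin n → ℂ}
    (hτ : DifferentiableAt ℂ τ z) (hg : WeakDiffAt g (τ z)) (v : Fin n → ℂ) :
    conjDerivV (fun w => g (τ w)) z v = conjDerivV g (τ z) (fderiv ℂ τ z v) :=
  conjDerivV_eq fun l => by
    rw [apply_conjDerivV hg, conjDeriv_comp (g := fun w => l (g w)) hτ (hg l)]

/-- The product rule for a varying linear map. Its first term keeps the vector frozen at `f z`, so
that closedness of `T` on constant vectors applies to it. -/
theorem conjDerivV_family [Module.Finite ℂ N] {T : (Fin n → ℂ) → M →ₗ[ℂ] N}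
    {f : (Fin n → ℂ) → M} {z : Fin n → ℂ} (hT : ∀ x, WeakDiffAt (fun w => T w x) z)
    (hf : WeakDiffAt f z) (v : Fin n → ℂ) :
    conjDerivV (fun w => T w (f w)) z v =
      conjDerivV (fun w => T w (f z)) z v + T z (conjDerivV f z v) :=
  conjDerivV_eq fun l => by
    rw [map_add, apply_conjDerivV (hT _), funext fun w => apply_eq_sum_coord_family T l w (f w),
      funext fun w => apply_eq_sum_coord_family T l w (f z),
      apply_eq_sum_coord_family T l z (conjDerivV f z v),
      conjDeriv_sum_mul _ (fun a _ => hf _) fun a _ => hT _ l,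
      conjDeriv_sum_mul _ (fun a _ => differentiableAt_const _) fun a _ => hT _ l,
      ← Finset.sum_add_distrib]
    refine Finset.sum_congr rfl fun a _ => ?_
    rw [conjDeriv_const, zero_mul, zero_add, apply_conjDerivV hf, add_comm]

theorem localDbar_add [Module (Forms n) M] {f g : (Fin n → ℂ) → M} {z : Fin n → ℂ} (hf : WeakDiffAt f z)
    (hg : WeakDiffAt g z) :
    localDbar (fun w => f w + g w) z = localDbar f z + localDbar g z := by
  simp only [localDbar_eq, conjDerivV_add hf hg, smul_add, Finset.sum_add_distrib]

end VectorCalculus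

/-! ## The Dolbeault operator in coordinates -/

section Dolbeault

/-- Multiplication by a form, as a linear map. -/
def formMul {n : ℕ} (M : Type*) [AddCommGroup M] [Module ℂ M] [Module (Forms n) M]
    [IsScalarTower ℂ (Forms n) M] (η : Forms n) : M →ₗ[ℂ] M :=
  (Algebra.lsmul ℂ ℂ M η : Module.End ℂ M)

theorem formMul_apply {n : ℕ} {M : Type*} [AddCommGroup M] [Module ℂ M]
    [Module (Forms n) M] [IsScalarTower ℂ (Forms n) M] (η : Forms n) (x : M) : formMul M η x = η • x := rfl

variable {n : ℕ} {M : Type*} [AddCommGroup M] [Module ℂ M] [Module.Finite ℂ M] [Module (Forms n) M]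
  [IsScalarTower ℂ (Forms n) M]

theorem smoothAt_localDbar {f : (Fin n → ℂ) → M} {z : Fin n → ℂ} (hf : SmoothAt f z) :
    SmoothAt (localDbar f) z := by
  have : localDbar f = fun w => ∑ j, formMul M (ExteriorAlgebra.ι ℂ (dzbar j))
      (conjDerivV f w (Pi.single j 1)) := funext fun w => localDbar_eq f w
  rw [this]
  exact smoothAt_sum _ fun j _ => (hf.conjDerivV _).map _

theorem localDbar_smul (c : ℂ) {f : (Fin n → ℂ) → M} {z : Fin n → ℂ} (hf : WeakDiffAt f z) :
    localDbar (fun w => c • f w) z = c • localDbar f z := by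
  have : ∀ v, conjDerivV (fun w => c • f w) z v = c • conjDerivV f z v := fun v =>
    conjDerivV_map hf (LinearMap.lsmul ℂ M c) v
  simp only [localDbar_eq, this, Finset.smul_sum, ← formMul_apply, map_smul]

/-- The products `dz̄_i dz̄_j` are antisymmetric and the second derivatives symmetric, so the double
sum equals its own negative. -/
theorem localDbar_localDbar {f : (Fin n → ℂ) → M} {z : Fin n → ℂ} (hf : SmoothAt f z) :
    localDbar (localDbar f) z = 0 := by
  have h : localDbar f = fun w => ∑ j, formMul M (ExteriorAlgebra.ι ℂ (dzbar j))
      (conjDerivV f w (Pi.single j 1)) := funext fun w => localDbar_eq f w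
  have h' : ∀ v, conjDerivV (localDbar f) z v = ∑ j, ExteriorAlgebra.ι ℂ (dzbar j) •
      conjDerivV (fun w => conjDerivV f w (Pi.single j 1)) z v := by
    intro v
    rw [h]
    refine conjDerivV_eq fun l => ?_
    simp only [map_sum]
    have := conjDeriv_sum_mul Finset.univ (g := fun _ _ => 1)
      (f := fun j w => l (formMul M (ExteriorAlgebra.ι ℂ (dzbar j))
        (conjDerivV f w (Pi.single j 1)))) (z := z)
      (fun j _ => ((hf.conjDerivV (Pi.single j 1)).map (formMul M _)).weakDiffAt l)
      (fun _ _ => differentiableAt_const _) v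
    simp only [mul_one, conjDeriv_const, mul_zero, add_zero] at this
    rw [this]
    refine Finset.sum_congr rfl fun j _ => ?_
    exact (apply_conjDerivV (hf.conjDerivV (Pi.single j 1)).weakDiffAt
      (l ∘ₗ formMul M (ExteriorAlgebra.ι ℂ (dzbar j))) v).symm
  rw [localDbar_eq]
  simp only [h', Finset.smul_sum, smul_smul]
  set S := ∑ i, ∑ j, ((ExteriorAlgebra.ι ℂ (dzbar i) * ExteriorAlgebra.ι ℂ (dzbar j) : Forms n)) •
    conjDerivV (fun w => conjDerivV f w (Pi.single j 1)) z (Pi.single i 1) with hS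
  have hneg : S = -S := by
    conv_lhs => rw [hS, Finset.sum_comm]
    rw [hS, ← Finset.sum_neg_distrib]
    refine Finset.sum_congr rfl fun i _ => ?_
    rw [← Finset.sum_neg_distrib]
    refine Finset.sum_congr rfl fun j _ => ?_
    rw [ι_mul_ι_comm, neg_smul, conjDerivV_conjDerivV_comm hf]
  have h2 : (2 : ℂ) • S = 0 := by
    rw [two_smul]
    exact add_eq_zero_iff_eq_neg.2 hneg
  exact (smul_eq_zero_iff_right two_ne_zero).1 h2

theorem pullForms_dzbar (A : (Fin n → ℂ) →L[ℂ] (Fin n → ℂ)) (j : Fin n) :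
    pullForms A (ExteriorAlgebra.ι ℂ (dzbar j)) = ∑ k, (starRingEnd ℂ) (A (Pi.single k 1) j) •
      ExteriorAlgebra.ι ℂ (dzbar k) := by
  have h : pullCovector A (dzbar j) = ∑ k, (starRingEnd ℂ) (A (Pi.single k 1) j) • dzbar k := by
    refine LinearMap.ext fun x => ?_
    have := congrFun (sum_smul_map_single A.toLinearMap x) j
    simp only [ContinuousLinearMap.coe_coe, Finset.sum_apply, Pi.smul_apply, smul_eq_mul] at this
    simp [pullCovector, dzbar, ← this, mul_comm]
  rw [pullForms_ι, h]
  simp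

end Dolbeault

/-- The operator `∑ dz̄_j ∧ ∂/∂z̄_j` is compatible with holomorphic changes of coordinates. -/
theorem sum_dzbar_smul_conjDerivV {n : ℕ} {M : Type*} [AddCommGroup M]
    [Module ℂ M] [Module.Finite ℂ M] (A : (Fin n → ℂ) →L[ℂ] (Fin n → ℂ)) (f : (Fin n → ℂ) → M)
    (z : Fin n → ℂ) {N : Type*} [AddCommGroup N] [Module ℂ N] [Module (Forms n) N]
    [IsScalarTower ℂ (Forms n) N] (T : M →ₗ[ℂ] N) :
    ∑ j, (ExteriorAlgebra.ι ℂ (dzbar j) : Forms n) • T (conjDerivV f z (A (Pi.single j 1))) =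
      ∑ k, pullForms A (ExteriorAlgebra.ι ℂ (dzbar k)) • T (conjDerivV f z (Pi.single k 1)) := by
  have h : ∀ j, A (Pi.single j 1) = ∑ k, A (Pi.single j 1) k • Pi.single k (1 : ℂ) := by
    intro j
    conv_lhs => rw [pi_eq_sum_univ' (A (Pi.single j 1))]
  simp only [pullForms_dzbar, Finset.sum_smul]
  conv_lhs => enter [2, j]; rw [h j, conjDerivV_sum_right, map_sum, Finset.smul_sum]
  rw [Finset.sum_comm]
  refine Finset.sum_congr rfl fun k _ => Finset.sum_congr rfl fun j _ => ?_
  rw [map_smul, smul_assoc, ← formMul_apply, map_smul, formMul_apply]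

/-! ## The adjoint representation -/

section LieGroup
variable {m : ℕ} {G : Type v} [TopologicalSpace G] [ChartedSpace (Fin m → ℂ) G] [Group G]

/-- The base point is a variable equal to `1`, so that points such as `h * 1 * h⁻¹` from the chain
rule are accepted without rewriting inside the dependent tangent space. -/
theorem Ad_apply_eq_mfderiv (g x : G) (hx : x = 1) (Y : LieAlg m G) :
    Ad g Y = (mfderiv 𝓘(ℂ, Fin m → ℂ) 𝓘(ℂ, Fin m → ℂ) (fun x : G => g * x * g⁻¹) x :
      (Fin m → ℂ) →L[ℂ] (Fin m → ℂ)) Y := by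
  subst hx
  rfl

theorem Ad_one : Ad (1 : G) = (LinearMap.id : LieAlg m G →ₗ[ℂ] LieAlg m G) := by
  refine LinearMap.ext fun Y => ?_
  have h : (fun x : G => 1 * x * 1⁻¹) = id := by ext x; simp
  rw [Ad_apply_eq_mfderiv 1 1 rfl, h, mfderiv_id]
  rfl

variable (m G) in
/-- The multiplication of `G` in the preferred chart at the identity. -/
def chartMul (z : (Fin m → ℂ) × (Fin m → ℂ)) : Fin m → ℂ :=
  extChartAt 𝓘(ℂ, Fin m → ℂ) (1 : G) ((extChartAt 𝓘(ℂ, Fin m → ℂ) (1 : G)).symm z.1 *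
    (extChartAt 𝓘(ℂ, Fin m → ℂ) (1 : G)).symm z.2)

/-- Conjugation in the preferred chart at the identity. -/
def chartConj (G : Type v) [TopologicalSpace G] [ChartedSpace (Fin m → ℂ) G] [Group G]
    (w y : Fin m → ℂ) : Fin m → ℂ :=
  extChartAt 𝓘(ℂ, Fin m → ℂ) (1 : G) ((extChartAt 𝓘(ℂ, Fin m → ℂ) (1 : G)).symm w *
    (extChartAt 𝓘(ℂ, Fin m → ℂ) (1 : G)).symm y *
    ((extChartAt 𝓘(ℂ, Fin m → ℂ) (1 : G)).symm w)⁻¹)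

variable (m G) in
/-- The coordinates of the identity. -/
abbrev chartOne : Fin m → ℂ := extChartAt 𝓘(ℂ, Fin m → ℂ) (1 : G) 1

theorem eventually_chartMul_one_left :
    ∀ᶠ w in nhds (chartOne m G), chartMul m G (chartOne m G, w) = w := by
  filter_upwards [extChartAt_target_mem_nhds (I := 𝓘(ℂ, Fin m → ℂ)) (1 : G)] with w hw
  rw [chartMul, extChartAt_to_inv, one_mul, PartialEquiv.right_inv _ hw]

theorem eventually_chartMul_one_right :
    ∀ᶠ w in nhds (chartOne m G), chartMul m G (w, chartOne m G) = w := by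
  filter_upwards [extChartAt_target_mem_nhds (I := 𝓘(ℂ, Fin m → ℂ)) (1 : G)] with w hw
  rw [chartMul, extChartAt_to_inv, mul_one, PartialEquiv.right_inv _ hw]

theorem fderiv_chartMul_right {w y : Fin m → ℂ} (h : DifferentiableAt ℂ (chartMul m G) (w, y))
    (Y : Fin m → ℂ) :
    fderiv ℂ (fun y => chartMul m G (w, y)) y Y = fderiv ℂ (chartMul m G) (w, y) (0, Y) := by
  have h1 : HasFDerivAt (fun y : Fin m → ℂ => (w, y))
      (ContinuousLinearMap.inr ℂ (Fin m → ℂ) (Fin m → ℂ)) y := hasFDerivAt_prodMk_right w y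
  have h2 := (h.hasFDerivAt.comp (f := fun y : Fin m → ℂ => (w, y)) y h1).fderiv
  exact congrArg (fun A : (Fin m → ℂ) →L[ℂ] (Fin m → ℂ) => A Y) h2 |>.trans (by simp)

theorem fderiv_chartMul_left {w y : Fin m → ℂ} (h : DifferentiableAt ℂ (chartMul m G) (w, y))
    (Y : Fin m → ℂ) :
    fderiv ℂ (fun w => chartMul m G (w, y)) w Y = fderiv ℂ (chartMul m G) (w, y) (Y, 0) := by
  have h1 : HasFDerivAt (fun w : Fin m → ℂ => (w, y))
      (ContinuousLinearMap.inl ℂ (Fin m → ℂ) (Fin m → ℂ)) w := hasFDerivAt_prodMk_left w y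
  have h2 := (h.hasFDerivAt.comp (f := fun w : Fin m → ℂ => (w, y)) w h1).fderiv
  exact congrArg (fun A : (Fin m → ℂ) →L[ℂ] (Fin m → ℂ) => A Y) h2 |>.trans (by simp)

variable [LieGroup 𝓘(ℂ, Fin m → ℂ) ω G]

theorem contMDiff_conj (g : G) : ContMDiff 𝓘(ℂ, Fin m → ℂ) 𝓘(ℂ, Fin m → ℂ) ω
    (fun x : G => g * x * g⁻¹) :=
  (contMDiff_const.mul contMDiff_id).mul contMDiff_const

theorem mdifferentiable_conj (g : G) : MDifferentiable 𝓘(ℂ, Fin m → ℂ) 𝓘(ℂ, Fin m → ℂ)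
    (fun x : G => g * x * g⁻¹) :=
  (contMDiff_conj g).mdifferentiable (by simp)

theorem Ad_mul (g h : G) (Y : LieAlg m G) : Ad (g * h) Y = Ad g (Ad h Y) := by
  have hc : (fun x : G => g * h * x * (g * h)⁻¹) = (fun x => g * x * g⁻¹) ∘ fun x => h * x * h⁻¹ := by
    ext x; simp [mul_assoc]
  rw [Ad_apply_eq_mfderiv (g * h) 1 rfl, hc, mfderiv_comp (I' := 𝓘(ℂ, Fin m → ℂ)) 1
    (mdifferentiable_conj g _) (mdifferentiable_conj h _), Ad_apply_eq_mfderiv g (h * 1 * h⁻¹) (by simp)]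
  rfl

theorem inverse_mfderiv_conj_apply (g x : G)
    (Y : TangentSpace 𝓘(ℂ, Fin m → ℂ) x) :
    (mfderiv 𝓘(ℂ, Fin m → ℂ) 𝓘(ℂ, Fin m → ℂ) (fun x : G => g * x * g⁻¹) x).inverse
      (mfderiv 𝓘(ℂ, Fin m → ℂ) 𝓘(ℂ, Fin m → ℂ) (fun x : G => g * x * g⁻¹) x Y) = Y := by
  have key : ∀ (g g' x : G), g' * g = 1 → ((mfderiv 𝓘(ℂ, Fin m → ℂ) 𝓘(ℂ, Fin m → ℂ)
      (fun x : G => g' * x * g) (g * x * g') : (Fin m → ℂ) →L[ℂ] (Fin m → ℂ))).comp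
      (mfderiv 𝓘(ℂ, Fin m → ℂ) 𝓘(ℂ, Fin m → ℂ) (fun x : G => g * x * g') x :
      (Fin m → ℂ) →L[ℂ] (Fin m → ℂ)) = ContinuousLinearMap.id ℂ _ := by
    intro g g' x hg
    have hd : ∀ a b : G, MDifferentiable 𝓘(ℂ, Fin m → ℂ) 𝓘(ℂ, Fin m → ℂ)
        fun x : G => a * x * b := fun a b =>
      ((contMDiff_const.mul contMDiff_id).mul contMDiff_const : ContMDiff 𝓘(ℂ, Fin m → ℂ)
        𝓘(ℂ, Fin m → ℂ) ω fun x : G => a * x * b).mdifferentiable (by simp)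
    have h : (fun x : G => g' * x * g) ∘ (fun x => g * x * g') = id := by
      ext x
      have : g' * (g * x * g') * g = (g' * g) * x * (g' * g) := by simp only [mul_assoc]
      simp [this, hg]
    have h1 := mfderiv_comp (I' := 𝓘(ℂ, Fin m → ℂ)) x (hd g' g _) (hd g g' x)
    rw [h, mfderiv_id] at h1
    exact h1.symm
  have h1 := key g g⁻¹ x (inv_mul_cancel g)
  have h2 := key g⁻¹ g (g * x * g⁻¹) (mul_inv_cancel g)
  have e : g⁻¹ * (g * x * g⁻¹) * g = x := by simp [mul_assoc]
  rw [e] at h2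
  have h3 := ContinuousLinearMap.inverse_eq h2 h1
  exact (congrArg (fun A : (Fin m → ℂ) →L[ℂ] (Fin m → ℂ) => A _) h3).trans
    (congrArg (fun A : (Fin m → ℂ) →L[ℂ] (Fin m → ℂ) => A Y) h1)

/-- Conjugation by `g` intertwines left translation by `x` with left translation by `g x g⁻¹`;
differentiating this identity at `1` gives the claim. -/
theorem mpullback_conj_mulInvariantVectorField (g : G) (Y : LieAlg m G) :
    VectorField.mpullback 𝓘(ℂ, Fin m → ℂ) 𝓘(ℂ, Fin m → ℂ) (fun x : G => g * x * g⁻¹)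
      (mulInvariantVectorField (Ad g Y)) = mulInvariantVectorField Y := by
  funext x
  have hl : ∀ a : G, MDifferentiable 𝓘(ℂ, Fin m → ℂ) 𝓘(ℂ, Fin m → ℂ) (fun x : G => a * x) :=
    fun a => (contMDiff_mul_left (n := ω)).mdifferentiable (by simp)
  have h : mulInvariantVectorField (Ad g Y) (g * x * g⁻¹) =
      mfderiv 𝓘(ℂ, Fin m → ℂ) 𝓘(ℂ, Fin m → ℂ) (fun x : G => g * x * g⁻¹) x
        (mulInvariantVectorField Y x) := by
    have hc : (fun y : G => g * x * g⁻¹ * y) ∘ (fun y : G => g * y * g⁻¹) =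
        (fun y => g * y * g⁻¹) ∘ fun y => x * y := by ext y; simp [mul_assoc]
    have h1 := mfderiv_comp (I' := 𝓘(ℂ, Fin m → ℂ)) (1 : G) (hl (g * x * g⁻¹) _)
      (mdifferentiable_conj g 1)
    have h2 := mfderiv_comp (I' := 𝓘(ℂ, Fin m → ℂ)) (1 : G) 
      (mdifferentiable_conj g _) (hl x 1)
    rw [hc] at h1
    have h3 := congrArg (fun A : (Fin m → ℂ) →L[ℂ] (Fin m → ℂ) => A Y) (h1.symm.trans h2)
    have e1 : g * 1 * g⁻¹ = 1 := by simp
    have e2 : x * 1 = x := mul_one x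
    rw [e1, e2] at h3
    exact h3
  rw [VectorField.mpullback, h, inverse_mfderiv_conj_apply]

/-- Pullback of vector fields preserves Lie brackets, and pullback by conjugation takes the
invariant field of `Ad g Y` to that of `Y`. -/
theorem Ad_lie (g : G) (Y Z : LieAlg m G) : Ad g ⁅Y, Z⁆ = ⁅Ad g Y, Ad g Z⁆ := by
  have h := VectorField.mpullback_mlieBracket (n := ω) (x₀ := (1 : G)) (f := fun x : G => g * x * g⁻¹)
    (V := mulInvariantVectorField (Ad g Y)) (W := mulInvariantVectorField (Ad g Z))
    (mdifferentiableAt_mulInvariantVectorField (I := 𝓘(ℂ, Fin m → ℂ)) (Ad g Y)) (mdifferentiableAt_mulInvariantVectorField (I := 𝓘(ℂ, Fin m → ℂ)) (Ad g Z))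
    (contMDiff_conj g 1) (by simp)
  rw [mpullback_conj_mulInvariantVectorField, mpullback_conj_mulInvariantVectorField,
    ← GroupLieAlgebra.bracket_def, VectorField.mpullback] at h
  have e : g * 1 * g⁻¹ = 1 := by simp
  -- Writing the bracket as an image under `Ad g` lets the inverse derivative in the pullback
  -- cancel.
  have h1 : VectorField.mlieBracket 𝓘(ℂ, Fin m → ℂ) (mulInvariantVectorField (Ad g Y))
      (mulInvariantVectorField (Ad g Z)) (g * 1 * g⁻¹) =
      mfderiv 𝓘(ℂ, Fin m → ℂ) 𝓘(ℂ, Fin m → ℂ) (fun x : G => g * x * g⁻¹) 1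
        (Ad g⁻¹ ⁅Ad g Y, Ad g Z⁆) := by
    have h2 : Ad g (Ad g⁻¹ ⁅Ad g Y, Ad g Z⁆) = ⁅Ad g Y, Ad g Z⁆ := by
      rw [← Ad_mul, mul_inv_cancel, Ad_one, LinearMap.id_apply]
    refine Eq.trans ?_ h2.symm
    rw [GroupLieAlgebra.bracket_def, e]
  rw [h1, inverse_mfderiv_conj_apply] at h
  rw [← h, ← Ad_mul, mul_inv_cancel, Ad_one, LinearMap.id_apply]

/-- Joint analyticity in the parameter and the group variable is needed: the derivative in the
second variable, which is `Ad (γ w)`, then depends analytically on `w`. -/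
theorem contDiffAt_chart_conj {n : ℕ} {γ : (Fin n → ℂ) → G} {z : Fin n → ℂ}
    (hγ : ContMDiffAt 𝓘(ℂ, Fin n → ℂ) 𝓘(ℂ, Fin m → ℂ) ω γ z) :
    ContDiffAt ℂ ω (Function.uncurry fun (w : Fin n → ℂ) (y : Fin m → ℂ) =>
      extChartAt 𝓘(ℂ, Fin m → ℂ) (1 : G)
        (γ w * (extChartAt 𝓘(ℂ, Fin m → ℂ) (1 : G)).symm y * (γ w)⁻¹))
      (z, extChartAt 𝓘(ℂ, Fin m → ℂ) (1 : G) 1) := by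
  rw [← contMDiffAt_iff_contDiffAt]
  have h1 : ContMDiffAt 𝓘(ℂ, (Fin n → ℂ) × (Fin m → ℂ)) 𝓘(ℂ, Fin m → ℂ) ω
      (fun x : (Fin n → ℂ) × (Fin m → ℂ) => γ x.1) (z, extChartAt 𝓘(ℂ, Fin m → ℂ) (1 : G) 1) :=
    hγ.comp (z, extChartAt 𝓘(ℂ, Fin m → ℂ) (1 : G) 1) contDiff_fst.contMDiff.contMDiffAt
  have h2 : ContMDiffAt 𝓘(ℂ, (Fin n → ℂ) × (Fin m → ℂ)) 𝓘(ℂ, Fin m → ℂ) ω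
      (fun x : (Fin n → ℂ) × (Fin m → ℂ) => (extChartAt 𝓘(ℂ, Fin m → ℂ) (1 : G)).symm x.2)
      (z, extChartAt 𝓘(ℂ, Fin m → ℂ) (1 : G) 1) :=
    ((contMDiffOn_extChartAt_symm (1 : G)).contMDiffAt (extChartAt_target_mem_nhds (1 : G))).comp
      (z, extChartAt 𝓘(ℂ, Fin m → ℂ) (1 : G) 1) contDiff_snd.contMDiff.contMDiffAt
  refine ContMDiffAt.comp _ ?_ ((h1.mul h2).mul h1.inv)
  have e : γ z * (extChartAt 𝓘(ℂ, Fin m → ℂ) (1 : G)).symm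
      (extChartAt 𝓘(ℂ, Fin m → ℂ) (1 : G) 1) * (γ z)⁻¹ = 1 := by simp
  rw [e]
  exact contMDiffAt_extChartAt

theorem Ad_apply_eq_fderiv (g : G) (Y : LieAlg m G) :
    Ad g Y = fderiv ℂ (fun y : Fin m → ℂ => extChartAt 𝓘(ℂ, Fin m → ℂ) (1 : G)
      (g * (extChartAt 𝓘(ℂ, Fin m → ℂ) (1 : G)).symm y * g⁻¹))
      (extChartAt 𝓘(ℂ, Fin m → ℂ) (1 : G) 1) Y := by
  have e : g * 1 * g⁻¹ = 1 := by simp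
  have h := congrArg (fun A : (Fin m → ℂ) →L[ℂ] (Fin m → ℂ) => A Y)
    (mdifferentiable_conj (m := m) g 1).mfderiv
  simp only [writtenInExtChartAt, e, modelWithCornersSelf_coe, Set.range_id,
    fderivWithin_univ] at h
  exact h

theorem contDiffAt_Ad {n : ℕ} {γ : (Fin n → ℂ) → G} {z : Fin n → ℂ}
    (hγ : ContMDiffAt 𝓘(ℂ, Fin n → ℂ) 𝓘(ℂ, Fin m → ℂ) ω γ z) (Y : LieAlg m G) :
    ContDiffAt ℂ ω (F := Fin m → ℂ) (fun w => Ad (γ w) Y) z := by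
  have h := (contDiffAt_chart_conj hγ).fderiv (m := ω) (g := fun _ => _) contDiffAt_const le_rfl
  have h2 := h.clm_apply (contDiffAt_const (c := @id (Fin m → ℂ) Y))
  refine h2.congr_of_eventuallyEq (Filter.Eventually.of_forall fun w => ?_)
  exact Ad_apply_eq_fderiv (γ w) Y

theorem holomorphicAt_Ad {n : ℕ} {γ : (Fin n → ℂ) → G} {z : Fin n → ℂ}
    (hγ : ContMDiffAt 𝓘(ℂ, Fin n → ℂ) 𝓘(ℂ, Fin m → ℂ) ω γ z) (Y : LieAlg m G) :
    HolomorphicAt (fun w => Ad (γ w) Y) z := fun l => by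
  let l' : (Fin m → ℂ) →L[ℂ] ℂ := LinearMap.toContinuousLinearMap l
  exact (ContDiffAt.comp z l'.contDiff.contDiffAt (contDiffAt_Ad hγ Y)).analyticAt

theorem differentiableAt_Ad_chart (Y : LieAlg m G) :
    DifferentiableAt ℂ (F := Fin m → ℂ)
      (fun w => Ad ((extChartAt 𝓘(ℂ, Fin m → ℂ) (1 : G)).symm w) Y)
      (extChartAt 𝓘(ℂ, Fin m → ℂ) (1 : G) 1) :=
  (contDiffAt_Ad ((contMDiffOn_extChartAt_symm (n := ω) (I := 𝓘(ℂ, Fin m → ℂ))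
    (1 : G)).contMDiffAt (extChartAt_target_mem_nhds (1 : G))) Y).differentiableAt (by simp)

/-! ### The derivative of the adjoint representation -/

theorem contDiffAt_chartMul : ContDiffAt ℂ ω (chartMul m G) (chartOne m G, chartOne m G) := by
  rw [← contMDiffAt_iff_contDiffAt]
  have h0 := (contMDiffOn_extChartAt_symm (n := ω) (I := 𝓘(ℂ, Fin m → ℂ)) (1 : G)).contMDiffAt
    (extChartAt_target_mem_nhds (1 : G))
  have h1 : ContMDiffAt 𝓘(ℂ, (Fin m → ℂ) × (Fin m → ℂ)) 𝓘(ℂ, Fin m → ℂ) ω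
      (fun x : (Fin m → ℂ) × (Fin m → ℂ) => (extChartAt 𝓘(ℂ, Fin m → ℂ) (1 : G)).symm x.1)
      (chartOne m G, chartOne m G) :=
    h0.comp (chartOne m G, chartOne m G) contDiff_fst.contMDiff.contMDiffAt
  have h2 : ContMDiffAt 𝓘(ℂ, (Fin m → ℂ) × (Fin m → ℂ)) 𝓘(ℂ, Fin m → ℂ) ω
      (fun x : (Fin m → ℂ) × (Fin m → ℂ) => (extChartAt 𝓘(ℂ, Fin m → ℂ) (1 : G)).symm x.2)
      (chartOne m G, chartOne m G) :=
    h0.comp (chartOne m G, chartOne m G) contDiff_snd.contMDiff.contMDiffAt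
  refine ContMDiffAt.comp _ ?_ (h1.mul h2)
  have e : (extChartAt 𝓘(ℂ, Fin m → ℂ) (1 : G)).symm (chartOne m G) *
      (extChartAt 𝓘(ℂ, Fin m → ℂ) (1 : G)).symm (chartOne m G) = 1 := by
    rw [chartOne, extChartAt_to_inv, mul_one]
  rw [e]
  exact contMDiffAt_extChartAt

theorem eventually_differentiableAt_chartMul :
    ∀ᶠ z in nhds (chartOne m G, chartOne m G), DifferentiableAt ℂ (chartMul m G) z :=
  ((contDiffAt_chartMul (m := m) (G := G)).eventually (by simp)).mono fun _ h =>
    h.differentiableAt (by simp)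

theorem fderiv_chartMul_one_right (Y : Fin m → ℂ) :
    fderiv ℂ (chartMul m G) (chartOne m G, chartOne m G) (0, Y) = Y := by
  rw [← fderiv_chartMul_right (contDiffAt_chartMul.differentiableAt (by simp)),
    Filter.EventuallyEq.fderiv_eq (eventually_chartMul_one_left (m := m) (G := G)), fderiv_fun_id]
  rfl

theorem fderiv_chartMul_one_left (Y : Fin m → ℂ) :
    fderiv ℂ (chartMul m G) (chartOne m G, chartOne m G) (Y, 0) = Y := by
  rw [← fderiv_chartMul_left (contDiffAt_chartMul.differentiableAt (by simp)),
    Filter.EventuallyEq.fderiv_eq (eventually_chartMul_one_right (m := m) (G := G)), fderiv_fun_id]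
  rfl

/-- An invariant field is the derivative of left translation at `1`; in the chart this is a partial
derivative of the multiplication in its second variable. -/
theorem mulInvariantVectorField_chart (Y : LieAlg m G) :
    VectorField.mpullbackWithin 𝓘(ℂ, Fin m → ℂ) 𝓘(ℂ, Fin m → ℂ)
      (extChartAt 𝓘(ℂ, Fin m → ℂ) (1 : G)).symm (mulInvariantVectorField Y)
      (Set.range 𝓘(ℂ, Fin m → ℂ)) =ᶠ[nhds (chartOne m G)]
    fun w => fderiv ℂ (chartMul m G) (w, chartOne m G) (0, Y) := by
  have hd : ∀ᶠ w in nhds (chartOne m G),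
      DifferentiableAt ℂ (chartMul m G) (w, chartOne m G) :=
    (ContinuousAt.prodMk continuousAt_id continuousAt_const :
      ContinuousAt (fun w : Fin m → ℂ => (w, chartOne m G)) _).eventually
      eventually_differentiableAt_chartMul
  filter_upwards [extChartAt_target_mem_nhds (I := 𝓘(ℂ, Fin m → ℂ)) (1 : G), hd] with w hw hdw
  set φ := extChartAt 𝓘(ℂ, Fin m → ℂ) (1 : G) with hφ
  set g : G := φ.symm w with hg
  have hs : g ∈ φ.source := φ.map_target hw
  have hinv : (mfderivWithin 𝓘(ℂ, Fin m → ℂ) 𝓘(ℂ, Fin m → ℂ) φ.symm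
      (Set.range 𝓘(ℂ, Fin m → ℂ)) w).inverse = mfderiv 𝓘(ℂ, Fin m → ℂ) 𝓘(ℂ, Fin m → ℂ) φ g :=
    ContinuousLinearMap.inverse_eq (mfderivWithin_extChartAt_symm_comp_mfderiv_extChartAt hw)
      (mfderiv_extChartAt_comp_mfderivWithin_extChartAt_symm hw)
  have hφd : MDifferentiableAt 𝓘(ℂ, Fin m → ℂ) 𝓘(ℂ, Fin m → ℂ) φ g :=
    mdifferentiableAt_extChartAt (by simpa [hφ] using hs)
  have hl : MDifferentiableAt 𝓘(ℂ, Fin m → ℂ) 𝓘(ℂ, Fin m → ℂ) (fun x : G => g * x) 1 :=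
    (contMDiff_mul_left (n := ω)).mdifferentiable (by simp) 1
  have hφd' : MDifferentiableAt 𝓘(ℂ, Fin m → ℂ) 𝓘(ℂ, Fin m → ℂ) φ (g * 1) := by
    rwa [mul_one]
  have hc := mfderiv_comp (I' := 𝓘(ℂ, Fin m → ℂ)) (1 : G) hφd' hl
  have e1 : g * 1 = g := mul_one g
  rw [e1] at hc
  have hc' := congrArg (fun A : (Fin m → ℂ) →L[ℂ] (Fin m → ℂ) => A Y)
    ((hφd'.comp (1 : G) hl).mfderiv.symm.trans hc)
  simp only [writtenInExtChartAt, modelWithCornersSelf_coe, Set.range_id,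
    fderivWithin_univ] at hc'
  refine Eq.trans ?_ (fderiv_chartMul_right hdw Y)
  rw [VectorField.mpullbackWithin, hinv]
  exact hc'.symm

theorem fderiv_fderiv_chartMul (Y Z : Fin m → ℂ) :
    fderiv ℂ (fun w => fderiv ℂ (chartMul m G) (w, chartOne m G) (0, Y)) (chartOne m G) Z =
      fderiv ℂ (fderiv ℂ (chartMul m G)) (chartOne m G, chartOne m G) (Z, 0) (0, Y) := by
  have h0 : DifferentiableAt ℂ (fderiv ℂ (chartMul m G)) (chartOne m G, chartOne m G) :=
    (contDiffAt_chartMul.fderiv_right (m := 1) (by simp)).differentiableAt one_ne_zero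
  have h1 : HasFDerivAt (fun w : Fin m → ℂ => (w, chartOne m G))
    (ContinuousLinearMap.inl ℂ (Fin m → ℂ) (Fin m → ℂ)) (chartOne m G) :=
    hasFDerivAt_prodMk_left _ _
  have h2 := (h0.hasFDerivAt.comp (f := fun w : Fin m → ℂ => (w, chartOne m G)) _ h1).clm_apply
    (hasFDerivAt_const ((0 : Fin m → ℂ), Y) (chartOne m G))
  have h3 := congrArg (fun A : (Fin m → ℂ) →L[ℂ] (Fin m → ℂ) => A Z) h2.fderiv
  simpa using h3

/-- Both fields take their defining vectors as values at the identity, so the bracket is the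
antisymmetrised mixed second derivative of the multiplication. -/
theorem lieBracket_chartMul (Y Z : Fin m → ℂ) :
    VectorField.lieBracket ℂ (fun w => fderiv ℂ (chartMul m G) (w, chartOne m G) (0, Y))
      (fun w => fderiv ℂ (chartMul m G) (w, chartOne m G) (0, Z)) (chartOne m G) =
    fderiv ℂ (fderiv ℂ (chartMul m G)) (chartOne m G, chartOne m G) (Y, 0) (0, Z) -
    fderiv ℂ (fderiv ℂ (chartMul m G)) (chartOne m G, chartOne m G) (Z, 0) (0, Y) := by
  rw [VectorField.lieBracket_eq]
  simp only [fderiv_fderiv_chartMul, fderiv_chartMul_one_right]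

theorem mlieBracket_mulInvariantVectorField (Y Z : LieAlg m G) :
    VectorField.mlieBracket 𝓘(ℂ, Fin m → ℂ) (mulInvariantVectorField Y)
      (mulInvariantVectorField Z) (1 : G) = VectorField.lieBracket ℂ
      (fun w => fderiv ℂ (chartMul m G) (w, chartOne m G) (0, Y))
      (fun w => fderiv ℂ (chartMul m G) (w, chartOne m G) (0, Z)) (chartOne m G) := by
  have h1 := Filter.EventuallyEq.lieBracket_vectorField_eq (𝕜 := ℂ)
    (mulInvariantVectorField_chart Y) (mulInvariantVectorField_chart Z)
  have hset : (extChartAt 𝓘(ℂ, Fin m → ℂ) (1 : G)).symm ⁻¹' Set.univ ∩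
      Set.range 𝓘(ℂ, Fin m → ℂ) = Set.univ := by simp
  have hid : (mfderiv 𝓘(ℂ, Fin m → ℂ) 𝓘(ℂ, Fin m → ℂ) (extChartAt 𝓘(ℂ, Fin m → ℂ) (1 : G))
      1).inverse = ContinuousLinearMap.id ℂ (Fin m → ℂ) := by
    rw [mfderiv_extChartAt_self]
    exact ContinuousLinearMap.inverse_id
  rw [← VectorField.mlieBracketWithin_univ, VectorField.mlieBracketWithin_apply, hid, hset]
  exact (congrFun VectorField.lieBracketWithin_univ _).trans h1

/-- Differentiate `w y = (w y w⁻¹) w` in `y` at the identity. This isolates `Ad w` without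
differentiating the inverse. -/
theorem fderiv_chartMul_eq_conj {w : Fin m → ℂ}
    (h1 : DifferentiableAt ℂ (chartMul m G) (w, chartOne m G))
    (h2 : DifferentiableAt ℂ (chartMul m G) (chartOne m G, w)) (Y : Fin m → ℂ) :
    fderiv ℂ (chartMul m G) (w, chartOne m G) (0, Y) = fderiv ℂ (chartMul m G) (chartOne m G, w)
      (fderiv ℂ (chartConj G w) (chartOne m G) Y, 0) := by
  set φ := extChartAt 𝓘(ℂ, Fin m → ℂ) (1 : G) with hφ
  set g := φ.symm w with hg
  let c : (Fin m → ℂ) → Fin m → ℂ := fun y => φ (g * φ.symm y * g⁻¹)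
  have hc0 : c (chartOne m G) = chartOne m G := by
    simp only [c, chartOne, hφ, extChartAt_to_inv, mul_one, mul_inv_cancel]
  have hcd : DifferentiableAt ℂ c (chartOne m G) := by
    have h := contDiffAt_chart_conj (m := m) (γ := fun _ : Fin 0 → ℂ => g) (z := 0)
      contMDiffAt_const
    have h' := h.comp (f := fun y : Fin m → ℂ => ((0 : Fin 0 → ℂ), y)) (chartOne m G)
      (contDiffAt_const.prodMk contDiffAt_id)
    exact h'.differentiableAt (by simp)
  have hcont : ContinuousAt (fun y => g * φ.symm y * g⁻¹) (chartOne m G) :=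
    ContinuousAt.comp (g := fun x : G => g * x * g⁻¹)
      (contMDiff_conj (m := m) g).continuous.continuousAt (continuousAt_extChartAt_symm (1 : G))
  have hev : (fun y => chartMul m G (w, y)) =ᶠ[nhds (chartOne m G)]
      fun y => chartMul m G (c y, w) := by
    have hmem : ∀ᶠ y in nhds (chartOne m G), g * φ.symm y * g⁻¹ ∈ φ.source := by
      refine hcont.eventually_mem ?_
      have : g * φ.symm (chartOne m G) * g⁻¹ = 1 := by
        simp only [chartOne, hφ, extChartAt_to_inv, mul_one, mul_inv_cancel]
      rw [this]
      exact extChartAt_source_mem_nhds (1 : G)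
    filter_upwards [hmem] with y hy
    simp only [chartMul, c]
    rw [← hφ, φ.left_inv hy, ← hg, inv_mul_cancel_right]
  rw [← fderiv_chartMul_right h1, hev.fderiv_eq]
  have h3 : DifferentiableAt ℂ (fun y => chartMul m G (y, w)) (chartOne m G) :=
    DifferentiableAt.comp (f := fun y : Fin m → ℂ => (y, w)) (chartOne m G) h2
      (hasFDerivAt_prodMk_left _ _).differentiableAt
  have h3' := h3.hasFDerivAt
  rw [← hc0] at h3'
  have h4 := congrArg (fun A : (Fin m → ℂ) →L[ℂ] (Fin m → ℂ) => A Y)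
    (HasFDerivAt.comp (f := c) (g := fun y => chartMul m G (y, w)) (chartOne m G) h3'
      hcd.hasFDerivAt).fderiv
  refine h4.trans ?_
  rw [hc0]
  exact fderiv_chartMul_left h2 _

/-- Differentiating the previous identity in `w` at `1` gives a mixed second derivative on the left,
and the other mixed derivative plus the derivative of `Ad` on the right. Symmetry of second
derivatives brings them to the same form. -/
theorem fderiv_fderiv_conj (Y Z : Fin m → ℂ)
    (hA : DifferentiableAt ℂ (fun w => fderiv ℂ (chartConj G w) (chartOne m G) Y) (chartOne m G))
    (hA1 : fderiv ℂ (chartConj G (chartOne m G)) (chartOne m G) Y = Y) :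
    fderiv ℂ (fun w => fderiv ℂ (chartConj G w) (chartOne m G) Y) (chartOne m G) Z =
    fderiv ℂ (fderiv ℂ (chartMul m G)) (chartOne m G, chartOne m G) (Z, 0) (0, Y) -
    fderiv ℂ (fderiv ℂ (chartMul m G)) (chartOne m G, chartOne m G) (Y, 0) (0, Z) := by
  have hd1 : ∀ᶠ w in nhds (chartOne m G),
      DifferentiableAt ℂ (chartMul m G) (w, chartOne m G) :=
    (ContinuousAt.prodMk continuousAt_id continuousAt_const :
      ContinuousAt (fun w : Fin m → ℂ => (w, chartOne m G)) _).eventually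
      eventually_differentiableAt_chartMul
  have hd2 : ∀ᶠ w in nhds (chartOne m G),
      DifferentiableAt ℂ (chartMul m G) (chartOne m G, w) :=
    (ContinuousAt.prodMk continuousAt_const continuousAt_id :
      ContinuousAt (fun w : Fin m → ℂ => (chartOne m G, w)) _).eventually
      eventually_differentiableAt_chartMul
  have hev' : (fun w => fderiv ℂ (chartMul m G) (w, chartOne m G) (0, Y)) =ᶠ[nhds (chartOne m G)]
      fun w => fderiv ℂ (chartMul m G) (chartOne m G, w)
        (fderiv ℂ (chartConj G w) (chartOne m G) Y, 0) := by
    filter_upwards [hd1, hd2] with w h1 h2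
    exact fderiv_chartMul_eq_conj h1 h2 Y
  have h0 : DifferentiableAt ℂ (fderiv ℂ (chartMul m G)) (chartOne m G, chartOne m G) :=
    (contDiffAt_chartMul.fderiv_right (m := 1) (by simp)).differentiableAt one_ne_zero
  have hr := (h0.hasFDerivAt.comp (f := fun w : Fin m → ℂ => (chartOne m G, w)) _
    (hasFDerivAt_prodMk_right _ _)).clm_apply
      (hA.hasFDerivAt.prodMk (hasFDerivAt_const (0 : Fin m → ℂ) _))
  have h := congrArg (fun A : (Fin m → ℂ) →L[ℂ] (Fin m → ℂ) => A Z)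
    (hev'.fderiv_eq.trans hr.fderiv)
  have hsymm : IsSymmSndFDerivAt ℂ (chartMul m G) (chartOne m G, chartOne m G) :=
    contDiffAt_chartMul.isSymmSndFDerivAt (by simp)
  simp only [fderiv_fderiv_chartMul, hA1] at h
  rw [← hsymm.eq ((0 : Fin m → ℂ), Z), h]
  simp [fderiv_chartMul_one_left]

theorem fderiv_Ad (Y : LieAlg m G) (Z : LieAlg m G) :
    fderiv ℂ (F := Fin m → ℂ)
      (fun w => Ad ((extChartAt 𝓘(ℂ, Fin m → ℂ) (1 : G)).symm w) Y) (chartOne m G) Z = ⁅Z, Y⁆ := by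
  have hA : (fun w => (Ad ((extChartAt 𝓘(ℂ, Fin m → ℂ) (1 : G)).symm w) Y : Fin m → ℂ)) =
      fun w => fderiv ℂ (chartConj G w) (chartOne m G) Y :=
    funext fun w => Ad_apply_eq_fderiv ((extChartAt 𝓘(ℂ, Fin m → ℂ) (1 : G)).symm w) Y
  have hd := differentiableAt_Ad_chart Y
  have h1 := congrFun hA (chartOne m G)
  rw [extChartAt_to_inv, Ad_one] at h1
  have h2 : DifferentiableAt ℂ (fun w => fderiv ℂ (chartConj G w) (chartOne m G) Y)
      (chartOne m G) := hA ▸ hd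
  have h3 := fderiv_fderiv_conj (m := m) (G := G) Y Z h2 h1.symm
  have h4 : fderiv ℂ (F := Fin m → ℂ)
      (fun w => Ad ((extChartAt 𝓘(ℂ, Fin m → ℂ) (1 : G)).symm w) Y) (chartOne m G) =
      fderiv ℂ (fun w => fderiv ℂ (chartConj G w) (chartOne m G) Y) (chartOne m G) :=
    congrArg (fun f => fderiv ℂ f (chartOne m G)) hA
  have h5 := (mlieBracket_mulInvariantVectorField Z Y).trans (lieBracket_chartMul (G := G) Z Y)
  exact (congrArg (fun B : (Fin m → ℂ) →L[ℂ] (Fin m → ℂ) => B Z) h4).trans (h3.trans h5.symm)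

theorem contDiff_of_isHomogPoly {k d : ℕ} {p : (Fin k → ℂ) → ℂ} (hp : IsHomogPoly d p) :
    ContDiff ℂ ω p := by
  have he : p = fun x => inCoord p
      (LinearMap.toContinuousLinearMap (finCoord (Fin k → ℂ)).toLinearMap x) :=
    funext fun x => congrArg p ((finCoord (Fin k → ℂ)).symm_apply_apply x).symm
  have hs : ContDiff ℂ ω (inCoord p) := mem_smoothFun_of_isHomogPoly hp
  rw [he]
  exact hs.comp (LinearMap.toContinuousLinearMap (finCoord (Fin k → ℂ)).toLinearMap).contDiff

/-- The function `w ↦ p (Ad w v)` is constant; by `fderiv_Ad` its derivative at the identity in the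
direction `X` is the derivative of `p` along `⁅X, v⁆`. -/
theorem lineDeriv_lie_eq_zero {d : ℕ} {p : LieAlg m G → ℂ} (hp : IsHomogPoly d p)
    (hinv : ∀ (g : G) (Y : LieAlg m G), p (Ad g Y) = p Y) (X v : LieAlg m G) :
    lineDeriv ℂ p v ⁅X, v⁆ = 0 := by
  let p' : (Fin m → ℂ) → ℂ := p
  have hp' : Differentiable ℂ p' := (contDiff_of_isHomogPoly hp).differentiable (by simp)
  let A : (Fin m → ℂ) → Fin m → ℂ :=
    fun w => Ad ((extChartAt 𝓘(ℂ, Fin m → ℂ) (1 : G)).symm w) v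
  have hA : DifferentiableAt ℂ A (chartOne m G) := differentiableAt_Ad_chart v
  have hA1 : A (chartOne m G) = v := by
    simp only [A, chartOne, extChartAt_to_inv, Ad_one]
    rfl
  have hc : (fun w => p' (A w)) = fun _ => p v := funext fun w => hinv _ v
  have h := (hp' (A (chartOne m G))).hasFDerivAt.comp (chartOne m G) hA.hasFDerivAt
  have h2 := congrArg (fun B : (Fin m → ℂ) →L[ℂ] ℂ => B X) h.fderiv
  have h3 : fderiv ℂ (p' ∘ A) (chartOne m G) = 0 := by
    rw [show p' ∘ A = fun _ => p v from hc, fderiv_const_apply]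
  rw [h3] at h2
  have h4 : fderiv ℂ p' v (⁅X, v⁆ : LieAlg m G) = 0 := by
    rw [hA1] at h2
    have h5 := fderiv_Ad v X
    rw [← h5]
    exact h2.symm
  rw [← h4]
  exact (hp' v).lineDeriv_eq_fderiv

theorem polar_comp_equivariant {W W' : Type*} [AddCommGroup W] [Module ℂ W] [AddCommGroup W']
    [Module ℂ W'] {p : W → ℂ} {p' : W' → ℂ} (A : W' →ₗ[ℂ] W) (hA : ∀ x, p (A x) = p' x) (k : ℕ)
    (X : Fin k → W') (v : W') : polar p k (fun a => A (X a)) (A v) = polar p' k X v := by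
  induction k generalizing v with
  | zero => exact hA v
  | succ k ih =>
    simp only [polar, lineDeriv]
    congr 1
    funext t
    rw [← ih]
    simp only [map_add, map_smul]
    rfl

end LieGroup

/-! ## Pullback of forms along a holomorphic map -/

section Pullback

variable {n : ℕ}

theorem covector_eq_sum (l : Covector n) : l = ∑ k, evalHol (Pi.single k 1) l • dz k +
    ∑ k, antiPart l (Pi.single k 1) • dzbar k := by
  refine LinearMap.ext fun x => ?_
  have h : ∀ c : ℂ, ∀ k, l (c • Pi.single k (1 : ℂ)) = c.re * l (Pi.single k 1) +
      c.im * l (Complex.I • Pi.single k 1) := by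
    intro c k
    have h' : c • (Pi.single k 1 : Fin n → ℂ) = c.re • (Pi.single k 1 : Fin n → ℂ) +
        c.im • (Complex.I • (Pi.single k 1 : Fin n → ℂ)) := by
      ext i
      simp only [Pi.smul_apply, smul_eq_mul, Pi.add_apply, Complex.real_smul]
      conv_lhs => rw [← Complex.re_add_im c]
      ring
    rw [h', map_add, map_smul, map_smul, Complex.real_smul, Complex.real_smul]
  have hx : l x = ∑ k, l (x k • Pi.single k (1 : ℂ)) := by
    rw [← map_sum, ← pi_eq_sum_univ' x]
  rw [hx, Finset.sum_congr rfl fun k _ => h (x k) k]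
  simp only [LinearMap.add_apply, LinearMap.sum_apply, LinearMap.smul_apply, smul_eq_mul,
    ← Finset.sum_add_distrib]
  refine Finset.sum_congr rfl fun k _ => ?_
  have h1 : dz k x = x k := rfl
  have h2 : dzbar k x = (starRingEnd ℂ) (x k) := rfl
  have h3 : (starRingEnd ℂ) (x k) = (x k).re - (x k).im * Complex.I := by
    apply Complex.ext <;> simp
  rw [h1, h2, h3]
  conv_rhs => rw [← Complex.re_add_im (x k)]
  simp only [evalHol, antiPart, LinearMap.coe_mk, AddHom.coe_mk, Complex.add_re, Complex.add_im,
    Complex.ofReal_re, Complex.ofReal_im, Complex.mul_re, Complex.mul_im, Complex.I_re,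
    Complex.I_im]
  simp only [mul_zero, sub_zero, add_zero, mul_one, zero_add]
  linear_combination (((x k).im : ℂ) * l (Complex.I • Pi.single k 1)) * Complex.I_mul_I

theorem pullForms_dz (A : (Fin n → ℂ) →L[ℂ] (Fin n → ℂ)) (j : Fin n) :
    pullForms A (ExteriorAlgebra.ι ℂ (dz j)) = ∑ k, A (Pi.single k 1) j •
      ExteriorAlgebra.ι ℂ (dz k) := by
  have h : pullCovector A (dz j) = ∑ k, A (Pi.single k 1) j • dz k := by
    refine LinearMap.ext fun x => ?_
    have := congrFun (sum_smul_map_single A.toLinearMap x) j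
    simp only [ContinuousLinearMap.coe_coe, Finset.sum_apply, Pi.smul_apply, smul_eq_mul] at this
    simp [pullCovector, dz, ← this, mul_comm]
  rw [pullForms_ι, h]
  simp

theorem conjDerivV_smul_const {M : Type*} [AddCommGroup M] [Module ℂ M] [Module.Finite ℂ M]
    {g : (Fin n → ℂ) → ℂ} {z : Fin n → ℂ} (hg : DifferentiableAt ℝ g z) (c : M) (v : Fin n → ℂ) :
    conjDerivV (fun w => g w • c) z v = conjDeriv g z v • c :=
  conjDerivV_eq fun l => by
    have := conjDeriv_sum_mul (Finset.univ : Finset Unit) (f := fun _ => g) (g := fun _ _ => l c)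
      (z := z) (fun _ _ => hg) (fun _ _ => differentiableAt_const _) v
    simpa [conjDeriv_const] using this

theorem HolomorphicAt.smul_const {M : Type*} [AddCommGroup M] [Module ℂ M]
    {g : (Fin n → ℂ) → ℂ} {z : Fin n → ℂ} (hg : AnalyticAt ℂ g z) (c : M) :
    HolomorphicAt (fun w => g w • c) z := fun l => by
  exact (hg.mul (analyticAt_const (v := l c))).congr (Filter.Eventually.of_forall fun w => by simp)

theorem holomorphicAt_sum {ι M : Type*} [AddCommGroup M] [Module ℂ M] (s : Finset ι)
    {f : ι → (Fin n → ℂ) → M} {z : Fin n → ℂ} (hf : ∀ i ∈ s, HolomorphicAt (f i) z) :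
    HolomorphicAt (fun w => ∑ i ∈ s, f i w) z := fun l => by
  simpa using Finset.analyticAt_fun_sum s fun i hi => hf i hi l

theorem analyticAt_fderiv_coord {τ : (Fin n → ℂ) → Fin n → ℂ} {z : Fin n → ℂ}
    (hτ : ContDiffAt ℂ ω τ z) (v : Fin n → ℂ) (k : Fin n) :
    AnalyticAt ℂ (fun w => fderiv ℂ τ w v k) z := by
  have h : ContDiffAt ℂ ω (fderiv ℂ τ) z := hτ.fderiv_right (m := ω) le_rfl
  exact (contDiffAt_pi.1 (h.clm_apply contDiffAt_const) k).analyticAt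

theorem localDbar_of_holomorphicAt {M : Type*} [AddCommGroup M] [Module ℂ M] [Module.Finite ℂ M]
    [Module (Forms n) M] {f : (Fin n → ℂ) → M} {z : Fin n → ℂ} (hf : HolomorphicAt f z) :
    localDbar f z = 0 := by
  rw [localDbar_eq]
  simp [conjDerivV_of_holomorphicAt hf]

theorem conjDeriv_conj {g : (Fin n → ℂ) → ℂ} {z : Fin n → ℂ} (hg : DifferentiableAt ℂ g z)
    (v : Fin n → ℂ) :
    conjDeriv (fun w => (starRingEnd ℂ) (g w)) z v = (starRingEnd ℂ) (fderiv ℂ g z v) := by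
  have h : HasFDerivAt (fun w => (starRingEnd ℂ) (g w)) (((Complex.conjCLE : ℂ →L[ℝ] ℂ)).comp
      ((fderiv ℂ g z).restrictScalars ℝ)) z :=
    (Complex.conjCLE : ℂ →L[ℝ] ℂ).hasFDerivAt.comp z (hg.hasFDerivAt.restrictScalars ℝ)
  rw [conjDeriv, h.fderiv]
  simp only [ContinuousLinearMap.comp_apply, ContinuousLinearMap.coe_restrictScalars', map_smul,
    smul_eq_mul, ContinuousLinearEquiv.coe_coe, Complex.conjCLE_apply, map_mul, Complex.conj_I]
  linear_combination (-(1 / 2 : ℂ) * (starRingEnd ℂ) (fderiv ℂ g z v)) * Complex.I_mul_I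

/-- The pullback of `dz̄_k` is `∂̄` of the conjugate of `τ_k`. It is therefore closed because `∂̄² =
0`. -/
theorem pullForms_fderiv_dzbar {τ : (Fin n → ℂ) → Fin n → ℂ} {z : Fin n → ℂ}
    (hτ : ContDiffAt ℂ ω τ z) (k : Fin n) :
    (fun w => pullForms (fderiv ℂ τ w) (ExteriorAlgebra.ι ℂ (dzbar k))) =ᶠ[nhds z]
      localDbar fun w => (starRingEnd ℂ) (τ w k) • (1 : Forms n) := by
  filter_upwards [hτ.eventually (by simp)] with w hw
  have hd : DifferentiableAt ℂ (fun u => τ u k) w :=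
    (contDiffAt_pi.1 hw k).differentiableAt (by simp)
  have hd' : DifferentiableAt ℝ (fun u => (starRingEnd ℂ) (τ u k)) w :=
    (Complex.conjCLE : ℂ →L[ℝ] ℂ).differentiableAt.comp w (hd.restrictScalars ℝ)
  rw [pullForms_dzbar, localDbar_eq]
  refine Finset.sum_congr rfl fun i _ => ?_
  have h : fderiv ℂ (fun u => τ u k) w = (ContinuousLinearMap.proj k).comp (fderiv ℂ τ w) :=
    ((ContinuousLinearMap.proj (R := ℂ) (φ := fun _ : Fin n => ℂ) k).hasFDerivAt.comp w
      (hw.differentiableAt (by simp)).hasFDerivAt).fderiv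
  rw [conjDerivV_smul_const hd', conjDeriv_conj hd, h, smul_eq_mul, mul_smul_comm, mul_one]
  rfl

theorem smoothAt_conj_smul_one {τ : (Fin n → ℂ) → Fin n → ℂ} {z : Fin n → ℂ}
    (hτ : ContDiffAt ℂ ω τ z) (k : Fin n) :
    SmoothAt (fun w => (starRingEnd ℂ) (τ w k) • (1 : Forms n)) z := fun l => by
  have h : ContDiffAt ℝ ∞ (fun u => (starRingEnd ℂ) (τ u k)) z :=
    (Complex.conjCLE : ℂ →L[ℝ] ℂ).contDiff.contDiffAt.comp z
      (((contDiffAt_pi.1 hτ k).of_le le_top).restrict_scalars ℝ)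
  simpa using h.mul contDiffAt_const

/-- Split the covector by type: the pullback of `dz_k` has holomorphic coefficients, and that of
`dz̄_k` is `∂̄`-exact. -/
theorem pullForms_fderiv_ι {τ : (Fin n → ℂ) → Fin n → ℂ} {z : Fin n → ℂ}
    (hτ : ContDiffAt ℂ ω τ z) (l : Covector n) :
    SmoothAt (fun w => pullForms (fderiv ℂ τ w) (ExteriorAlgebra.ι ℂ l)) z ∧
      localDbar (fun w => pullForms (fderiv ℂ τ w) (ExteriorAlgebra.ι ℂ l)) z = 0 := by
  have h1 : HolomorphicAt (fun w => ∑ k, evalHol (Pi.single k 1) l •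
      pullForms (fderiv ℂ τ w) (ExteriorAlgebra.ι ℂ (dz k))) z := by
    refine holomorphicAt_sum _ fun k _ => HolomorphicAt.map (N := Forms n) ?_
      (LinearMap.lsmul ℂ (Forms n) (evalHol (Pi.single k 1) l))
    simp only [pullForms_dz]
    exact holomorphicAt_sum _ fun i _ => HolomorphicAt.smul_const (analyticAt_fderiv_coord hτ _ _) _
  have h2 : ∀ k, SmoothAt (fun w => pullForms (fderiv ℂ τ w) (ExteriorAlgebra.ι ℂ (dzbar k))) z :=
    fun k => (smoothAt_localDbar (smoothAt_conj_smul_one hτ k)).congr (pullForms_fderiv_dzbar hτ k)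
  have h3 : ∀ k, localDbar (fun w => pullForms (fderiv ℂ τ w)
      (ExteriorAlgebra.ι ℂ (dzbar k))) z = 0 := fun k => by
    rw [localDbar_congr (pullForms_fderiv_dzbar hτ k),
      localDbar_localDbar (smoothAt_conj_smul_one hτ k)]
  have h4 : SmoothAt (fun w => ∑ k, antiPart l (Pi.single k 1) •
      pullForms (fderiv ℂ τ w) (ExteriorAlgebra.ι ℂ (dzbar k))) z :=
    smoothAt_sum _ fun k _ => (h2 k).map (LinearMap.lsmul ℂ (Forms n) (antiPart l (Pi.single k 1)))
  have h5 : (fun w => pullForms (fderiv ℂ τ w) (ExteriorAlgebra.ι ℂ l)) = fun w =>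
      (∑ k, evalHol (Pi.single k 1) l • pullForms (fderiv ℂ τ w) (ExteriorAlgebra.ι ℂ (dz k))) +
      ∑ k, antiPart l (Pi.single k 1) •
        pullForms (fderiv ℂ τ w) (ExteriorAlgebra.ι ℂ (dzbar k)) := by
    funext w
    conv_lhs => rw [covector_eq_sum l]
    simp only [map_add, map_sum, map_smul]
  have h6 : ∀ s : Finset (Fin n), localDbar (fun w => ∑ k ∈ s, antiPart l (Pi.single k 1) •
        pullForms (fderiv ℂ τ w) (ExteriorAlgebra.ι ℂ (dzbar k))) z = 0 := by
    intro s
    classical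
    induction s using Finset.induction_on with
    | empty => simpa using localDbar_of_holomorphicAt fun l => analyticAt_const
    | insert a s ha ih =>
      have hs : ∀ k, SmoothAt (fun w => antiPart l (Pi.single k 1) •
          pullForms (fderiv ℂ τ w) (ExteriorAlgebra.ι ℂ (dzbar k))) z := fun k =>
        (h2 k).map (LinearMap.lsmul ℂ (Forms n) (antiPart l (Pi.single k 1)))
      simp only [Finset.sum_insert ha]
      rw [localDbar_add (hs a).weakDiffAt (smoothAt_sum s fun k _ => hs k).weakDiffAt, ih, add_zero,
        localDbar_smul _ (h2 a).weakDiffAt, h3, smul_zero]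
  rw [h5]
  refine ⟨h1.smoothAt.add h4, ?_⟩
  rw [localDbar_add h1.smoothAt.weakDiffAt h4.weakDiffAt, h6, localDbar_of_holomorphicAt h1,
    add_zero]

/-- Closedness passes to products by the Leibniz rule. Both terms vanish, so the sign from moving
`dz̄_j` past the first factor is harmless. -/
theorem pullForms_fderiv {τ : (Fin n → ℂ) → Fin n → ℂ} {z : Fin n → ℂ}
    (hτ : ContDiffAt ℂ ω τ z) (η : Forms n) :
    SmoothAt (fun w => pullForms (fderiv ℂ τ w) η) z ∧
      localDbar (fun w => pullForms (fderiv ℂ τ w) η) z = 0 := by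
  induction η using CliffordAlgebra.left_induction with
  | algebraMap r =>
    have h : HolomorphicAt (fun w => pullForms (fderiv ℂ τ w)
        (algebraMap ℂ (CliffordAlgebra (0 : QuadraticForm ℂ (Covector n))) r)) z := by
      have : (fun w => pullForms (fderiv ℂ τ w)
        (algebraMap ℂ (CliffordAlgebra (0 : QuadraticForm ℂ (Covector n))) r)) =
        fun _ => algebraMap ℂ (Forms n) r := funext fun w => (pullForms (fderiv ℂ τ w)).commutes r
      rw [this]
      exact fun l => analyticAt_const
    exact ⟨h.smoothAt, localDbar_of_holomorphicAt h⟩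
  | add x y hx hy =>
    simp only [map_add]
    refine ⟨hx.1.add hy.1, ?_⟩
    rw [localDbar_add hx.1.weakDiffAt hy.1.weakDiffAt, hx.2, hy.2, add_zero]
  | ι_mul x m hx =>
    have hm := pullForms_fderiv_ι hτ m
    have h : (fun w => pullForms (fderiv ℂ τ w)
        (CliffordAlgebra.ι (0 : QuadraticForm ℂ (Covector n)) m * x)) = fun w =>
        pullForms (fderiv ℂ τ w) (ExteriorAlgebra.ι ℂ m) * pullForms (fderiv ℂ τ w) x :=
      funext fun w => map_mul (pullForms (fderiv ℂ τ w)) _ _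
    rw [h]
    refine ⟨hm.1.map₂ hx.1 (LinearMap.mul ℂ (Forms n)), ?_⟩
    have h1 := hm.2
    have h2 := hx.2
    have key : ∀ v, conjDerivV (fun w => pullForms (fderiv ℂ τ w) (ExteriorAlgebra.ι ℂ m) *
        pullForms (fderiv ℂ τ w) x) z v =
        conjDerivV (fun w => pullForms (fderiv ℂ τ w) (ExteriorAlgebra.ι ℂ m)) z v *
          pullForms (fderiv ℂ τ z) x + pullForms (fderiv ℂ τ z) (ExteriorAlgebra.ι ℂ m) *
          conjDerivV (fun w => pullForms (fderiv ℂ τ w) x) z v :=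
      conjDerivV_map₂ hm.1.weakDiffAt hx.1.weakDiffAt (LinearMap.mul ℂ (Forms n))
    rw [localDbar_eq] at h1 h2 ⊢
    simp only [smul_eq_mul] at h1 h2
    simp only [key, smul_eq_mul, mul_add, Finset.sum_add_distrib, ← mul_assoc]
    rw [← Finset.sum_mul, h1, zero_mul, zero_add, pullForms_ι]
    simp only [ι_mul_ι_comm _ (pullCovector (fderiv ℂ τ z) m), neg_mul, mul_assoc, Finset.sum_neg_distrib]
    rw [← Finset.mul_sum, h2, mul_zero, neg_zero]

variable {M N : Type*} [AddCommGroup M] [Module ℂ M] [Module.Finite ℂ M] [Module (Forms n) M]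
  [AddCommGroup N] [Module ℂ N] [Module.Finite ℂ N] [Module (Forms n) N]
  [IsScalarTower ℂ (Forms n) N]

/-- The Dolbeault operator is compatible with changes of frame and coordinates. -/
theorem localDbar_changeFrame {T : (Fin n → ℂ) → M →ₗ[ℂ] N} {τ : (Fin n → ℂ) → Fin n → ℂ}
    {g : (Fin n → ℂ) → M} {z : Fin n → ℂ} (hT : ∀ x, SmoothAt (fun w => T w x) z)
    (hT' : ∀ x, localDbar (fun w => T w x) z = 0) (hτ : DifferentiableAt ℂ τ z)
    (hmul : ∀ (η : Forms n) x, T z (η • x) = pullForms (fderiv ℂ τ z) η • T z x)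
    (hg : WeakDiffAt g (τ z)) :
    localDbar (fun w => T w (g (τ w))) z = T z (localDbar g (τ z)) := by
  have hgτ : WeakDiffAt (fun w => g (τ w)) z := fun l =>
    DifferentiableAt.comp (g := fun w => l (g w)) z (hg l) (hτ.restrictScalars ℝ)
  rw [localDbar_eq, localDbar_eq, map_sum]
  have h := hT' (g (τ z))
  rw [localDbar_eq] at h
  -- The terms differentiating the frame sum to zero by `h`; the others differentiate `g` along the
  -- columns of the Jacobian of `τ`.
  simp only [conjDerivV_family (fun x => (hT x).weakDiffAt) hgτ, conjDerivV_comp hτ hg, smul_add,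
    Finset.sum_add_distrib, h, zero_add, hmul]
  exact sum_dzbar_smul_conjDerivV (fderiv ℂ τ z) g (τ z) (T z)

end Pullback

/-! ## Changes of frame on a manifold -/

section ChangeOfFrame

variable {n m : ℕ} {X : Type u} [TopologicalSpace X] [ChartedSpace (Fin n → ℂ) X]
  {G : Type v} [TopologicalSpace G] [ChartedSpace (Fin m → ℂ) G] [Group G]

/-- The change of coordinates from the preferred chart at `x` to that at `y`. -/
def transitionMap (x y : X) (z : Fin n → ℂ) : Fin n → ℂ :=
  chartAt (Fin n → ℂ) y ((chartAt (Fin n → ℂ) x).symm z)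

theorem HolPrincipalBundle.eventually_frame
    (P : HolPrincipalBundle.{u, v, w} n m X G) {x y : X} (hx : y ∈ (chartAt (Fin n → ℂ) x).source)
    (hy : y ∈ P.baseSet (P.indexAt x)) : ∀ᶠ z in nhds (chartAt (Fin n → ℂ) x y),
      z ∈ (chartAt (Fin n → ℂ) x).target ∧
      (chartAt (Fin n → ℂ) x).symm z ∈ (chartAt (Fin n → ℂ) y).source ∧
      (chartAt (Fin n → ℂ) x).symm z ∈ P.baseSet (P.indexAt x) ∧
      (chartAt (Fin n → ℂ) x).symm z ∈ P.baseSet (P.indexAt y) := by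
  have h1 := (chartAt (Fin n → ℂ) x).map_source hx
  have hc : Filter.Tendsto (chartAt (Fin n → ℂ) x).symm (nhds (chartAt (Fin n → ℂ) x y))
      (nhds y) := by
    have := (chartAt (Fin n → ℂ) x).continuousAt_symm h1
    rwa [ContinuousAt, (chartAt (Fin n → ℂ) x).left_inv hx] at this
  filter_upwards [(chartAt (Fin n → ℂ) x).open_target.mem_nhds h1,
    hc ((chartAt (Fin n → ℂ) y).open_source.mem_nhds (mem_chart_source _ y)),
    hc ((P.isOpen_baseSet _).mem_nhds hy),
    hc ((P.isOpen_baseSet _).mem_nhds (P.mem_baseSet_at y))] with z h1 h2 h3 h4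
  exact ⟨h1, h2, h3, h4⟩

variable [IsManifold 𝓘(ℂ, Fin n → ℂ) ω X]

theorem tangentCoordChange_eq_fderiv (x y p : X) :
    tangentCoordChange 𝓘(ℂ, Fin n → ℂ) x y p =
      fderiv ℂ (transitionMap x y) (chartAt (Fin n → ℂ) x p) := by
  rw [tangentCoordChange_def]
  simp only [modelWithCornersSelf_coe, Set.range_id, fderivWithin_univ]
  rfl

theorem contDiffAt_transitionMap {x y p : X} (hx : p ∈ (chartAt (Fin n → ℂ) x).source)
    (hy : p ∈ (chartAt (Fin n → ℂ) y).source) :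
    ContDiffAt ℂ ω (transitionMap x y) (chartAt (Fin n → ℂ) x p) := by
  rw [← contMDiffAt_iff_contDiffAt]
  have h1 : ContMDiffAt 𝓘(ℂ, Fin n → ℂ) 𝓘(ℂ, Fin n → ℂ) ω (chartAt (Fin n → ℂ) x).symm
      (chartAt (Fin n → ℂ) x p) :=
    (contMDiffOn_chart_symm (x := x)).contMDiffAt
      ((chartAt (Fin n → ℂ) x).open_target.mem_nhds ((chartAt (Fin n → ℂ) x).map_source hx))
  have h2 : ContMDiffAt 𝓘(ℂ, Fin n → ℂ) 𝓘(ℂ, Fin n → ℂ) ω (chartAt (Fin n → ℂ) y) p :=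
    (contMDiffOn_chart (x := y)).contMDiffAt ((chartAt (Fin n → ℂ) y).open_source.mem_nhds hy)
  rw [← (chartAt (Fin n → ℂ) x).left_inv hx] at h2
  exact h2.comp _ h1

theorem chartJac_self (x : X) : chartJac x x = ContinuousLinearMap.id ℂ (Fin n → ℂ) := by
  ext v : 1
  exact tangentCoordChange_self (mem_extChartAt_source x)

theorem chartJac_eq_comp {x y p : X} (hx : p ∈ (chartAt (Fin n → ℂ) x).source)
    (hy : p ∈ (chartAt (Fin n → ℂ) y).source) :
    chartJac x p = (chartJac y p).comp (fderiv ℂ (transitionMap x y)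
      (chartAt (Fin n → ℂ) x p)) := by
  ext v : 1
  rw [← tangentCoordChange_eq_fderiv]
  refine (tangentCoordChange_comp ?_).symm
  simp only [extChartAt_source]
  exact ⟨⟨hx, hy⟩, mem_chart_source _ p⟩

namespace HolPrincipalBundle

variable (P : HolPrincipalBundle.{u, v, w} n m X G)

theorem localRep_center (s : X → Forms n ⊗[ℂ] LieAlg m G) (x : X) :
    P.localRep s x (chartAt (Fin n → ℂ) x x) = s x := by
  have h := (chartAt (Fin n → ℂ) x).left_inv (mem_chart_source _ x)
  simp only [localRep, h, chartJac_self, pullForms_id, P.trans_self _ x (P.mem_baseSet_at x),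
    Ad_one]
  exact DFunLike.congr_fun (TensorProduct.map_id (R := ℂ)) (s x)

theorem contMDiffAt_trans {x y : X} (hx : y ∈ (chartAt (Fin n → ℂ) x).source)
    (hy : y ∈ P.baseSet (P.indexAt x)) : ContMDiffAt 𝓘(ℂ, Fin n → ℂ) 𝓘(ℂ, Fin m → ℂ) ω
      (fun z => P.trans (P.indexAt x) (P.indexAt y) ((chartAt (Fin n → ℂ) x).symm z))
      (chartAt (Fin n → ℂ) x y) := by
  have h1 : ContMDiffAt 𝓘(ℂ, Fin n → ℂ) 𝓘(ℂ, Fin n → ℂ) ω (chartAt (Fin n → ℂ) x).symm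
      (chartAt (Fin n → ℂ) x y) :=
    (contMDiffOn_chart_symm (x := x)).contMDiffAt
      ((chartAt (Fin n → ℂ) x).open_target.mem_nhds ((chartAt (Fin n → ℂ) x).map_source hx))
  have h2 : ContMDiffAt 𝓘(ℂ, Fin n → ℂ) 𝓘(ℂ, Fin m → ℂ) ω
      (P.trans (P.indexAt x) (P.indexAt y)) y :=
    (P.holomorphic_trans _ _).contMDiffAt (((P.isOpen_baseSet _).inter
      (P.isOpen_baseSet _)).mem_nhds ⟨hy, P.mem_baseSet_at y⟩)
  rw [← (chartAt (Fin n → ℂ) x).left_inv hx] at h2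
  have h3 := h2.comp _ h1
  rwa [(chartAt (Fin n → ℂ) x).left_inv hx] at h3

variable [LieGroup 𝓘(ℂ, Fin m → ℂ) ω G]

/-- The cocycle rules for chart Jacobians and for transition functions, applied through the frames
at `x`, at `y` and at the point itself. -/
theorem localRep_changeFrame (s : X → Forms n ⊗[ℂ] LieAlg m G) {x y : X} {z : Fin n → ℂ}
    (hz : z ∈ (chartAt (Fin n → ℂ) x).target)
    (h1 : (chartAt (Fin n → ℂ) x).symm z ∈ (chartAt (Fin n → ℂ) y).source)
    (h2 : (chartAt (Fin n → ℂ) x).symm z ∈ P.baseSet (P.indexAt x))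
    (h3 : (chartAt (Fin n → ℂ) x).symm z ∈ P.baseSet (P.indexAt y)) :
    P.localRep s x z = TensorProduct.map (pullForms (fderiv ℂ (transitionMap x y) z)).toLinearMap
      (Ad (P.trans (P.indexAt x) (P.indexAt y) ((chartAt (Fin n → ℂ) x).symm z)))
      (P.localRep s y (transitionMap x y z)) := by
  have hs := (chartAt (Fin n → ℂ) x).map_target hz
  have hr := (chartAt (Fin n → ℂ) x).right_inv hz
  set p := (chartAt (Fin n → ℂ) x).symm z with hp
  have h4 : (chartAt (Fin n → ℂ) y).symm (transitionMap x y z) = p :=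
    (chartAt (Fin n → ℂ) y).left_inv h1
  simp only [localRep, h4, ← hp]
  rw [← LinearMap.comp_apply, ← TensorProduct.map_comp, chartJac_eq_comp hs h1, hr,
    ← P.trans_comp _ _ _ p ⟨⟨h2, h3⟩, P.mem_baseSet_at p⟩]
  congr 2
  · exact LinearMap.ext fun a => pullForms_comp _ _ a
  · exact LinearMap.ext fun a => Ad_mul _ _ a

theorem smoothAt_frameChange {τ : (Fin n → ℂ) → Fin n → ℂ} {γ : (Fin n → ℂ) → G} {z : Fin n → ℂ}
    (hτ : ContDiffAt ℂ ω τ z) (hγ : ContMDiffAt 𝓘(ℂ, Fin n → ℂ) 𝓘(ℂ, Fin m → ℂ) ω γ z)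
    (u : Forms n ⊗[ℂ] LieAlg m G) :
    SmoothAt (fun w => TensorProduct.map (pullForms (fderiv ℂ τ w)).toLinearMap (Ad (γ w)) u) z ∧
    localDbar (fun w => TensorProduct.map (pullForms (fderiv ℂ τ w)).toLinearMap (Ad (γ w)) u) z
      = 0 := by
  induction u with
  | zero =>
    simp only [map_zero]
    exact ⟨smoothAt_const _ _, localDbar_of_holomorphicAt fun l => analyticAt_const⟩
  | add u w hu hw =>
    simp only [map_add]
    exact ⟨hu.1.add hw.1, by
      rw [localDbar_add hu.1.weakDiffAt hw.1.weakDiffAt, hu.2, hw.2, add_zero]⟩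
  | tmul a Y =>
    have ha := pullForms_fderiv hτ a
    have hY := holomorphicAt_Ad hγ Y
    have key : ∀ v, conjDerivV (fun w => TensorProduct.map (pullForms (fderiv ℂ τ w)).toLinearMap
        (Ad (γ w)) (a ⊗ₜ[ℂ] Y)) z v =
        conjDerivV (fun w => pullForms (fderiv ℂ τ w) a) z v ⊗ₜ[ℂ] Ad (γ z) Y := fun v => by
      have := conjDerivV_map₂ ha.1.weakDiffAt hY.smoothAt.weakDiffAt
        (TensorProduct.mk ℂ (Forms n) (LieAlg m G)) v
      rw [conjDerivV_of_holomorphicAt hY, map_zero, add_zero] at this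
      exact this
    refine ⟨ha.1.map₂ hY.smoothAt (TensorProduct.mk ℂ (Forms n) (LieAlg m G)), ?_⟩
    have h := ha.2
    rw [localDbar_eq] at h ⊢
    simp only [key, TensorProduct.smul_tmul']
    rw [← TensorProduct.sum_tmul, h, TensorProduct.zero_tmul]

/-- `dbar` is defined at each point in its own frame. In one fixed frame it is still the coordinate
operator, which is what makes `dbar s` smooth and `dbar` square to zero. -/
theorem localRep_dbar (s : X → Forms n ⊗[ℂ] LieAlg m G) {x y : X}
    (hs : WeakDiffAt (P.localRep s y) (chartAt (Fin n → ℂ) y y))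
    (hx : y ∈ (chartAt (Fin n → ℂ) x).source) (hy : y ∈ P.baseSet (P.indexAt x)) :
    P.localRep (P.dbar s) x (chartAt (Fin n → ℂ) x y) =
      localDbar (P.localRep s x) (chartAt (Fin n → ℂ) x y) := by
  have hτ := contDiffAt_transitionMap hx (mem_chart_source (Fin n → ℂ) y)
  have hl := (chartAt (Fin n → ℂ) x).left_inv hx
  have hτy : transitionMap x y (chartAt (Fin n → ℂ) x y) = chartAt (Fin n → ℂ) y y := by
    rw [transitionMap, hl]
  have hT := smoothAt_frameChange hτ (P.contMDiffAt_trans hx hy)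
  have hev : P.localRep s x =ᶠ[nhds (chartAt (Fin n → ℂ) x y)] fun z =>
      TensorProduct.map (pullForms (fderiv ℂ (transitionMap x y) z)).toLinearMap
      (Ad (P.trans (P.indexAt x) (P.indexAt y) ((chartAt (Fin n → ℂ) x).symm z)))
      (P.localRep s y (transitionMap x y z)) :=
    (P.eventually_frame hx hy).mono fun z hz =>
      P.localRep_changeFrame s hz.1 hz.2.1 hz.2.2.1 hz.2.2.2
  rw [localDbar_congr hev, localDbar_changeFrame (fun u => (hT u).1) (fun u => (hT u).2)
    (hτ.differentiableAt (by simp)) (fun η u => map_pullForms_smul _ _ η u) (by rwa [hτy]), hτy,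
    ← tangentCoordChange_eq_fderiv, hl]
  simp only [localRep, hl]
  rfl

theorem localRep_dbar_eventuallyEq {s : X → Forms n ⊗[ℂ] LieAlg m G}
    (hs : ∀ y, SmoothAt (P.localRep s y) (chartAt (Fin n → ℂ) y y)) (x : X) :
    P.localRep (P.dbar s) x =ᶠ[nhds (chartAt (Fin n → ℂ) x x)] localDbar (P.localRep s x) := by
  filter_upwards [P.eventually_frame (mem_chart_source (Fin n → ℂ) x) (P.mem_baseSet_at x)]
    with z hz
  have h := P.localRep_dbar s (hs _).weakDiffAt ((chartAt (Fin n → ℂ) x).map_target hz.1) hz.2.2.1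
  rwa [(chartAt (Fin n → ℂ) x).right_inv hz.1] at h

end HolPrincipalBundle

end ChangeOfFrame

/-! ## The dgla of a Higgs pair -/

theorem holomorphicAt_toLieForm {n : ℕ} {L : Type*} [AddCommGroup L] [Module ℂ L] {φ : (Fin n → ℂ) → (Fin n → ℂ) →ₗ[ℂ] L} {z : Fin n → ℂ}
    (h : ∀ e, HolomorphicAt (fun w => φ w e) z) : HolomorphicAt (fun w => toLieForm (φ w)) z :=
  holomorphicAt_sum _ fun j _ => (h (Pi.single j 1)).map
    (TensorProduct.mk ℂ (Forms n) L (ExteriorAlgebra.ι ℂ (dz j)))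

/-! ### The local Dolbeault operator and the bracket of forms. -/

section FormBracketCalculus

variable {n : ℕ} {L : Type*} [LieRing L] [LieAlgebra ℂ L] [Module.Finite ℂ L]

theorem localDbar_mem {f : (Fin n → ℂ) → Forms n ⊗[ℂ] L} {z : Fin n → ℂ} (hf : WeakDiffAt f z)
    {i : ℤ} (h : ∀ w, f w ∈ tensorIn L (formsDegree n i)) :
    localDbar f z ∈ tensorIn L (formsDegree n (i + 1)) := by
  rw [localDbar_eq, add_comm]
  exact sum_mem fun j _ => smul_mem_tensorIn (ι_mem_formsDegree _)
    (conjDerivV_mem hf (Filter.Eventually.of_forall h) _)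

theorem localDbar_formBracket {f g : (Fin n → ℂ) → Forms n ⊗[ℂ] L} {z : Fin n → ℂ}
    (hf : WeakDiffAt f z) (hg : WeakDiffAt g z) {i : ℤ}
    (hi : f z ∈ tensorIn L (formsDegree n i)) :
    localDbar (fun w => formBracket n L (f w) (g w)) z =
      formBracket n L (localDbar f z) (g z) +
        i.negOnePow • formBracket n L (f z) (localDbar g z) := by
  simp only [localDbar_eq, conjDerivV_map₂ hf hg, smul_add, Finset.sum_add_distrib, map_sum,
    LinearMap.sum_apply, formBracket_smul_left, Finset.smul_sum]
  congr 1
  refine Finset.sum_congr rfl fun j _ => ?_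
  -- Moving `dz̄_j` past `f` produces the Leibniz sign a second time, so the two cancel.
  rw [formBracket_smul_right (ι_mem_formsDegree _) hi, smul_smul, units_mul_self_eq_one, one_smul]

end FormBracketCalculus

section Higgs

variable {n m : ℕ} {X : Type u} [TopologicalSpace X] [ChartedSpace (Fin n → ℂ) X]
  [IsManifold 𝓘(ℂ, Fin n → ℂ) ω X]
  {G : Type v} [TopologicalSpace G] [ChartedSpace (Fin m → ℂ) G] [Group G]
  (P : HolPrincipalBundle.{u, v, w} n m X G)

namespace HolPrincipalBundle

theorem mem_adForms_iff {i : ℤ} {s : X → Forms n ⊗[ℂ] LieAlg m G} : s ∈ P.adForms i ↔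
    (∀ x, s x ∈ tensorIn (LieAlg m G) (formsDegree n i)) ∧
      ∀ x, SmoothAt (P.localRep s x) (chartAt (Fin n → ℂ) x x) := by
  rw [← lieFormsOfDegree_eq]
  rfl

theorem localRep_mem {i : ℤ} {s : X → Forms n ⊗[ℂ] LieAlg m G}
    (hs : ∀ x, s x ∈ tensorIn (LieAlg m G) (formsDegree n i)) (x : X) (z : Fin n → ℂ) :
    P.localRep s x z ∈ tensorIn (LieAlg m G) (formsDegree n i) :=
  map_mem_tensorIn (fun _ => pullForms_mem_formsDegree _) (hs _)

theorem localRep_add (s t : X → Forms n ⊗[ℂ] LieAlg m G) (x : X) :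
    P.localRep (s + t) x = fun z => P.localRep s x z + P.localRep t x z :=
  funext fun _ => map_add _ _ _

theorem localRep_smul (c : ℂ) (s : X → Forms n ⊗[ℂ] LieAlg m G) (x : X) :
    P.localRep (c • s) x = fun z => c • P.localRep s x z :=
  funext fun _ => LinearMap.map_smul _ _ _

/-- The local representative at `x` of a section of `ad P ⊗ Ω^1`. -/
def localHiggs (θ : X → ((Fin n → ℂ) →ₗ[ℂ] LieAlg m G)) (x : X) (z : Fin n → ℂ) :
    (Fin n → ℂ) →ₗ[ℂ] LieAlg m G :=
  let y := (chartAt (Fin n → ℂ) x).symm z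
  Ad (P.trans (P.indexAt x) (P.indexAt y) y) ∘ₗ θ y ∘ₗ (chartJac x y).toLinearMap

theorem localRep_toLieForm (θ : X → ((Fin n → ℂ) →ₗ[ℂ] LieAlg m G)) (x : X) :
    P.localRep (fun y => toLieForm (θ y)) x = fun z => toLieForm (P.localHiggs θ x z) :=
  funext fun _ => map_toLieForm _ _ _

theorem dbar_add {P : HolPrincipalBundle.{u, v, w} n m X G} {i j : ℤ} {s t : X → Forms n ⊗[ℂ] LieAlg m G} (hs : s ∈ P.adForms i)
    (ht : t ∈ P.adForms j) : P.dbar (s + t) = P.dbar s + P.dbar t := by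
  funext x
  simp only [dbar, localRep_add, Pi.add_apply]
  exact localDbar_add (hs.2 x).weakDiffAt (ht.2 x).weakDiffAt

theorem dbar_smul {P : HolPrincipalBundle.{u, v, w} n m X G} {i : ℤ} (c : ℂ) {s : X → Forms n ⊗[ℂ] LieAlg m G} (hs : s ∈ P.adForms i) :
    P.dbar (c • s) = c • P.dbar s := by
  funext x
  simp only [dbar, localRep_smul, Pi.smul_apply]
  exact localDbar_smul c (hs.2 x).weakDiffAt

theorem holomorphicAt_localRep_toLieForm {P : HolPrincipalBundle.{u, v, w} n m X G} (θ : HiggsField P) (x : X) :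
    HolomorphicAt (P.localRep (fun y => toLieForm (θ.toFun y)) x) (chartAt (Fin n → ℂ) x x) := by
  rw [localRep_toLieForm]
  exact holomorphicAt_toLieForm (θ.holomorphic x)

theorem toLieForm_mem_adForms {P : HolPrincipalBundle.{u, v, w} n m X G} (θ : HiggsField P) :
    (fun x => toLieForm (θ.toFun x)) ∈ P.adForms 1 := by
  rw [mem_adForms_iff]
  exact ⟨fun x => toLieForm_mem _, fun x => (holomorphicAt_localRep_toLieForm θ x).smoothAt⟩

theorem dbar_toLieForm {P : HolPrincipalBundle.{u, v, w} n m X G} (θ : HiggsField P) : P.dbar (fun x => toLieForm (θ.toFun x)) = 0 :=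
  funext fun x => localDbar_of_holomorphicAt (holomorphicAt_localRep_toLieForm θ x)

variable [LieGroup 𝓘(ℂ, Fin m → ℂ) ω G]

theorem localRep_bracket (s t : X → Forms n ⊗[ℂ] LieAlg m G) (x : X) :
    P.localRep (fun y => formBracket n (LieAlg m G) (s y) (t y)) x = fun z =>
      formBracket n (LieAlg m G) (P.localRep s x z) (P.localRep t x z) :=
  funext fun _ => map_formBracket _ (Ad_lie _) _ _

variable {P}

theorem dbar_mem {i : ℤ} {s : X → Forms n ⊗[ℂ] LieAlg m G} (hs : s ∈ P.adForms i) :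
    P.dbar s ∈ P.adForms (i + 1) := by
  rw [mem_adForms_iff] at hs ⊢
  exact ⟨fun x => localDbar_mem (hs.2 x).weakDiffAt (P.localRep_mem hs.1 x),
    fun x => (smoothAt_localDbar (hs.2 x)).congr (P.localRep_dbar_eventuallyEq hs.2 x)⟩

theorem bracket_mem {i j : ℤ} {s t : X → Forms n ⊗[ℂ] LieAlg m G} (hs : s ∈ P.adForms i)
    (ht : t ∈ P.adForms j) :
    (fun x => formBracket n (LieAlg m G) (s x) (t x)) ∈ P.adForms (i + j) := by
  rw [mem_adForms_iff] at hs ht ⊢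
  refine ⟨fun x => formBracket_mem (hs.1 x) (ht.1 x), fun x => ?_⟩
  rw [localRep_bracket]
  exact (hs.2 x).map₂ (ht.2 x) _

theorem dbar_dbar {i : ℤ} {s : X → Forms n ⊗[ℂ] LieAlg m G} (hs : s ∈ P.adForms i) :
    P.dbar (P.dbar s) = 0 := by
  funext x
  rw [dbar, localDbar_congr (P.localRep_dbar_eventuallyEq hs.2 x), localDbar_localDbar (hs.2 x)]
  rfl

theorem dbar_bracket {i j : ℤ} {s t : X → Forms n ⊗[ℂ] LieAlg m G} (hs : s ∈ P.adForms i)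
    (ht : t ∈ P.adForms j) :
    P.dbar (fun x => formBracket n (LieAlg m G) (s x) (t x)) =
      (fun x => formBracket n (LieAlg m G) (P.dbar s x) (t x)) +
        i.negOnePow • fun x => formBracket n (LieAlg m G) (s x) (P.dbar t x) := by
  funext x
  have h := (P.mem_adForms_iff.1 hs).1
  simp only [dbar, localRep_bracket]
  rw [localDbar_formBracket (hs.2 x).weakDiffAt (ht.2 x).weakDiffAt (P.localRep_mem h x _),
    localRep_center, localRep_center]
  rfl

end HolPrincipalBundle

variable [LieGroup 𝓘(ℂ, Fin m → ℂ) ω G] {P}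

open HolPrincipalBundle

theorem iSupIndep_of_apply {X V : Type*} [AddCommGroup V] [Module ℂ V] {A : ℤ → Submodule ℂ (X → V)}
    {B : ℤ → Submodule ℂ V} (hB : iSupIndep B) (h : ∀ i, ∀ s ∈ A i, ∀ x, s x ∈ B i) :
    iSupIndep A := by
  rw [iSupIndep_def] at hB ⊢
  intro i
  rw [Submodule.disjoint_def]
  intro s hs hs'
  funext x
  refine (Submodule.disjoint_def.1 (hB i)) _ (h i s hs x) ?_
  have hle : (⨆ j, ⨆ (_ : j ≠ i), A j) ≤
      (⨆ j, ⨆ (_ : j ≠ i), B j).comap (LinearMap.proj (R := ℂ) (φ := fun _ : X => V) x) :=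
    iSup₂_le fun j hj t ht => (le_iSup₂ (f := fun j (_ : j ≠ i) => B j) j hj) (h j t ht x)
  exact hle hs'

theorem higgsDGLA_d (θ : HiggsField P) (s : X → Forms n ⊗[ℂ] LieAlg m G) :
    (higgsDGLA P θ).d s =
      P.dbar s + fun x => formBracket n (LieAlg m G) (toLieForm (θ.toFun x)) (s x) := rfl

theorem higgsDGLA_br (θ : HiggsField P) (s t : X → Forms n ⊗[ℂ] LieAlg m G) :
    (higgsDGLA P θ).br s t = fun x => formBracket n (LieAlg m G) (s x) (t x) := rfl

/-- The square of `∂̄ + ad θ` vanishes since `∂̄² = 0`, `∂̄θ = 0` and `(ad θ)² = 0`. The Leibniz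
rule for `ad θ` is the Jacobi identity with `θ` in degree `1`. -/
theorem higgsDGLA_isDGLA (θ : HiggsField P) : (higgsDGLA P θ).IsDGLA where
  independent := iSupIndep_of_apply (iSupIndep_lieFormsOfDegree (n := n) (L := LieAlg m G))
    fun i s hs x => hs.1 x
  d_mem i s hs := by
    refine add_mem (dbar_mem hs) ?_
    rw [add_comm]
    exact bracket_mem (toLieForm_mem_adForms θ) hs
  d_add i s hs t ht := by
    simp only [higgsDGLA_d, dbar_add hs ht]
    funext x
    simp only [Pi.add_apply, map_add]
    abel
  d_smul i c s hs := by
    simp only [higgsDGLA_d, dbar_smul c hs]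
    funext x
    simp only [Pi.add_apply, Pi.smul_apply, map_smul, smul_add]
  d_d i s hs := by
    have h1 := bracket_mem (toLieForm_mem_adForms θ) hs
    rw [higgsDGLA_d, higgsDGLA_d, dbar_add (dbar_mem hs) h1, dbar_dbar hs,
      dbar_bracket (toLieForm_mem_adForms θ) hs, dbar_toLieForm]
    funext x
    simp only [Pi.add_apply, Pi.zero_apply, Pi.neg_apply, map_zero, LinearMap.zero_apply, map_add,
      toLieForm_bracket_bracket (θ.integrable x), Int.negOnePow_one, Units.neg_smul, one_smul]
    abel
  br_mem i j s hs t ht := bracket_mem hs ht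
  skew i j s hs t ht := funext fun x =>
    formBracket_skew ((P.mem_adForms_iff.1 hs).1 x) ((P.mem_adForms_iff.1 ht).1 x)
  jacobi i j k s hs t ht r hr := funext fun x =>
    formBracket_jacobi ((P.mem_adForms_iff.1 hs).1 x) ((P.mem_adForms_iff.1 ht).1 x)
  leibniz i j s hs t ht := by
    simp only [higgsDGLA_d, higgsDGLA_br, dbar_bracket hs ht]
    funext x
    simp only [Pi.add_apply, Pi.smul_apply, map_add, LinearMap.add_apply, smul_add]
    rw [formBracket_jacobi (toLieForm_mem (θ.toFun x)) ((P.mem_adForms_iff.1 hs).1 x), one_mul]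
    abel

end Higgs

/-! ## Polynomial functions with values in forms -/

section PolyForms

variable {n d : ℕ}

/-- The functionals whose composite with `f` is smooth form a subspace containing all `l ∘ F i`.
Since the `F i` separate points, nothing nonzero is annihilated by it, and in finite dimension it is
the whole dual. -/
theorem smoothAt_of_separating {k : ℕ} {M ι K : Type*} [AddCommGroup M] [Module ℂ M]
    [Module.Finite ℂ M] [AddCommGroup K] [Module ℂ K] (F : ι → M →ₗ[ℂ] K)
    (hF : ∀ x, (∀ i, F i x = 0) → x = 0) {f : (Fin k → ℂ) → M} {z : Fin k → ℂ}
    (hf : ∀ i, SmoothAt (fun w => F i (f w)) z) : SmoothAt f z := by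
  let S : Submodule ℂ (Module.Dual ℂ M) :=
    { carrier := {l | ContDiffAt ℝ ∞ (fun w => l (f w)) z}
      add_mem' := fun {a b} (ha : ContDiffAt ℝ ∞ (fun w => a (f w)) z)
        (hb : ContDiffAt ℝ ∞ (fun w => b (f w)) z) =>
        show ContDiffAt ℝ ∞ (fun w => a (f w) + b (f w)) z from ha.add hb
      zero_mem' := show ContDiffAt ℝ ∞ (fun _ => (0 : ℂ)) z from contDiffAt_const
      smul_mem' := fun c a (ha : ContDiffAt ℝ ∞ (fun w => a (f w)) z) =>
        show ContDiffAt ℝ ∞ (fun w => c * a (f w)) z from contDiffAt_const.mul ha }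
  have hS : S.dualCoannihilator = ⊥ := by
    refine eq_bot_iff.2 fun x hx => hF x fun i => ?_
    rw [Submodule.mem_dualCoannihilator] at hx
    exact (Module.forall_dual_apply_eq_zero_iff ℂ _).1 fun l => hx (l ∘ₗ F i) (hf i l)
  have hS' : S = ⊤ := by
    rw [← Subspace.dualCoannihilator_dualAnnihilator_eq (W := S), hS,
      Submodule.dualAnnihilator_bot]
  intro l
  have : l ∈ S := hS' ▸ Submodule.mem_top
  exact this

variable (n d) in
/-- The functions on `ℂⁿ` with values in `Forms n` that are homogeneous polynomials of degree
`d`. -/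
def polyForms : Submodule (Forms n) ((Fin n → ℂ) → Forms n) :=
  Submodule.span (Forms n) {t | ∃ q, IsHomogPoly d q ∧ t = fun e => algebraMap ℂ (Forms n) (q e)}

/-- The calculus above needs a finite-dimensional target, unlike the space of all functions of `e`.
Homogeneous polynomials of fixed degree provide one, and it is stable under multiplication by forms.
-/
instance polyForms_finite : Module.Finite ℂ (polyForms n d) := by
  let Φ : MultilinearMap ℂ (fun _ : Fin d => Fin n → ℂ) ℂ →ₗ[ℂ] ((Fin n → ℂ) → Forms n) :=
    { toFun := fun F e => algebraMap ℂ (Forms n) (F fun _ => e)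
      map_add' := fun F F' => by ext e; simp
      map_smul' := fun c F => by ext e; simp [Algebra.smul_def] }
  obtain ⟨S, hS⟩ := (Module.Finite.range Φ : Module.Finite ℂ (LinearMap.range Φ)).fg_top |> fun _ =>
    (Module.Finite.iff_fg.1 (Module.Finite.range Φ : Module.Finite ℂ (LinearMap.range Φ)))
  have h : polyForms n d = Submodule.span (Forms n) (S : Set ((Fin n → ℂ) → Forms n)) := by
    rw [← Submodule.span_span_of_tower ℂ (Forms n), hS, polyForms]
    congr 1
    ext t
    constructor
    · rintro ⟨q, ⟨F, hF⟩, rfl⟩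
      exact ⟨F, funext fun e => by simp [Φ, hF]⟩
    · rintro ⟨F, rfl⟩
      exact ⟨fun e => F fun _ => e, ⟨F, fun _ => rfl⟩, rfl⟩
  have : Module.Finite (Forms n) (polyForms n d) := Module.Finite.iff_fg.2 ⟨S, h.symm⟩
  exact Module.Finite.trans (Forms n) _

theorem IsHomogPoly.comp_linear {W W' : Type*} [AddCommGroup W] [Module ℂ W] [AddCommGroup W']
    [Module ℂ W'] {q : W → ℂ} (hq : IsHomogPoly d q) (A : W' →ₗ[ℂ] W) :
    IsHomogPoly d fun x => q (A x) := by
  obtain ⟨F, hF⟩ := hq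
  exact ⟨F.compLinearMap fun _ => A, fun x => by simp [hF]⟩

variable (n d) in
/-- The homogeneous polynomials of degree `d` with values in forms of type `(0, i)`. -/
def symPart (i : ℤ) : Submodule ℂ ((Fin n → ℂ) → Forms n) :=
  Submodule.span ℂ {t | ∃ q : (Fin n → ℂ) → ℂ, IsHomogPoly d q ∧ ∃ α ∈ antiForms n i,
    t = fun e => q e • α}

theorem iSup_symFibre (i : ℤ) :
    ⨆ (r : ℕ) (_ : (r : ℤ) + 1 = i), symFibre n d r = symPart n d (i - 1) := by
  refine le_antisymm (iSup₂_le ?_) ?_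
  · rintro r rfl
    rw [add_sub_cancel_right, symPart, symFibre, formsOfType_zero_right]
  · refine Submodule.span_le.2 ?_
    rintro _ ⟨q, hq, α, hα, rfl⟩
    rcases mem_intPow_iff.1 hα with rfl | ⟨r, hr, -⟩
    · simp only [smul_zero]
      exact zero_mem (⨆ (r : ℕ) (_ : (r : ℤ) + 1 = i), symFibre n d r)
    · refine (le_iSup₂ (f := fun (r : ℕ) (_ : (r : ℤ) + 1 = i) => symFibre n d r) r (by omega)) ?_
      refine Submodule.subset_span ⟨q, hq, α, ?_, rfl⟩
      rwa [formsOfType_zero_right, ← hr]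

theorem symPart_le_polyForms (i : ℤ) :
    symPart n d i ≤ (polyForms n d).restrictScalars ℂ := by
  refine Submodule.span_le.2 ?_
  rintro _ ⟨q, hq, α, -, rfl⟩
  have h : (fun e => q e • α) = α • fun e => algebraMap ℂ (Forms n) (q e) := by
    funext e
    rw [Pi.smul_apply, smul_eq_mul, Algebra.smul_def, Algebra.commutes]
  rw [h]
  exact Submodule.smul_mem (polyForms n d) α (Submodule.subset_span ⟨q, hq, rfl⟩)

theorem symPart_apply_mem {i : ℤ} {t : (Fin n → ℂ) → Forms n} (ht : t ∈ symPart n d i)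
    (e : Fin n → ℂ) : t e ∈ antiForms n i := by
  induction ht using Submodule.span_induction with
  | mem t ht =>
    obtain ⟨q, -, α, hα, rfl⟩ := ht
    exact Submodule.smul_mem _ _ hα
  | zero => exact zero_mem _
  | add t t' _ _ h h' => exact add_mem h h'
  | smul c t _ h => exact Submodule.smul_mem _ c h

theorem pull_mem_symPart (A : (Fin n → ℂ) →L[ℂ] (Fin n → ℂ)) {i : ℤ} {t : (Fin n → ℂ) → Forms n}
    (ht : t ∈ symPart n d i) : (fun e => pullForms A (t (A e))) ∈ symPart n d i := by
  induction ht using Submodule.span_induction with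
  | mem t ht =>
    obtain ⟨q, hq, α, hα, rfl⟩ := ht
    exact Submodule.subset_span ⟨_, hq.comp_linear A.toLinearMap, _,
      pullForms_mem_antiForms A hα, funext fun e => map_smul (pullForms A) _ _⟩
  | zero =>
    simp only [Pi.zero_apply, map_zero]
    exact zero_mem (symPart n d i)
  | add t t' _ _ h h' =>
    simp only [Pi.add_apply, map_add]
    exact add_mem h h'
  | smul c t _ h =>
    simp only [Pi.smul_apply, map_smul]
    exact Submodule.smul_mem _ c h

theorem antiForm_smul_mem_symPart {i j : ℤ} {η : Forms n} (hη : η ∈ antiForms n j)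
    {t : (Fin n → ℂ) → Forms n} (ht : t ∈ symPart n d i) : η • t ∈ symPart n d (i + j) := by
  induction ht using Submodule.span_induction with
  | mem t ht =>
    obtain ⟨q, hq, α, hα, rfl⟩ := ht
    refine Submodule.subset_span ⟨q, hq, η * α, ?_, funext fun e => ?_⟩
    · rw [add_comm]
      exact mul_mem_intPow hη hα
    · simp
  | zero => simp
  | add t t' _ _ h h' =>
    rw [smul_add]
    exact add_mem h h'
  | smul c t _ h =>
    rw [smul_comm η c t]
    exact Submodule.smul_mem _ c h

theorem pull_mem_polyForms (A : (Fin n → ℂ) →L[ℂ] (Fin n → ℂ)) {t : (Fin n → ℂ) → Forms n}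
    (ht : t ∈ polyForms n d) : (fun e => pullForms A (t (A e))) ∈ polyForms n d := by
  induction ht using Submodule.closure_induction with
  | zero =>
    simp only [Pi.zero_apply, map_zero]
    exact zero_mem (polyForms n d)
  | add t t' _ _ h h' =>
    simp only [Pi.add_apply, map_add]
    exact add_mem h h'
  | smul_mem η t ht =>
    obtain ⟨q, hq, rfl⟩ := ht
    have h : (fun e => pullForms A ((η • fun e => algebraMap ℂ (Forms n) (q e)) (A e))) =
        pullForms A η • fun e => algebraMap ℂ (Forms n) (q (A e)) := by
      funext e
      simp
    rw [h]
    exact Submodule.smul_mem _ _ (Submodule.subset_span ⟨_, hq.comp_linear A.toLinearMap, rfl⟩)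

variable (d) in
/-- Pullback of a polynomial with values in forms, evaluated at `e`. -/
def pullEval (A : (Fin n → ℂ) →L[ℂ] (Fin n → ℂ)) (e : Fin n → ℂ) : polyForms n d →ₗ[ℂ] Forms n where
  toFun t := pullForms A (t.1 (A e))
  map_add' _ _ := map_add _ _ _
  map_smul' c _ := map_smul (pullForms A) c _

variable (d) in
/-- Evaluation of a polynomial with values in forms. -/
def evalPoly (e : Fin n → ℂ) : polyForms n d →ₗ[ℂ] Forms n where
  toFun t := t.1 e
  map_add' _ _ := rfl
  map_smul' _ _ := rfl

/-- On a generator the frame change is a holomorphic factor, the polynomial evaluated on the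
Jacobian, times the pullback of a constant form, which is `∂̄`-closed. -/
theorem pullEval_fderiv {τ : (Fin n → ℂ) → Fin n → ℂ} {z : Fin n → ℂ}
    (hτ : ContDiffAt ℂ ω τ z) (e : Fin n → ℂ) (t : polyForms n d) :
    SmoothAt (fun w => pullEval d (fderiv ℂ τ w) e t) z ∧
      localDbar (fun w => pullEval d (fderiv ℂ τ w) e t) z = 0 := by
  obtain ⟨t, ht⟩ := t
  simp only [pullEval, LinearMap.coe_mk, AddHom.coe_mk]
  induction ht using Submodule.closure_induction with
  | zero =>
    simp only [Pi.zero_apply, map_zero]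
    exact ⟨smoothAt_const _ _, localDbar_of_holomorphicAt fun l => analyticAt_const⟩
  | add t t' _ _ h h' =>
    simp only [Pi.add_apply, map_add]
    exact ⟨h.1.add h'.1, by
      rw [localDbar_add h.1.weakDiffAt h'.1.weakDiffAt, h.2, h'.2, add_zero]⟩
  | smul_mem η t ht =>
    obtain ⟨q, hq, rfl⟩ := ht
    have hη := pullForms_fderiv hτ η
    have hqa : AnalyticAt ℂ (fun w => q (fderiv ℂ τ w e)) z := by
      have h1 : ContDiffAt ℂ ω (fun w => fderiv ℂ τ w e) z :=
        (hτ.fderiv_right (m := ω) le_rfl).clm_apply contDiffAt_const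
      exact ((contDiff_of_isHomogPoly hq).contDiffAt.comp z h1).analyticAt
    have hqh : HolomorphicAt (fun w => q (fderiv ℂ τ w e)) z := fun l => by
      have := HolomorphicAt.smul_const (M := ℂ) hqa 1 l
      simpa using this
    have h : (fun w => pullForms (fderiv ℂ τ w)
        ((η • fun e => algebraMap ℂ (Forms n) (q e)) (fderiv ℂ τ w e))) = fun w =>
        q (fderiv ℂ τ w e) • pullForms (fderiv ℂ τ w) η := by
      funext w
      simp [Algebra.smul_def, Algebra.commutes]
    rw [h]
    refine ⟨hqh.smoothAt.map₂ hη.1 (LinearMap.lsmul ℂ (Forms n)), ?_⟩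
    have key : ∀ v, conjDerivV (fun w => q (fderiv ℂ τ w e) • pullForms (fderiv ℂ τ w) η) z v =
        q (fderiv ℂ τ z e) • conjDerivV (fun w => pullForms (fderiv ℂ τ w) η) z v := fun v => by
      have := conjDerivV_map₂ hqh.smoothAt.weakDiffAt hη.1.weakDiffAt
        (LinearMap.lsmul ℂ (Forms n)) v
      rw [conjDerivV_of_holomorphicAt hqh, map_zero, LinearMap.zero_apply, zero_add] at this
      exact this
    have h2 := hη.2
    rw [localDbar_eq] at h2 ⊢
    simp only [key]
    simp only [smul_comm _ (q _), ← Finset.smul_sum]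
    rw [h2, smul_zero]

end PolyForms

/-! ## The dgla of forms with values in the symmetric powers -/

section SymForms

variable {n d : ℕ} {X : Type u} [TopologicalSpace X] [ChartedSpace (Fin n → ℂ) X]

theorem eventually_mem_charts (x : X) : ∀ᶠ z in nhds (chartAt (Fin n → ℂ) x x),
    z ∈ (chartAt (Fin n → ℂ) x).target :=
  (chartAt (Fin n → ℂ) x).open_target.mem_nhds
    ((chartAt (Fin n → ℂ) x).map_source (mem_chart_source _ x))

variable [IsManifold 𝓘(ℂ, Fin n → ℂ) ω X]

/-- The local representative at `x` of a form with values in `S^d Ω^1`. -/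
def symRep {t : X → (Fin n → ℂ) → Forms n} (ht : ∀ y, t y ∈ polyForms n d) (x : X)
    (z : Fin n → ℂ) : polyForms n d :=
  ⟨fun e => symLocalRep t x e z, pull_mem_polyForms _ (ht _)⟩

theorem smoothAt_symRep {t : X → (Fin n → ℂ) → Forms n} (ht : ∀ y, t y ∈ polyForms n d) {x : X}
    {z : Fin n → ℂ} (h : ∀ e, SmoothAt (symLocalRep t x e) z) : SmoothAt (symRep ht x) z :=
  smoothAt_of_separating (evalPoly d) (fun _ h => Subtype.ext (funext h)) h

/-- The differential is defined for each `e` separately. Collecting all `e` into one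
`polyForms`-valued function shows that the result is again polynomial in `e`. -/
theorem localDbar_symLocalRep {t : X → (Fin n → ℂ) → Forms n} (ht : ∀ y, t y ∈ polyForms n d)
    {x : X} {z : Fin n → ℂ} (h : ∀ e, SmoothAt (symLocalRep t x e) z) (e : Fin n → ℂ) :
    localDbar (symLocalRep t x e) z = evalPoly d e (localDbar (symRep ht x) z) := by
  have key : ∀ v, conjDerivV (symLocalRep t x e) z v =
      evalPoly d e (conjDerivV (symRep ht x) z v) :=
    fun v => conjDerivV_map (smoothAt_symRep ht h).weakDiffAt (evalPoly d e) v
  simp only [localDbar_eq, key, map_sum]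
  rfl

theorem symLocalRep_changeFrame {t : X → (Fin n → ℂ) → Forms n} (ht : ∀ y, t y ∈ polyForms n d)
    {x y : X} {z : Fin n → ℂ} (hz : z ∈ (chartAt (Fin n → ℂ) x).target)
    (h1 : (chartAt (Fin n → ℂ) x).symm z ∈ (chartAt (Fin n → ℂ) y).source) (e : Fin n → ℂ) :
    symLocalRep t x e z = pullEval d (fderiv ℂ (transitionMap x y) z) e
      (symRep ht y (transitionMap x y z)) := by
  have hs := (chartAt (Fin n → ℂ) x).map_target hz
  have hr := (chartAt (Fin n → ℂ) x).right_inv hz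
  have h4 : (chartAt (Fin n → ℂ) y).symm (transitionMap x y z) = (chartAt (Fin n → ℂ) x).symm z :=
    (chartAt (Fin n → ℂ) y).left_inv h1
  simp only [symLocalRep, symRep, pullEval, LinearMap.coe_mk, AddHom.coe_mk, h4]
  rw [chartJac_eq_comp hs h1, hr, pullForms_comp]
  rfl

theorem symLocalRep_dbar {t : X → (Fin n → ℂ) → Forms n} (ht : ∀ y, t y ∈ polyForms n d)
    (h : ∀ y e, SmoothAt (symLocalRep t y e) (chartAt (Fin n → ℂ) y y)) {x y : X}
    (hx : y ∈ (chartAt (Fin n → ℂ) x).source) (e : Fin n → ℂ) :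
    symLocalRep ((symDGLA n X d).d t) x e (chartAt (Fin n → ℂ) x y) =
      localDbar (symLocalRep t x e) (chartAt (Fin n → ℂ) x y) := by
  have hτ := contDiffAt_transitionMap hx (mem_chart_source (Fin n → ℂ) y)
  have hl := (chartAt (Fin n → ℂ) x).left_inv hx
  have hτy : transitionMap x y (chartAt (Fin n → ℂ) x y) = chartAt (Fin n → ℂ) y y := by
    rw [transitionMap, hl]
  have hT := pullEval_fderiv (d := d) hτ e
  have h1 := (chartAt (Fin n → ℂ) x).map_source hx
  have hev : symLocalRep t x e =ᶠ[nhds (chartAt (Fin n → ℂ) x y)] fun z =>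
      pullEval d (fderiv ℂ (transitionMap x y) z) e (symRep ht y (transitionMap x y z)) := by
    have hc : Filter.Tendsto (chartAt (Fin n → ℂ) x).symm (nhds (chartAt (Fin n → ℂ) x y))
        (nhds y) := by
      have := (chartAt (Fin n → ℂ) x).continuousAt_symm h1
      rwa [ContinuousAt, hl] at this
    filter_upwards [(chartAt (Fin n → ℂ) x).open_target.mem_nhds h1,
      hc ((chartAt (Fin n → ℂ) y).open_source.mem_nhds (mem_chart_source _ y))] with z hz hz'
    exact symLocalRep_changeFrame ht hz hz' e
  have hd := localDbar_symLocalRep ht (h y)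
  rw [localDbar_congr hev, localDbar_changeFrame (fun u => (hT u).1) (fun u => (hT u).2)
    (hτ.differentiableAt (by simp)) (fun η u => map_mul (pullForms _) η _)
    (by rw [hτy]; exact (smoothAt_symRep ht (h y)).weakDiffAt), hτy,
    ← tangentCoordChange_eq_fderiv]
  simp only [symLocalRep, hl, symDGLA] at hd ⊢
  rw [hd]
  rfl

theorem symLocalRep_dbar_eventuallyEq {t : X → (Fin n → ℂ) → Forms n}
    (ht : ∀ y, t y ∈ polyForms n d)
    (h : ∀ y e, SmoothAt (symLocalRep t y e) (chartAt (Fin n → ℂ) y y)) (x : X) (e : Fin n → ℂ) :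
    symLocalRep ((symDGLA n X d).d t) x e =ᶠ[nhds (chartAt (Fin n → ℂ) x x)]
      localDbar (symLocalRep t x e) := by
  filter_upwards [eventually_mem_charts x] with z hz
  have h := symLocalRep_dbar ht h ((chartAt (Fin n → ℂ) x).map_target hz) e
  rwa [(chartAt (Fin n → ℂ) x).right_inv hz] at h

theorem mem_symForms_iff {i : ℤ} {t : X → (Fin n → ℂ) → Forms n} : t ∈ symForms n X d i ↔
    (∀ x, t x ∈ symPart n d (i - 1)) ∧
      ∀ x e, SmoothAt (symLocalRep t x e) (chartAt (Fin n → ℂ) x x) := by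
  rw [← iSup_symFibre]
  rfl

theorem localDbar_mem_symPart {f : (Fin n → ℂ) → polyForms n d} {z : Fin n → ℂ}
    (hf : WeakDiffAt f z) {i : ℤ} (h : ∀ w, (f w : (Fin n → ℂ) → Forms n) ∈ symPart n d i) :
    (localDbar f z).1 ∈ symPart n d (i + 1) := by
  rw [localDbar_eq, AddSubmonoidClass.coe_finsetSum]
  refine sum_mem fun j _ => antiForm_smul_mem_symPart (ι_mem_antiForms (dzbar_mem j)) ?_
  exact conjDerivV_mem (S := (symPart n d i).comap
    ((polyForms n d).subtype.restrictScalars ℂ)) hf (Filter.Eventually.of_forall h) _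

theorem symDGLA_isDGLA : (symDGLA n X d).IsDGLA where
  independent := by
    refine iSupIndep_of_apply (B := fun i => symPart n d (i - 1)) ?_
      fun i t ht x => (mem_symForms_iff.1 ht).1 x
    refine (iSupIndep_of_apply (iSupIndep_formsDegree n) fun i t ht e =>
      antiForms_le i (symPart_apply_mem ht e)).comp (sub_left_injective (b := (1 : ℤ)))
  d_mem i t ht := by
    refine mem_symForms_iff.2 ?_
    rw [add_sub_cancel_right]
    have ht' := mem_symForms_iff.1 ht
    have hp : ∀ y, t y ∈ polyForms n d := fun y => symPart_le_polyForms _ (ht'.1 y)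
    refine ⟨fun x => ?_, fun x e => ?_⟩
    · have h1 : (symDGLA n X d).d t x =
          (localDbar (symRep hp x) (chartAt (Fin n → ℂ) x x)).1 :=
        funext fun e => localDbar_symLocalRep hp (ht'.2 x) e
      rw [h1]
      have := localDbar_mem_symPart (smoothAt_symRep hp (ht'.2 x)).weakDiffAt
        fun w => pull_mem_symPart _ (ht'.1 _)
      rwa [sub_add_cancel] at this
    · exact (smoothAt_localDbar (ht'.2 x e)).congr (symLocalRep_dbar_eventuallyEq hp ht'.2 x e)
  d_add i t ht s hs := by
    funext x e
    have h : symLocalRep (t + s) x e = fun z => symLocalRep t x e z + symLocalRep s x e z :=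
      funext fun _ => map_add _ _ _
    simp only [symDGLA, Pi.add_apply, h]
    exact localDbar_add (ht.2 x e).weakDiffAt (hs.2 x e).weakDiffAt
  d_smul i c t ht := by
    funext x e
    have h : symLocalRep (c • t) x e = fun z => c • symLocalRep t x e z :=
      funext fun _ => map_smul (pullForms _) _ _
    simp only [symDGLA, Pi.smul_apply, h]
    exact localDbar_smul c (ht.2 x e).weakDiffAt
  d_d i t ht := by
    have ht' := mem_symForms_iff.1 ht
    have hp : ∀ y, t y ∈ polyForms n d := fun y => symPart_le_polyForms _ (ht'.1 y)
    funext x e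
    have h := localDbar_congr (symLocalRep_dbar_eventuallyEq hp ht'.2 x e)
    rw [localDbar_localDbar (ht'.2 x e)] at h
    exact h
  br_mem i j _ _ _ _ := zero_mem _
  skew i j _ _ _ _ := by simp [symDGLA]
  jacobi i j k _ _ _ _ _ _ := by simp [symDGLA]
  leibniz i j _ _ _ _ := by
    -- With zero bracket the Leibniz rule reduces to this, which is not automatic because `d` is
    -- only a function.
    have h : (symDGLA n X d).d 0 = 0 := by
      funext x e
      have h : symLocalRep (0 : X → (Fin n → ℂ) → Forms n) x e = fun z => 0 :=
        funext fun _ => map_zero _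
      simp only [symDGLA, h]
      exact localDbar_of_holomorphicAt fun l => analyticAt_const
    have h' : (symDGLA n X d).br = 0 := rfl
    simp [h', h]

end SymForms

/-! ## Polarisations of homogeneous polynomials -/

section Homogeneous

variable {L : Type*} [AddCommGroup L] [Module ℂ L] {d k : ℕ}

theorem IsHomogPoly.add {q r : L → ℂ} (hq : IsHomogPoly d q) (hr : IsHomogPoly d r) :
    IsHomogPoly d fun x => q x + r x := by
  obtain ⟨F, hF⟩ := hq
  obtain ⟨F', hF'⟩ := hr
  exact ⟨F + F', fun x => by simp [hF, hF']⟩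

theorem IsHomogPoly.const_mul {q : L → ℂ} (hq : IsHomogPoly d q) (c : ℂ) :
    IsHomogPoly d fun x => c * q x := by
  obtain ⟨F, hF⟩ := hq
  exact ⟨c • F, fun x => by simp [hF]⟩

theorem isHomogPoly_zero : IsHomogPoly d fun _ : L => 0 := ⟨0, fun x => by simp⟩

theorem IsHomogPoly.sum {ι : Type*} (s : Finset ι) {q : ι → L → ℂ}
    (hq : ∀ i ∈ s, IsHomogPoly d (q i)) : IsHomogPoly d fun x => ∑ i ∈ s, q i x := by
  classical
  induction s using Finset.induction_on with
  | empty => simpa using isHomogPoly_zero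
  | insert i s hi ih =>
    simp only [Finset.sum_insert hi]
    exact (hq i (Finset.mem_insert_self i s)).add
      (ih fun j hj => hq j (Finset.mem_insert_of_mem hj))

theorem IsHomogPoly.linear_mul {q : L → ℂ} (hq : IsHomogPoly d q) (l : Module.Dual ℂ L) :
    IsHomogPoly (d + 1) fun x => l x * q x := by
  obtain ⟨F, hF⟩ := hq
  exact ⟨(l.smulRight F).uncurryLeft, fun x => by simp [hF, Fin.tail_def]⟩

theorem IsHomogPoly.prod_mul {q : L → ℂ} (hq : IsHomogPoly d q) (l : Fin k → Module.Dual ℂ L) :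
    IsHomogPoly (d + k) fun x => (∏ a, l a x) * q x := by
  induction k with
  | zero => simpa using hq
  | succ k ih =>
    simp only [Fin.prod_univ_succ, mul_assoc]
    exact (ih fun a => l a.succ).linear_mul (l 0)

variable [Module.Finite ℂ L]

theorem IsHomogPoly.eq_sum_coord_mul {q : L → ℂ} (hq : IsHomogPoly (d + 1) q) :
    ∃ r : Fin (Module.finrank ℂ L) → L → ℂ, (∀ b, IsHomogPoly d (r b)) ∧
      q = fun x => ∑ b, (Module.finBasis ℂ L).coord b x * r b x := by
  obtain ⟨F, hF⟩ := hq
  refine ⟨fun b x => F.curryLeft (Module.finBasis ℂ L b) fun _ => x,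
    fun b => ⟨_, fun _ => rfl⟩, funext fun x => ?_⟩
  have h1 : q x = F.curryLeft x fun _ => x := by
    rw [hF, F.curryLeft_apply]
    congr 1
    funext i
    refine Fin.cases rfl (fun _ => rfl) i
  have h2 := (Module.finBasis ℂ L).sum_repr x
  have h3 := congrArg (fun y => F.curryLeft y fun _ => x) h2.symm
  refine h1.trans (h3.trans ?_)
  simp only [map_sum, map_smul, sum_apply, smul_apply]
  rfl

theorem IsHomogPoly.hasLineDerivAt {q : L → ℂ} (hq : IsHomogPoly d q) (v X : L) :
    HasLineDerivAt ℂ q (lineDeriv ℂ q v X) v X := by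
  have h1 := (smoothFun_differentiableAt ⟨q, mem_smoothFun_of_isHomogPoly hq⟩
    (finCoord L v)).lineDifferentiableAt (v := finCoord L X)
  have h2 : LineDifferentiableAt ℂ q v X := by
    simpa only [LineDifferentiableAt, inCoord, map_add, map_smul,
      LinearEquiv.symm_apply_apply] using h1
  exact h2.hasLineDerivAt

/-- Split off one linear factor as in `eq_sum_coord_mul` and use the product rule. In the base case
the cofactors are values of `0`-linear forms, hence constants. -/
theorem isHomogPoly_lineDeriv {q : L → ℂ} (hq : IsHomogPoly (d + 1) q) (X : L) :
    IsHomogPoly d fun v => lineDeriv ℂ q v X := by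
  induction d generalizing q with
  | zero =>
    obtain ⟨r, hr, rfl⟩ := hq.eq_sum_coord_mul
    choose F hF using hr
    refine ⟨∑ b, (Module.finBasis ℂ L).coord b X • F b, fun v => ?_⟩
    have h : HasDerivAt (fun t : ℂ => ∑ b, (Module.finBasis ℂ L).coord b (v + t • X) *
        r b (v + t • X)) (∑ b, (Module.finBasis ℂ L).coord b X * F b fun _ => v) 0 := by
      refine HasDerivAt.fun_sum fun b _ => ?_
      have h1 : (fun t : ℂ => (Module.finBasis ℂ L).coord b (v + t • X) * r b (v + t • X)) =
          fun t => ((Module.finBasis ℂ L).coord b v + t * (Module.finBasis ℂ L).coord b X) *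
            F b fun _ => v := by
        funext t
        rw [hF, map_add, map_smul, smul_eq_mul, Subsingleton.elim (fun _ => v + t • X) fun _ => v]
      rw [h1]
      simpa using (((hasDerivAt_id (0 : ℂ)).mul_const _).const_add _).mul_const (F b fun _ => v)
    refine h.deriv.trans ?_
    simp
  | succ d ih =>
    obtain ⟨r, hr, rfl⟩ := hq.eq_sum_coord_mul
    have h : (fun v => lineDeriv ℂ (fun x => ∑ b, (Module.finBasis ℂ L).coord b x * r b x) v X) =
        fun v => ∑ b, ((Module.finBasis ℂ L).coord b X * r b v +
          (Module.finBasis ℂ L).coord b v * lineDeriv ℂ (r b) v X) := by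
      funext v
      have h : HasDerivAt (fun t : ℂ => ∑ b, (Module.finBasis ℂ L).coord b (v + t • X) *
          r b (v + t • X)) (∑ b, ((Module.finBasis ℂ L).coord b X * r b v +
          (Module.finBasis ℂ L).coord b v * lineDeriv ℂ (r b) v X)) 0 := by
        refine HasDerivAt.fun_sum fun b _ => ?_
        have h1 : HasDerivAt (fun t : ℂ => (Module.finBasis ℂ L).coord b (v + t • X))
            ((Module.finBasis ℂ L).coord b X) 0 := by
          simpa using ((hasDerivAt_id (0 : ℂ)).mul_const ((Module.finBasis ℂ L).coord b X)).const_add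
            ((Module.finBasis ℂ L).coord b v)
        refine (h1.fun_mul ((hr b).hasLineDerivAt v X)).congr_deriv ?_
        simp
      exact h.deriv
    rw [h]
    exact IsHomogPoly.sum _ fun b _ => ((hr b).const_mul _).add ((ih (hr b)).linear_mul _)

theorem isHomogPoly_polar {r : ℕ} {p : L → ℂ} (hp : IsHomogPoly (r + k) p) (X : Fin k → L) :
    IsHomogPoly r (polar p k X) := by
  induction k generalizing r with
  | zero => exact hp
  | succ k ih =>
    exact isHomogPoly_lineDeriv (ih (r := r + 1) (by rwa [add_right_comm]) (Fin.tail X)) (X 0)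

theorem polar_eq_zero {p : L → ℂ} (hp : IsHomogPoly d p) (hk : d < k) (X : Fin k → L) :
    polar p k X = 0 := by
  induction k with
  | zero => omega
  | succ k ih =>
    funext v
    rw [polar]
    rcases Nat.lt_succ_iff_lt_or_eq.1 hk with h | rfl
    · rw [ih h]
      simp [lineDeriv]
    · obtain ⟨F, hF⟩ := isHomogPoly_polar (r := 0) (by rwa [zero_add]) (Fin.tail X)
      have h : polar p d (Fin.tail X) = fun _ => F Fin.elim0 :=
        funext fun x => (hF x).trans (congrArg F (Subsingleton.elim _ _))
      simp [h, lineDeriv]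

theorem IsHomogPoly.holomorphicAt_comp {n : ℕ} {q : L → ℂ} (hq : IsHomogPoly d q)
    {f : (Fin n → ℂ) → L} {z : Fin n → ℂ} (hf : HolomorphicAt f z) :
    HolomorphicAt (fun w => q (f w)) z := by
  have h : AnalyticAt ℂ (fun w => q (f w)) z := by
    induction d generalizing q with
    | zero =>
      obtain ⟨F, hF⟩ := hq
      have h : (fun w => q (f w)) = fun _ => F Fin.elim0 :=
        funext fun x => (hF _).trans (congrArg F (Subsingleton.elim _ _))
      rw [h]
      exact analyticAt_const
    | succ d ih =>
      obtain ⟨r, hr, rfl⟩ := hq.eq_sum_coord_mul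
      exact Finset.analyticAt_fun_sum _ fun b _ => (hf _).mul (ih (hr b))
  intro l
  simpa using HolomorphicAt.smul_const h (1 : ℂ) l

theorem holomorphicAt_polar {n : ℕ} {p : L → ℂ} (hp : IsHomogPoly d p) (X : Fin k → L)
    {f : (Fin n → ℂ) → L} {z : Fin n → ℂ} (hf : HolomorphicAt f z) :
    HolomorphicAt (fun w => polar p k X (f w)) z := by
  rcases lt_or_ge d k with h | h
  · rw [polar_eq_zero hp h]
    exact fun l => analyticAt_const (v := l 0)
  · obtain ⟨r, rfl⟩ := Nat.exists_eq_add_of_le' h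
    exact (isHomogPoly_polar hp X).holomorphicAt_comp hf

end Homogeneous

/-! ## Extension of multilinear forms to vector-valued forms -/

section FormExtend

variable {n k : ℕ} {L : Type*} [AddCommGroup L] [Module ℂ L]

theorem coordForm_mem {S : Submodule ℂ (Forms n)} (l : Module.Dual ℂ L) {u : Forms n ⊗[ℂ] L}
    (hu : u ∈ tensorIn L S) : coordForm l u ∈ S := by
  induction hu using tensorIn_induction with
  | zero => simp
  | add u w _ _ hu hw => simpa only [map_add] using add_mem hu hw
  | tmul a ha X =>
    rw [coordForm_tmul]
    exact S.smul_mem _ ha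

theorem coordForm_map (A : (Fin n → ℂ) →L[ℂ] (Fin n → ℂ)) (l : Module.Dual ℂ L)
    (u : Forms n ⊗[ℂ] L) :
    coordForm l (TensorProduct.map (pullForms A).toLinearMap LinearMap.id u) =
      pullForms A (coordForm l u) := by
  induction u with
  | zero => simp
  | add u w hu hw => simp only [map_add, hu, hw]
  | tmul a X => simp [coordForm_tmul]

theorem prod_ofFn_mem_antiForms {a : Fin k → Forms n} {m : Fin k → ℤ}
    (ha : ∀ i, a i ∈ antiForms n (m i)) : (List.ofFn a).prod ∈ antiForms n (∑ i, m i) := by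
  induction k with
  | zero => simpa using one_mem_intPow _
  | succ k ih =>
    rw [List.ofFn_succ, List.prod_cons, Fin.sum_univ_succ]
    exact mul_mem_intPow (ha 0) (ih fun i => ha i.succ)

/-- Linearity in `e` extracts one coordinate factor of `e` from each argument of `h_k`. -/
theorem evalOneZero_eq_sum (e : Fin n → ℂ) :
    evalOneZero e = ∑ j, e j • evalOneZero (Pi.single j 1) := by
  have h : evalHol e = ∑ j, e j • evalHol (Pi.single j 1) := by
    refine LinearMap.ext fun l => ?_
    have hI : ∀ (c : ℂ) (x : Fin n → ℂ), l (c • x) = c.re * l x + c.im * l (Complex.I • x) := by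
      intro c x
      have h' : c • x = c.re • x + c.im • (Complex.I • x) := by
        conv_lhs => rw [← Complex.re_add_im c]
        rw [add_smul, mul_smul]
        simp only [Complex.coe_smul]
      rw [h', map_add, map_smul, map_smul, Complex.real_smul, Complex.real_smul]
    let H : (Fin n → ℂ) →ₗ[ℂ] ℂ :=
      { toFun := fun e => evalHol e l
        map_add' := fun x y => by simp only [evalHol, LinearMap.coe_mk, AddHom.coe_mk, smul_add, map_add]; ring
        map_smul' := fun c x => by
          simp only [evalHol, LinearMap.coe_mk, AddHom.coe_mk, RingHom.id_apply, smul_eq_mul]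
          rw [smul_comm Complex.I c, hI c x, hI c (Complex.I • x), smul_smul Complex.I Complex.I,
            Complex.I_mul_I, neg_one_smul, map_neg]
          conv_rhs => rw [← Complex.re_add_im c]
          linear_combination (1 / 2 * c.im * l (Complex.I • x) : ℂ) * Complex.I_sq }
    have := sum_smul_map_single H e
    simpa [H] using this.symm
  rw [evalOneZero, h]
  ext a
  simp [evalOneZero]

theorem evalOneZeroL_eq_sum (e : Fin n → ℂ) (u : Forms n ⊗[ℂ] L) :
    evalOneZeroL L e u = ∑ j, e j • evalOneZeroL L (Pi.single j 1) u := by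
  rw [evalOneZeroL, evalOneZero_eq_sum]
  induction u with
  | zero => simp
  | add u w hu hw => simp only [map_add, hu, hw, smul_add, Finset.sum_add_distrib]
  | tmul a X => simp [TensorProduct.sum_tmul, TensorProduct.smul_tmul']

variable [Module.Finite ℂ L]

theorem formExtend_apply (Q : (Fin k → L) → ℂ) (u : Fin k → Forms n ⊗[ℂ] L) :
    formExtend Q u = ∑ J : Fin k → Fin (Module.finrank ℂ L),
      Q (fun a => Module.finBasis ℂ L (J a)) •
        (List.ofFn fun a => coordForm ((Module.finBasis ℂ L).coord (J a)) (u a)).prod := by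
  simp only [formExtend, sum_apply, smul_apply,
    MultilinearMap.compLinearMap_apply, MultilinearMap.mkPiAlgebraFin_apply]
  rfl

theorem smoothAt_prod_ofFn {f : Fin k → (Fin n → ℂ) → Forms n} {z : Fin n → ℂ}
    (hf : ∀ a, SmoothAt (f a) z) : SmoothAt (fun w => (List.ofFn fun a => f a w).prod) z := by
  induction k with
  | zero => simpa using smoothAt_const _ _
  | succ k ih =>
    simp only [List.ofFn_succ, List.prod_cons]
    exact (hf 0).map₂ (ih fun a => hf a.succ) (LinearMap.mul ℂ (Forms n))

theorem weakDiffAt_prod_ofFn {f : Fin k → (Fin n → ℂ) → Forms n} {z : Fin n → ℂ}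
    (hf : ∀ a, WeakDiffAt (f a) z) : WeakDiffAt (fun w => (List.ofFn fun a => f a w).prod) z := by
  induction k with
  | zero => simpa using (smoothAt_const (1 : Forms n) z).weakDiffAt
  | succ k ih =>
    simp only [List.ofFn_succ, List.prod_cons]
    exact (hf 0).map₂ (ih fun a => hf a.succ) (LinearMap.mul ℂ (Forms n))

theorem conjDerivV_prod_ofFn {f : Fin k → (Fin n → ℂ) → Forms n} {z : Fin n → ℂ}
    (hf : ∀ a, WeakDiffAt (f a) z) (v : Fin n → ℂ) :
    conjDerivV (fun w => (List.ofFn fun a => f a w).prod) z v = ∑ a, (List.ofFn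
      (Function.update (fun a => f a z) a (conjDerivV (f a) z v))).prod := by
  induction k with
  | zero =>
    simp only [List.ofFn_zero, List.prod_nil, Finset.univ_eq_empty, Finset.sum_empty]
    exact conjDerivV_of_holomorphicAt (fun _ => analyticAt_const) v
  | succ k ih =>
    have key : conjDerivV (fun w => f 0 w * (List.ofFn fun a : Fin k => f a.succ w).prod) z v =
        conjDerivV (f 0) z v * (List.ofFn fun a : Fin k => f a.succ z).prod +
          f 0 z * conjDerivV (fun w => (List.ofFn fun a : Fin k => f a.succ w).prod) z v :=
      conjDerivV_map₂ (hf 0) (weakDiffAt_prod_ofFn fun a => hf a.succ) (LinearMap.mul ℂ _) v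
    simp only [List.ofFn_succ, List.prod_cons, Fin.sum_univ_succ]
    rw [key, ih fun a => hf a.succ, Finset.mul_sum]
    refine congrArg₂ (· + ·) ?_ (Finset.sum_congr rfl fun a _ => ?_)
    · simp only [Function.update_self, Function.update_of_ne (Fin.succ_ne_zero _)]
    · rw [Function.update_of_ne (Fin.succ_ne_zero a).symm]
      congr 3
      funext i
      simp only [Function.update_apply, Fin.succ_inj]

theorem conjDerivV_sum {M ι : Type*} [AddCommGroup M] [Module ℂ M] [Module.Finite ℂ M]
    (s : Finset ι) {f : ι → (Fin n → ℂ) → M} {z : Fin n → ℂ} (hf : ∀ i ∈ s, WeakDiffAt (f i) z)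
    (v : Fin n → ℂ) : conjDerivV (fun w => ∑ i ∈ s, f i w) z v = ∑ i ∈ s, conjDerivV (f i) z v :=
  conjDerivV_eq fun l => by
    have := conjDeriv_sum_mul s (f := fun i w => l (f i w)) (g := fun _ _ => 1) (z := z)
      (fun i hi => hf i hi l) (fun _ _ => differentiableAt_const _) v
    simp only [mul_one, conjDeriv_const, mul_zero, add_zero] at this
    rw [map_sum]
    simp only [map_sum]
    rw [this]
    exact Finset.sum_congr rfl fun i hi => (apply_conjDerivV (hf i hi) l v).symm

/-- The coefficients are holomorphic, so only the arguments are differentiated. No signs occur yet,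
since `∂/∂z̄_j` has degree zero. -/
theorem conjDerivV_formExtend {Q : (Fin n → ℂ) → (Fin k → L) → ℂ} {z : Fin n → ℂ}
    (hQ : ∀ Y, HolomorphicAt (fun w => Q w Y) z) {u : Fin k → (Fin n → ℂ) → Forms n ⊗[ℂ] L}
    (hu : ∀ a, WeakDiffAt (u a) z) (v : Fin n → ℂ) :
    conjDerivV (fun w => formExtend (Q w) fun a => u a w) z v = ∑ a, formExtend (Q z)
      (Function.update (fun a => u a z) a (conjDerivV (u a) z v)) := by
  have h1 : ∀ J : Fin k → Fin (Module.finrank ℂ L), WeakDiffAt (fun w => (List.ofFn fun a =>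
      coordForm ((Module.finBasis ℂ L).coord (J a)) (u a w)).prod) z :=
    fun J => weakDiffAt_prod_ofFn fun a => (hu a).map _
  simp only [formExtend_apply]
  rw [Finset.sum_comm]
  refine (conjDerivV_sum _ (fun J _ => (hQ _).smoothAt.weakDiffAt.map₂ (h1 J)
    (LinearMap.lsmul ℂ (Forms n))) v).trans ?_
  refine Finset.sum_congr rfl fun J _ => ?_
  have key := conjDerivV_map₂ (hQ fun a => Module.finBasis ℂ L (J a)).smoothAt.weakDiffAt (h1 J)
    (LinearMap.lsmul ℂ (Forms n)) v
  rw [conjDerivV_of_holomorphicAt (hQ _), map_zero, LinearMap.zero_apply, zero_add,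
    conjDerivV_prod_ofFn fun a => (hu a).map _] at key
  refine key.trans ?_
  rw [LinearMap.lsmul_apply, Finset.smul_sum]
  refine Finset.sum_congr rfl fun a _ => ?_
  congr 3
  funext i
  rcases eq_or_ne i a with rfl | h
  · simp only [Function.update_self]
    exact conjDerivV_map (hu i) _ v
  · simp only [Function.update_of_ne h]

theorem smoothAt_formExtend {Q : (Fin n → ℂ) → (Fin k → L) → ℂ} {z : Fin n → ℂ}
    (hQ : ∀ Y, HolomorphicAt (fun w => Q w Y) z) {u : Fin k → (Fin n → ℂ) → Forms n ⊗[ℂ] L}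
    (hu : ∀ a, SmoothAt (u a) z) : SmoothAt (fun w => formExtend (Q w) fun a => u a w) z := by
  simp only [formExtend_apply]
  exact smoothAt_sum _ fun J _ => (hQ _).smoothAt.map₂
    (smoothAt_prod_ofFn fun a => (hu a).map _) (LinearMap.lsmul ℂ (Forms n))

end FormExtend

/-! ## The maps `h_k` -/

section Extend

variable {n k : ℕ} {𝔄 : Type*} [Ring 𝔄] [Algebra ℂ 𝔄] {E : Module.Dual ℂ 𝔄}

theorem formExtend_map {L L' : Type*} [AddCommGroup L] [Module ℂ L] [Module.Finite ℂ L]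
    [AddCommGroup L'] [Module ℂ L'] [Module.Finite ℂ L'] {D : L' →ₗ[ℂ] 𝔄}
    {Q : (Fin k → L') → ℂ} {Q' : (Fin k → L) → ℂ}
    (hQ : ∀ X, Q X = E (List.ofFn fun a => D (X a)).prod) (g : L →ₗ[ℂ] L')
    (hg : ∀ X, Q (fun a => g (X a)) = Q' X) (A : (Fin n → ℂ) →L[ℂ] (Fin n → ℂ))
    (u : Fin k → Forms n ⊗[ℂ] L) :
    formExtend Q (fun a => TensorProduct.map (pullForms A).toLinearMap g (u a)) =
      pullForms A (formExtend Q' u) := by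
  have h : ∀ w, D.lTensor (Forms n) (TensorProduct.map (pullForms A).toLinearMap g w) =
      Algebra.TensorProduct.map (pullForms A) (AlgHom.id ℂ 𝔄)
        ((D ∘ₗ g).lTensor (Forms n) w) := by
    intro w
    induction w with
    | zero => simp
    | add u w hu hw => simp only [map_add, hu, hw]
    | tmul a X => simp
  rw [formExtend_eq_coordForm hQ,
    formExtend_eq_coordForm (D := D ∘ₗ g) (fun X => (hg X).symm.trans (hQ _)), ← coordForm_map]
  simp only [h]
  refine congrArg (coordForm E) ?_
  have := map_list_prod (Algebra.TensorProduct.map (pullForms A) (AlgHom.id ℂ 𝔄))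
    (List.ofFn fun a => (D ∘ₗ g).lTensor (Forms n) (u a))
  rw [List.map_ofFn] at this
  exact this.symm

variable {L : Type*} [LieRing L] [LieAlgebra ℂ L] {D : L →ₗ[ℂ] 𝔄}

/-- The modified slot is moved to the front, where a form `dz̄_j` can be multiplied into it. Here
`c` still has the degree of `u a`, as it is to be a derivative without its `dz̄_j`. -/
theorem coordForm_prod_ofFn_update (hD : ∀ X Y, D X * D Y = D Y * D X) {d : Fin k → ℤ}
    {u : Fin k → Forms n ⊗[ℂ] L} (hu : ∀ i, u i ∈ tensorIn L (formsDegree n (d i))) {a : Fin k}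
    {c : Forms n ⊗[ℂ] L} (hc : c ∈ tensorIn L (formsDegree n (d a))) :
    coordForm E (List.ofFn fun i => D.lTensor (Forms n) (Function.update u a c i)).prod =
      listSign d (a :: (List.finRange k).erase a) • coordForm E (D.lTensor (Forms n) c *
        (((List.finRange k).erase a).map fun i => D.lTensor (Forms n) (u i)).prod) := by
  have hw : ∀ i, Function.update u a c i ∈ tensorIn L (formsDegree n (d i)) := by
    intro i
    rcases eq_or_ne i a with rfl | h
    · rwa [Function.update_self]
    · rw [Function.update_of_ne h]
      exact hu i
  have h := listSign_smul_prod_perm d (fun i => D.lTensor (Forms n) (Function.update u a c i))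
    (fun i j => lTensor_mul_comm hD (hw i) (hw j)) (List.perm_cons_erase (List.mem_finRange a))
    (List.nodup_finRange k)
  rw [listSign_eq_one_of_sorted d (List.pairwise_le_finRange k), one_smul, List.map_cons,
    List.prod_cons] at h
  have h2 : ((List.finRange k).erase a).map (fun i => D.lTensor (Forms n) (Function.update u a c i))
      = ((List.finRange k).erase a).map fun i => D.lTensor (Forms n) (u i) :=
    List.map_congr_left fun i hi => by
      rw [Function.update_of_ne ((List.nodup_finRange k).mem_erase_iff.1 hi).1]
  simp only [Function.update_self] at h
  rw [List.ofFn_eq_map, h, h2, LinearMap.map_smul_of_tower]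

end Extend

/-! ### Degree, smoothness, `∂̄` and graded symmetry of the maps `h_k`. -/

section Hitchin

variable {n m : ℕ} {X : Type u} [TopologicalSpace X] [ChartedSpace (Fin n → ℂ) X]
  [IsManifold 𝓘(ℂ, Fin n → ℂ) ω X]
  {G : Type v} [TopologicalSpace G] [ChartedSpace (Fin m → ℂ) G] [Group G]

/-- The count of degrees in `e`: the `k` arguments contribute one factor each and the polarisation
at `φ e` contributes `d - k`. For `k > d` the polarisation vanishes. -/
theorem formExtend_polar_mem_symPart {L : Type*} [AddCommGroup L] [Module ℂ L] [Module.Finite ℂ L]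
    {d k : ℕ} {p : L → ℂ} (hp : IsHomogPoly d p) (φ : (Fin n → ℂ) →ₗ[ℂ] L) {i : Fin k → ℤ}
    {u : Fin k → Forms n ⊗[ℂ] L} (hu : ∀ a, u a ∈ tensorIn L (formsDegree n (i a + 1))) :
    (fun e => formExtend (fun Y => polar p k Y (φ e)) fun a => evalOneZeroL L e (u a)) ∈
      symPart n d (∑ a, i a) := by
  have h : (fun e => formExtend (fun Y => polar p k Y (φ e)) fun a => evalOneZeroL L e (u a)) =
      ∑ K : Fin k → Fin n, ∑ J : Fin k → Fin (Module.finrank ℂ L), fun e =>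
        ((∏ a, e (K a)) * polar p k (fun a => Module.finBasis ℂ L (J a)) (φ e)) •
          (List.ofFn fun a => coordForm ((Module.finBasis ℂ L).coord (J a))
            (evalOneZeroL L (Pi.single (K a) 1) (u a))).prod := by
    funext e
    simp only [evalOneZeroL_eq_sum e, Finset.sum_apply]
    rw [MultilinearMap.map_sum]
    refine Finset.sum_congr rfl fun K _ => ?_
    rw [MultilinearMap.map_smul_univ, formExtend_apply, Finset.smul_sum]
    exact Finset.sum_congr rfl fun J _ => smul_smul _ _ _
  rw [h]
  refine sum_mem fun K _ => sum_mem fun J _ => ?_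
  rcases lt_or_ge d k with hk | hk
  · have h0 : (fun e => ((∏ a, e (K a)) * polar p k (fun a => Module.finBasis ℂ L (J a)) (φ e)) •
          (List.ofFn fun a => coordForm ((Module.finBasis ℂ L).coord (J a))
            (evalOneZeroL L (Pi.single (K a) 1) (u a))).prod) = 0 := by
      funext e
      rw [polar_eq_zero hp hk]
      simp
    rw [h0]
    exact zero_mem _
  · obtain ⟨r, rfl⟩ := Nat.exists_eq_add_of_le' hk
    exact Submodule.subset_span ⟨_, ((isHomogPoly_polar hp _).comp_linear φ).prod_mul
      fun a => LinearMap.proj (K a), _,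
      prod_ofFn_mem_antiForms fun a => coordForm_mem _ (evalOneZeroL_mem _ (hu a)), rfl⟩

theorem localHiggs_center (P : HolPrincipalBundle.{u, v, w} n m X G)
    (θ : X → (Fin n → ℂ) →ₗ[ℂ] LieAlg m G) (x : X) :
    P.localHiggs θ x (chartAt (Fin n → ℂ) x x) = θ x := by
  have h := (chartAt (Fin n → ℂ) x).left_inv (mem_chart_source _ x)
  simp only [HolPrincipalBundle.localHiggs, h, chartJac_self, P.trans_self _ x (P.mem_baseSet_at x),
    Ad_one]
  rfl

theorem hitchinMap_apply {P : HolPrincipalBundle.{u, v, w} n m X G} (θ : HiggsField P)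
    (p : LieAlg m G → ℂ) {k : ℕ} (s : Fin k → X → Forms n ⊗[ℂ] LieAlg m G) (x : X) (e : Fin n → ℂ) :
    hitchinMap θ p k s x e = formExtend (fun Y => polar p k Y (θ.toFun x e))
      fun a => evalOneZeroL (LieAlg m G) e (s a x) := rfl

variable {P : HolPrincipalBundle.{u, v, w} n m X G} [LieGroup 𝓘(ℂ, Fin m → ℂ) ω G]
  {θ : HiggsField P} {p : LieAlg m G → ℂ} {d k : ℕ}

/-- Every ingredient is natural: the projection to type `(1, •)` under pullback, and the
polarisation under `Ad` by invariance of `p`. So `h_k` has the same formula in every frame. -/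
theorem symLocalRep_hitchinMap (hp : IsHomogPoly d p) (hinv : ∀ (g : G) Y, p (Ad g Y) = p Y)
    (s : Fin k → X → Forms n ⊗[ℂ] LieAlg m G) (x : X) (e : Fin n → ℂ) :
    symLocalRep (hitchinMap θ p k s) x e = fun z =>
      formExtend (fun Y => polar p k Y (P.localHiggs θ.toFun x z e))
        fun a => evalOneZeroL (LieAlg m G) e (P.localRep (s a) x z) := by
  obtain ⟨𝔄, _, _, D, V, E, -, -, -, -, hpol⟩ :=
    exists_operators hp (lineDeriv_lie_eq_zero hp hinv)
  funext z
  simp only [HolPrincipalBundle.localRep, evalOneZeroL_map]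
  exact (formExtend_map (fun Y => hpol k Y _) _
    (fun Y => polar_comp_equivariant _ (hinv _) k Y _) _ _).symm

theorem hitchinMap_mem_symForms (hp : IsHomogPoly d p) (hinv : ∀ (g : G) Y, p (Ad g Y) = p Y)
    {i : Fin k → ℤ} {s : Fin k → X → Forms n ⊗[ℂ] LieAlg m G} (hs : ∀ a, s a ∈ P.adForms (i a + 1)) :
    hitchinMap θ p k s ∈ symForms n X d ((∑ a, i a) + 1) := by
  have hs' := fun a => P.mem_adForms_iff.1 (hs a)
  rw [mem_symForms_iff, add_sub_cancel_right]
  refine ⟨fun x => formExtend_polar_mem_symPart hp (θ.toFun x) fun a => (hs' a).1 x,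
    fun x e => ?_⟩
  rw [symLocalRep_hitchinMap hp hinv]
  exact smoothAt_formExtend (fun Y => holomorphicAt_polar hp Y (θ.holomorphic x e))
    fun a => ((hs' a).2 x).map _

/-- Differentiate slot by slot, bring the differentiated slot to the front, and absorb `dz̄_j`
there; the sum over `j` then rebuilds `∂̄_P` of that argument. -/
theorem symDGLA_d_hitchinMap {𝔄 : Type*} [Ring 𝔄] [Algebra ℂ 𝔄] {D : LieAlg m G →ₗ[ℂ] 𝔄}
    {E : LieAlg m G → 𝔄 →ₗ[ℂ] ℂ} (hD : ∀ X Y, D X * D Y = D Y * D X)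
    (hpol : ∀ (k : ℕ) (X : Fin k → LieAlg m G) (v : LieAlg m G),
      polar p k X v = E v (List.ofFn fun a => D (X a)).prod)
    (hp : IsHomogPoly d p) (hinv : ∀ (g : G) Y, p (Ad g Y) = p Y)
    {i : Fin k → ℤ} {s : Fin k → X → Forms n ⊗[ℂ] LieAlg m G} (hs : ∀ a, s a ∈ P.adForms (i a + 1))
    (x : X) (e : Fin n → ℂ) :
    (symDGLA n X d).d (hitchinMap θ p k s) x e =
      ∑ a, listSign i (a :: (List.finRange k).erase a) • coordForm (E (θ.toFun x e))
        (D.lTensor (Forms n) (evalOneZeroL (LieAlg m G) e (P.dbar (s a) x)) *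
          (((List.finRange k).erase a).map fun b =>
            D.lTensor (Forms n) (evalOneZeroL (LieAlg m G) e (s b x))).prod) := by
  have hs' := fun a => P.mem_adForms_iff.1 (hs a)
  have hw : ∀ a, WeakDiffAt (P.localRep (s a) x) (chartAt (Fin n → ℂ) x x) :=
    fun a => ((hs' a).2 x).weakDiffAt
  have hu : ∀ a, evalOneZeroL (LieAlg m G) e (s a x) ∈
      tensorIn (LieAlg m G) (formsDegree n (i a)) :=
    fun a => tensorIn_antiForms_le _ (evalOneZeroL_mem e ((hs' a).1 x))
  have hc : ∀ a v, evalOneZeroL (LieAlg m G) e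
      (conjDerivV (P.localRep (s a) x) (chartAt (Fin n → ℂ) x x) v) ∈
      tensorIn (LieAlg m G) (formsDegree n (i a)) :=
    fun a v => tensorIn_antiForms_le _ (evalOneZeroL_mem e (conjDerivV_mem (hw a)
      (Filter.Eventually.of_forall (P.localRep_mem (hs' a).1 x)) v))
  have h1 : (symDGLA n X d).d (hitchinMap θ p k s) x e =
      ∑ j, ExteriorAlgebra.ι ℂ (dzbar j) * conjDerivV (symLocalRep (hitchinMap θ p k s) x e)
        (chartAt (Fin n → ℂ) x x) (Pi.single j 1) := localDbar_eq _ _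
  have h2 : ∀ v, conjDerivV (symLocalRep (hitchinMap θ p k s) x e) (chartAt (Fin n → ℂ) x x) v =
      ∑ a, listSign i (a :: (List.finRange k).erase a) • coordForm (E (θ.toFun x e))
        (D.lTensor (Forms n) (evalOneZeroL (LieAlg m G) e
          (conjDerivV (P.localRep (s a) x) (chartAt (Fin n → ℂ) x x) v)) *
          (((List.finRange k).erase a).map fun b =>
            D.lTensor (Forms n) (evalOneZeroL (LieAlg m G) e (s b x))).prod) := by
    intro v
    rw [symLocalRep_hitchinMap hp hinv]
    refine (conjDerivV_formExtend (Q := fun z Y => polar p k Y (P.localHiggs θ.toFun x z e))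
      (fun Y => holomorphicAt_polar hp Y (θ.holomorphic x e)) (fun a => (hw a).map _) v).trans ?_
    refine Finset.sum_congr rfl fun a _ => ?_
    rw [localHiggs_center]
    simp only [P.localRep_center, conjDerivV_map (hw a)]
    rw [formExtend_eq_coordForm fun Y => hpol k Y _]
    exact coordForm_prod_ofFn_update hD hu (hc a v)
  rw [h1]
  simp only [h2, Finset.mul_sum]
  rw [Finset.sum_comm]
  refine Finset.sum_congr rfl fun a _ => ?_
  simp only [mul_smul_comm, ← Finset.smul_sum]
  congr 1
  simp only [← coordForm_lTensor_smul_mul, ← map_sum, ← Finset.sum_mul, ← evalOneZeroL_dzbar_smul]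
  rw [← localDbar_eq]
  rfl

theorem hitchinMap_comp_perm (hp : IsHomogPoly d p) (hinv : ∀ (g : G) Y, p (Ad g Y) = p Y)
    {i : Fin k → ℤ} {s : Fin k → X → Forms n ⊗[ℂ] LieAlg m G} (hs : ∀ a, s a ∈ P.adForms (i a + 1))
    (σ : Equiv.Perm (Fin k)) :
    hitchinMap θ p k (s ∘ σ) = koszulSign (σ⁻¹ : Equiv.Perm (Fin k)) i • hitchinMap θ p k s := by
  obtain ⟨𝔄, _, _, D, V, E, hD, -, -, -, hpol⟩ :=
    exists_operators hp (lineDeriv_lie_eq_zero hp hinv)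
  funext x e
  have hu : ∀ a, evalOneZeroL (LieAlg m G) e (s a x) ∈
      tensorIn (LieAlg m G) (formsDegree n (i a)) :=
    fun a => tensorIn_antiForms_le _ (evalOneZeroL_mem e ((P.mem_adForms_iff.1 (hs a)).1 x))
  have hn : (List.ofFn σ).Nodup := List.nodup_ofFn.2 σ.injective
  have hm : ∀ a, a ∈ List.ofFn σ := fun a => List.mem_ofFn.2 (σ.surjective a)
  have h := listSign_smul_prod_perm i
    (fun a => D.lTensor (Forms n) (evalOneZeroL (LieAlg m G) e (s a x)))
    (fun a b => lTensor_mul_comm hD (hu a) (hu b))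
    ((List.perm_ext_iff_of_nodup (List.nodup_finRange k) hn).2 fun a => by simp [hm])
    (List.nodup_finRange k)
  rw [listSign_eq_one_of_sorted i (List.pairwise_le_finRange k), one_smul] at h
  -- Listing the indices by increasing value of `σ⁻¹` gives `σ 0, σ 1, …`.
  have hk : koszulSign (σ⁻¹ : Equiv.Perm (Fin k)) i = listSign i (List.ofFn σ) := by
    refine koszulSign_eq_listSign _ i hn hm ?_
    rw [List.pairwise_ofFn]
    intro a b hab
    exact Or.inl (by simpa using hab)
  rw [Pi.smul_apply, Pi.smul_apply, hitchinMap_apply, hitchinMap_apply,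
    formExtend_eq_coordForm fun Y => hpol k Y _, formExtend_eq_coordForm fun Y => hpol k Y _,
    List.ofFn_eq_map (f := fun a => D.lTensor (Forms n) (evalOneZeroL (LieAlg m G) e (s a x))), h,
    List.map_ofFn, hk, LinearMap.map_smul_of_tower, smul_smul, units_mul_self_eq_one, one_smul]
  rfl

end Hitchin

/-! ## Sums over subsets of the arguments -/

section Subsets

variable {k : ℕ}

theorem ofFn_subfamily {β : Type*} (S : Finset (Fin k)) (s : Fin k → β) :
    List.ofFn (subfamily S s) = S.sort.map s := by
  refine List.ext_getElem (by simp) fun i h1 h2 => ?_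
  simp [subfamily, Finset.orderEmbOfFin_apply]

theorem sort_eq_of_pairwise {S : Finset (Fin k)} {l : List (Fin k)} (hl : l.Pairwise (· < ·))
    (hS : ∀ i, i ∈ S ↔ i ∈ l) : S.sort = l := by
  have h : S = l.toFinset := by
    ext i
    rw [hS, List.mem_toFinset]
  rw [h]
  exact (List.toFinset_sort (· ≤ ·) (hl.imp fun h => h.ne)).2 (hl.imp fun h => h.le)

theorem sort_compl_singleton (i : Fin k) :
    ({i}ᶜ : Finset (Fin k)).sort = (List.finRange k).erase i :=
  sort_eq_of_pairwise ((List.pairwise_lt_finRange k).sublist List.erase_sublist) fun j => by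
    rw [(List.nodup_finRange k).mem_erase_iff]
    simp

theorem sort_compl_pair (i j : Fin k) :
    ({i, j}ᶜ : Finset (Fin k)).sort = ((List.finRange k).erase i).erase j :=
  sort_eq_of_pairwise ((List.pairwise_lt_finRange k).sublist
    (List.erase_sublist.trans List.erase_sublist)) fun l => by
    rw [((List.nodup_finRange k).erase i).mem_erase_iff, (List.nodup_finRange k).mem_erase_iff]
    simp
    tauto

theorem sort_pair {i j : Fin k} (h : i < j) : ({i, j} : Finset (Fin k)).sort = [i, j] :=
  sort_eq_of_pairwise (by simpa using h) fun l => by simp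

theorem koszulSign_mem_eq_listSign (I : Finset (Fin k)) (n : Fin k → ℤ) :
    koszulSign (fun i => if i ∈ I then (0 : ℕ) else 1) n = listSign n (I.sort ++ Iᶜ.sort) := by
  refine koszulSign_eq_listSign _ n ?_ (fun i => ?_) ?_
  · refine List.nodup_append.2 ⟨Finset.sort_nodup _ _, Finset.sort_nodup _ _, ?_⟩
    intro a ha b hb hab
    rw [Finset.mem_sort] at ha hb
    exact (Finset.mem_compl.1 hb) (hab ▸ ha)
  · by_cases h : i ∈ I <;> simp [h]
  · refine List.pairwise_append.2 ⟨?_, ?_, ?_⟩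
    · refine I.sortedLT_sort.pairwise.imp_of_mem fun ha hb h => Or.inr ⟨?_, h⟩
      rw [Finset.mem_sort] at ha hb
      simp [ha, hb]
    · refine Iᶜ.sortedLT_sort.pairwise.imp_of_mem fun ha hb h => Or.inr ⟨?_, h⟩
      rw [Finset.mem_sort, Finset.mem_compl] at ha hb
      simp [ha, hb]
    · intro a ha b hb
      rw [Finset.mem_sort] at ha hb
      rw [Finset.mem_compl] at hb
      simp [ha, hb]

theorem sum_finset_eq_add {M : Type*} [AddCommMonoid M] (f : Finset (Fin k) → M)
    (hf : ∀ I, I.card ≠ 1 → I.card ≠ 2 → f I = 0) :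
    ∑ I, f I = ∑ i, f {i} + ∑ i, ∑ j, if i < j then f {i, j} else 0 := by
  have h1 : ∑ i, f {i} = ∑ I ∈ Finset.powersetCard 1 Finset.univ, f I := by
    rw [Finset.powersetCard_one, Finset.sum_map]
    rfl
  have h2 : ∑ i, ∑ j, (if i < j then f {i, j} else 0) =
      ∑ I ∈ Finset.powersetCard 2 Finset.univ, f I := by
    rw [← Finset.sum_product', ← Finset.sum_filter]
    refine Finset.sum_nbij (fun q => {q.1, q.2}) ?_ ?_ ?_ fun _ _ => rfl
    · rintro ⟨i, j⟩ h
      have h : i < j := by simpa using h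
      simp [Finset.mem_powersetCard, Finset.card_pair h.ne]
    · rintro ⟨i, j⟩ h ⟨i', j'⟩ h' heq
      have h : i < j := by simpa using h
      have h' : i' < j' := by simpa using h'
      have := congrArg (fun S : Finset (Fin k) => S.sort) heq
      simp only [sort_pair h, sort_pair h'] at this
      simpa using this
    · intro I hI
      obtain ⟨i, j, hij, rfl⟩ := Finset.card_eq_two.1 (Finset.mem_powersetCard.1 hI).2
      rcases lt_or_gt_of_ne hij with h | h
      · exact ⟨(i, j), by simpa using h, rfl⟩
      · exact ⟨(j, i), by simpa using h, Finset.pair_comm _ _⟩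
  rw [h1, h2, ← Finset.sum_union]
  · refine (Finset.sum_subset (Finset.subset_univ _) fun I _ hI => hf I ?_ ?_).symm
    · rintro h
      exact hI (Finset.mem_union_left _ (by simp [Finset.mem_powersetCard, h]))
    · rintro h
      exact hI (Finset.mem_union_right _ (by simp [Finset.mem_powersetCard, h]))
  · exact Finset.disjoint_left.2 fun I h h' => by
      rw [Finset.mem_powersetCard] at h h'
      omega

theorem sum_sum_erase_eq {M : Type*} [AddCommMonoid M] (g : Fin k → Fin k → M) :
    ∑ i, ∑ j ∈ Finset.univ.erase i, g i j =
      ∑ i, ∑ j, if i < j then g i j + g j i else 0 := by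
  have h1 : ∀ i, ∑ j ∈ Finset.univ.erase i, g i j =
      ∑ j, ((if i < j then g i j else 0) + if j < i then g i j else 0) := by
    intro i
    rw [← Finset.sum_erase (s := Finset.univ) (a := i) (f := fun j =>
      (if i < j then g i j else 0) + if j < i then g i j else 0) (by simp)]
    refine Finset.sum_congr rfl fun j hj => ?_
    rcases lt_or_gt_of_ne (Finset.ne_of_mem_erase hj) with h | h
    · simp [h, h.not_gt]
    · simp [h, h.not_gt]
  have h2 : ∀ i, (∑ j, if i < j then g i j + g j i else 0) =
      ∑ j, ((if i < j then g i j else 0) + if i < j then g j i else 0) :=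
    fun i => Finset.sum_congr rfl fun j _ => by split_ifs <;> simp
  simp only [h1, h2, Finset.sum_add_distrib]
  congr 1
  exact Finset.sum_comm

end Subsets

/-! ## The quadratic identity -/

section Quadratic

variable {n k : ℕ} {L : Type*} [LieRing L] [LieAlgebra ℂ L] {𝔄 : Type*} [Ring 𝔄] [Algebra ℂ 𝔄]
  {D V : L →ₗ[ℂ] 𝔄} {E : Module.Dual ℂ 𝔄}

/-- The `(1, •)` part of `[θ, s_a]` is, up to sign, the bracket of the `(0, •)` part of `s_a` with
`θ(e)`. By `hEv` this bracket is the linear field in leftmost position; moved to the right end it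
dies by `hE`, leaving one commutator for each `b ≠ a`. -/
theorem listSign_smul_coordForm_toLieForm_bracket (hD : ∀ X Y, D X * D Y = D Y * D X)
    (hV : ∀ X Y, D Y * V X = V X * D Y + D ⁅X, Y⁆) (hE : ∀ T X, E (T * V X) = 0)
    {φ : (Fin n → ℂ) →ₗ[ℂ] L} {e : Fin n → ℂ} (hEv : ∀ X T, E (V X * T) = E (D ⁅X, φ e⁆ * T))
    {i : Fin k → ℤ} {s : Fin k → Forms n ⊗[ℂ] L}
    (hs : ∀ a, s a ∈ tensorIn L (formsDegree n (i a + 1))) (a : Fin k) :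
    listSign i (a :: (List.finRange k).erase a) • coordForm E
      (D.lTensor (Forms n) (evalOneZeroL L e (formBracket n L (toLieForm φ) (s a))) *
        (((List.finRange k).erase a).map fun b =>
          D.lTensor (Forms n) (evalOneZeroL L e (s b))).prod) =
    ∑ b ∈ Finset.univ.erase a, ((i a + 1).negOnePow *
      listSign i (a :: b :: ((List.finRange k).erase a).erase b)) • coordForm E
        (D.lTensor (Forms n) (formBracket n L (antiProjL L (s a)) (evalOneZeroL L e (s b))) *
          ((((List.finRange k).erase a).erase b).map fun c =>
            D.lTensor (Forms n) (evalOneZeroL L e (s c))).prod) := by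
  have hu : ∀ a, evalOneZeroL L e (s a) ∈ tensorIn L (formsDegree n (i a)) :=
    fun a => tensorIn_antiForms_le _ (evalOneZeroL_mem e (hs a))
  have hc := tensorIn_antiForms_le _ (antiProjL_mem (hs a))
  have hnd : ((List.finRange k).erase a).Nodup := (List.nodup_finRange k).erase a
  have hsort : listSign i ((List.finRange k).erase a) = 1 := listSign_eq_one_of_sorted i
    ((List.pairwise_le_finRange k).sublist List.erase_sublist)
  have h1 : (1 : Forms n) ⊗ₜ[ℂ] φ e ∈ tensorIn L (formsDegree n 0) :=
    tmul_mem_tensorIn (one_mem_intPow _) _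
  have hset : Finset.univ.erase a = ((List.finRange k).erase a).toFinset := by
    ext b
    rw [List.mem_toFinset, (List.nodup_finRange k).mem_erase_iff]
    simp
  have hmain := coordForm_lTensor_mul_prod hD hV hE i (fun b => evalOneZeroL L e (s b)) hu hc 1 hnd
  simp only [one_mul, hsort, one_smul] at hmain
  rw [evalOneZeroL_toLieForm_bracket φ e (hs a), formBracket_skew h1 hc, zero_mul,
    Int.negOnePow_zero, one_smul]
  rw [LinearMap.map_smul_of_tower, map_neg, smul_mul_assoc, neg_mul, LinearMap.map_smul_of_tower,
    map_neg, ← coordForm_lTensor_mul hEv, hmain, neg_neg, smul_smul, hset,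
    List.sum_toFinset _ hnd, List.smul_sum, List.map_map]
  refine congrArg List.sum (List.map_congr_left fun b hb => ?_)
  rw [Function.comp_apply, smul_smul]
  congr 1
  have hh : headSign i a ((List.finRange k).erase a) =
      headSign i a (b :: ((List.finRange k).erase a).erase b) :=
    headSign_perm i a (List.perm_cons_erase hb)
  rw [listSign, hsort, mul_one, hh, listSign.eq_2 i a (b :: _), mul_comm (headSign _ _ _), mul_assoc]

theorem listSign_smul_coordForm_bracket {e : Fin n → ℂ} {i : Fin k → ℤ}
    {s : Fin k → Forms n ⊗[ℂ] L} (hs : ∀ a, s a ∈ tensorIn L (formsDegree n (i a + 1)))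
    {a b : Fin k} (hab : a ≠ b) (l : List (Fin k)) (T : Forms n ⊗[ℂ] 𝔄) :
    listSign i (a :: b :: l) • coordForm E (D.lTensor (Forms n) ((i a + 1).negOnePow •
      evalOneZeroL L e (formBracket n L (s a) (s b))) * T) =
    ((i a + 1).negOnePow * listSign i (a :: b :: l)) • coordForm E
      (D.lTensor (Forms n) (formBracket n L (antiProjL L (s a)) (evalOneZeroL L e (s b))) * T) +
    ((i b + 1).negOnePow * listSign i (b :: a :: l)) • coordForm E
      (D.lTensor (Forms n) (formBracket n L (antiProjL L (s b)) (evalOneZeroL L e (s a))) * T) := by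
  have hu := tensorIn_antiForms_le _ (evalOneZeroL_mem e (hs a))
  have hc := tensorIn_antiForms_le _ (antiProjL_mem (hs b))
  -- The `(0, •)` part of `s_b` has degree `i b + 1` and the `(1, •)` part of `s_a` has degree `i
  -- a`. Skew symmetry in these degrees turns the second half of the bracket into the term with `a`
  -- and `b` exchanged.
  have hsign : listSign i (a :: b :: l) * ((i a + 1).negOnePow * ((i b + 1).negOnePow *
      (i a * (i b + 1)).negOnePow)) = -((i b + 1).negOnePow * listSign i (b :: a :: l)) := by
    rw [listSign_swap i hab]
    simp only [Int.negOnePow_add, mul_add, mul_one, Int.negOnePow_one]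
    have h1 := units_mul_self_eq_one (i a * i b).negOnePow
    have h2 := units_mul_self_eq_one (i a).negOnePow
    calc _ = ((i a * i b).negOnePow * (i a * i b).negOnePow) *
          ((i a).negOnePow * (i a).negOnePow) * ((i b).negOnePow * listSign i (b :: a :: l)) := by
          simp only [mul_neg, neg_mul, mul_one, neg_neg]
          ac_rfl
      _ = _ := by
        rw [h1, h2]
        simp
  rw [evalOneZeroL_formBracket e (s a) (hs b), formBracket_skew hu hc]
  simp only [smul_add, smul_neg, map_add, map_neg, LinearMap.map_smul_of_tower, smul_mul_assoc,
    add_mul, neg_mul, smul_smul]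
  rw [hsign, Units.neg_smul, neg_neg, mul_comm (listSign i (a :: b :: l))]

theorem sum_listSign_smul_coordForm_bracket (hD : ∀ X Y, D X * D Y = D Y * D X)
    (hV : ∀ X Y, D Y * V X = V X * D Y + D ⁅X, Y⁆) (hE : ∀ T X, E (T * V X) = 0)
    {φ : (Fin n → ℂ) →ₗ[ℂ] L} {e : Fin n → ℂ} (hEv : ∀ X T, E (V X * T) = E (D ⁅X, φ e⁆ * T))
    {i : Fin k → ℤ} {s : Fin k → Forms n ⊗[ℂ] L}
    (hs : ∀ a, s a ∈ tensorIn L (formsDegree n (i a + 1))) :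
    ∑ a, listSign i (a :: (List.finRange k).erase a) • coordForm E
      (D.lTensor (Forms n) (evalOneZeroL L e (formBracket n L (toLieForm φ) (s a))) *
        (((List.finRange k).erase a).map fun b =>
          D.lTensor (Forms n) (evalOneZeroL L e (s b))).prod) =
    ∑ a, ∑ b, if a < b then listSign i (a :: b :: ((List.finRange k).erase a).erase b) •
      coordForm E (D.lTensor (Forms n) ((i a + 1).negOnePow •
        evalOneZeroL L e (formBracket n L (s a) (s b))) *
          ((((List.finRange k).erase a).erase b).map fun c =>
            D.lTensor (Forms n) (evalOneZeroL L e (s c))).prod) else 0 := by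
  rw [Finset.sum_congr rfl fun a _ =>
    listSign_smul_coordForm_toLieForm_bracket hD hV hE hEv hs a, sum_sum_erase_eq]
  refine Finset.sum_congr rfl fun a _ => Finset.sum_congr rfl fun b _ => ?_
  split_ifs with h
  · rw [listSign_smul_coordForm_bracket hs h.ne, List.erase_comm b a]
  · rfl

end Quadratic

/-! ## The `L∞`-morphism -/

section Operations

variable {V : Type*} [AddCommGroup V] [Module ℂ V] (A : GradedBracket V)

/-- The operations of a dgla as an `L∞`-algebra, as a function of the list of the degrees and the
arguments. -/
def GradedBracket.listOp : List (ℤ × V) → V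
  | [a] => -A.d a.2
  | [a, b] => (a.1 + 1).negOnePow • A.br a.2 b.2
  | _ => 0

/-- With arguments in a list, the arity `I.card` no longer occurs in a type, and the operation can
be computed once the sorted list of `I` is known. -/
theorem toLInfty_q_eq_listOp {k : ℕ} (n : Fin k → ℤ) (s : Fin k → V) :
    A.toLInfty.q k n s = A.listOp (List.ofFn fun a => (n a, s a)) := by
  match k with
  | 0 => rfl
  | 1 => rfl
  | 2 => rfl
  | k + 3 => rw [List.ofFn_succ, List.ofFn_succ, List.ofFn_succ]; rfl

theorem listOp_eq_zero {l : List (ℤ × V)} (h1 : l.length ≠ 1) (h2 : l.length ≠ 2) :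
    A.listOp l = 0 := by
  match l with
  | [] => rfl
  | [_] => exact (h1 rfl).elim
  | [_, _] => exact (h2 rfl).elim
  | _ :: _ :: _ :: _ => rfl

end Operations

/-! ### Assembling the morphism equation. -/

section Morphism

variable {n m : ℕ} {X : Type u} [TopologicalSpace X] [ChartedSpace (Fin n → ℂ) X]
  [IsManifold 𝓘(ℂ, Fin n → ℂ) ω X]
  {G : Type v} [TopologicalSpace G] [ChartedSpace (Fin m → ℂ) G] [Group G]
  {P : HolPrincipalBundle.{u, v, w} n m X G} {θ : HiggsField P} {p : LieAlg m G → ℂ} {d k : ℕ}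
  {𝔄 : Type*} [Ring 𝔄] [Algebra ℂ 𝔄] {D : LieAlg m G →ₗ[ℂ] 𝔄} {E : LieAlg m G → 𝔄 →ₗ[ℂ] ℂ}

theorem hitchinMap_cons_subfamily (hpol : ∀ (k : ℕ) (X : Fin k → LieAlg m G) (v : LieAlg m G),
      polar p k X v = E v (List.ofFn fun a => D (X a)).prod) (S : Finset (Fin k))
    (c : X → Forms n ⊗[ℂ] LieAlg m G) (s : Fin k → X → Forms n ⊗[ℂ] LieAlg m G) (x : X)
    (e : Fin n → ℂ) :
    hitchinMap θ p (S.card + 1) (Fin.cons c (subfamily S s)) x e = coordForm (E (θ.toFun x e))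
      (D.lTensor (Forms n) (evalOneZeroL (LieAlg m G) e (c x)) * (S.sort.map fun b =>
        D.lTensor (Forms n) (evalOneZeroL (LieAlg m G) e (s b x))).prod) := by
  rw [hitchinMap_apply, formExtend_eq_coordForm fun Y => hpol _ Y _, List.ofFn_succ,
    List.prod_cons, ← ofFn_subfamily]
  rfl

theorem hitchinMap_subfamily (hpol : ∀ (k : ℕ) (X : Fin k → LieAlg m G) (v : LieAlg m G),
      polar p k X v = E v (List.ofFn fun a => D (X a)).prod) {S : Finset (Fin k)}
    (hS : S = Finset.univ) (s : Fin k → X → Forms n ⊗[ℂ] LieAlg m G) :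
    hitchinMap θ p S.card (subfamily S s) = hitchinMap θ p k s := by
  funext x e
  have hsort : S.sort = List.finRange k :=
    sort_eq_of_pairwise (List.pairwise_lt_finRange k) fun i => by simp [hS]
  have h := ofFn_subfamily S fun b => D.lTensor (Forms n) (evalOneZeroL (LieAlg m G) e (s b x))
  rw [hsort, ← List.ofFn_eq_map] at h
  rw [hitchinMap_apply, hitchinMap_apply, formExtend_eq_coordForm fun Y => hpol _ Y _,
    formExtend_eq_coordForm fun Y => hpol _ Y _, ← h]
  rfl

/-- The target has zero bracket, so only `a = 1` contributes, with its single surjection and trivial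
sign. -/
theorem sum_toLInfty_symDGLA (hk : 1 ≤ k) (i : Fin k → ℤ)
    (h : (k : ℕ) → MultilinearMap ℂ (fun _ : Fin k => X → Forms n ⊗[ℂ] LieAlg m G)
      (X → (Fin n → ℂ) → Forms n)) (s : Fin k → X → Forms n ⊗[ℂ] LieAlg m G)
    (hh : ∀ S : Finset (Fin k), S = Finset.univ → h S.card (subfamily S s) = h k s) :
    ∑ a ∈ Finset.Icc 1 k, ((a.factorial : ℂ)⁻¹) •
        ∑ f : {f : Fin k → Fin a // Function.Surjective f},
          koszulSign f.1 i • (symDGLA n X d).toLInfty.q a (fun b => ∑ j with f.1 j = b, i j)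
            (fun b => h (Finset.univ.filter fun j => f.1 j = b).card
              (subfamily (Finset.univ.filter fun j => f.1 j = b) s)) =
      -(symDGLA n X d).d (h k s) := by
  rw [Finset.sum_eq_single_of_mem 1 (by simpa using hk)]
  · let f₀ : {f : Fin k → Fin 1 // Function.Surjective f} :=
      ⟨fun _ => 0, fun b => ⟨⟨0, hk⟩, Subsingleton.elim _ _⟩⟩
    rw [Fintype.sum_eq_single f₀ fun f hf => (hf (Subtype.ext (funext fun _ =>
      Subsingleton.elim _ _))).elim]
    have hsign : koszulSign f₀.1 i = 1 :=
      Finset.prod_eq_one fun a _ => Finset.prod_eq_one fun b _ => if_neg fun h => by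
        simp [f₀] at h
    rw [hsign, one_smul, Nat.factorial_one, Nat.cast_one, inv_one, one_smul]
    change -(symDGLA n X d).d (h _ _) = _
    rw [hh _ (Finset.filter_true_of_mem fun j _ => Subsingleton.elim _ _)]
  · intro a ha h1
    have hq : ∀ (i' : Fin a → ℤ) t, (symDGLA n X d).toLInfty.q a i' t = 0 := by
      intro i' t
      match a with
      | 0 => rfl
      | 1 => exact (h1 rfl).elim
      | 2 => exact smul_zero _
      | a + 3 => rfl
    simp only [hq, smul_zero, Finset.sum_const_zero]

variable [LieGroup 𝓘(ℂ, Fin m → ℂ) ω G]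

theorem hitchinMap_isLInftyMorphism (hp : IsHomogPoly d p) (hinv : ∀ (g : G) Y, p (Ad g Y) = p Y) :
    IsLInftyMorphism (higgsDGLA P θ).toLInfty (symDGLA n X d).toLInfty (hitchinMap θ p) where
  degree k _ i s hs := hitchinMap_mem_symForms hp hinv hs
  symmetric k _ i s hs σ := hitchinMap_comp_perm hp hinv hs σ
  morphism k hk i s hs := by
    obtain ⟨𝔄, _, _, D, V, E, hD, hV, hE, hEv, hpol⟩ :=
      exists_operators hp (lineDeriv_lie_eq_zero hp hinv)
    rw [sum_toLInfty_symDGLA hk i (hitchinMap θ p) s fun S hS => hitchinMap_subfamily hpol hS s]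
    funext x e
    have hterm : ∀ I : Finset (Fin k), I.Nonempty → ((if I.Nonempty then
        koszulSign (fun j => if j ∈ I then (0 : ℕ) else 1) i • hitchinMap θ p (Iᶜ.card + 1)
          (Fin.cons ((higgsDGLA P θ).toLInfty.q I.card (subfamily I i) (subfamily I s))
            (subfamily Iᶜ s)) else 0) : X → (Fin n → ℂ) → Forms n) x e =
        listSign i (I.sort ++ Iᶜ.sort) • coordForm (E (θ.toFun x e))
          (D.lTensor (Forms n) (evalOneZeroL (LieAlg m G) e ((higgsDGLA P θ).listOp
            (I.sort.map fun j => (i j, s j)) x)) * (Iᶜ.sort.map fun b =>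
              D.lTensor (Forms n) (evalOneZeroL (LieAlg m G) e (s b x))).prod) := by
      intro I hI
      rw [if_pos hI, Pi.smul_apply, Pi.smul_apply, hitchinMap_cons_subfamily hpol,
        koszulSign_mem_eq_listSign, toLInfty_q_eq_listOp, ← ofFn_subfamily I]
      rfl
    have hs' : ∀ a, s a x ∈ tensorIn (LieAlg m G) (formsDegree n (i a + 1)) :=
      fun a => (P.mem_adForms_iff.1 (hs a)).1 x
    rw [Finset.sum_apply, Finset.sum_apply, sum_finset_eq_add, Pi.neg_apply, Pi.neg_apply,
      symDGLA_d_hitchinMap hD hpol hp hinv hs]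
    · have hquad := sum_listSign_smul_coordForm_bracket hD hV (hE _) (hEv (θ.toFun x e)) hs'
      have h1 : ∀ a, listSign i (({a} : Finset (Fin k)).sort ++ ({a}ᶜ : Finset (Fin k)).sort) •
          coordForm (E (θ.toFun x e)) (D.lTensor (Forms n) (evalOneZeroL (LieAlg m G) e
            ((higgsDGLA P θ).listOp (({a} : Finset (Fin k)).sort.map fun j => (i j, s j)) x)) *
              ((({a}ᶜ : Finset (Fin k)).sort).map fun b =>
                D.lTensor (Forms n) (evalOneZeroL (LieAlg m G) e (s b x))).prod) =
          -(listSign i (a :: (List.finRange k).erase a) • coordForm (E (θ.toFun x e))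
            (D.lTensor (Forms n) (evalOneZeroL (LieAlg m G) e (P.dbar (s a) x)) *
              (((List.finRange k).erase a).map fun b =>
                D.lTensor (Forms n) (evalOneZeroL (LieAlg m G) e (s b x))).prod)) -
          listSign i (a :: (List.finRange k).erase a) • coordForm (E (θ.toFun x e))
            (D.lTensor (Forms n) (evalOneZeroL (LieAlg m G) e
              (formBracket n (LieAlg m G) (toLieForm (θ.toFun x)) (s a x))) *
              (((List.finRange k).erase a).map fun b =>
                D.lTensor (Forms n) (evalOneZeroL (LieAlg m G) e (s b x))).prod) := by
        intro a
        rw [sort_compl_singleton, Finset.sort_singleton]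
        have hop : (higgsDGLA P θ).listOp ([a].map fun j => (i j, s j)) x =
            -(P.dbar (s a) x + formBracket n (LieAlg m G) (toLieForm (θ.toFun x)) (s a x)) := rfl
        rw [hop]
        simp only [map_neg, map_add, neg_mul, add_mul, smul_neg, smul_add, List.singleton_append]
        abel
      have h2 : ∀ a b, a < b → listSign i (({a, b} : Finset (Fin k)).sort ++
          ({a, b}ᶜ : Finset (Fin k)).sort) • coordForm (E (θ.toFun x e)) (D.lTensor (Forms n)
            (evalOneZeroL (LieAlg m G) e ((higgsDGLA P θ).listOp
              (({a, b} : Finset (Fin k)).sort.map fun j => (i j, s j)) x)) *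
                ((({a, b}ᶜ : Finset (Fin k)).sort).map fun c =>
                  D.lTensor (Forms n) (evalOneZeroL (LieAlg m G) e (s c x))).prod) =
          listSign i (a :: b :: ((List.finRange k).erase a).erase b) •
            coordForm (E (θ.toFun x e)) (D.lTensor (Forms n) ((i a + 1).negOnePow •
              evalOneZeroL (LieAlg m G) e (formBracket n (LieAlg m G) (s a x) (s b x))) *
              ((((List.finRange k).erase a).erase b).map fun c =>
                D.lTensor (Forms n) (evalOneZeroL (LieAlg m G) e (s c x))).prod) := by
        intro a b hab
        rw [sort_compl_pair, sort_pair hab]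
        have hop : (higgsDGLA P θ).listOp ([a, b].map fun j => (i j, s j)) x =
            (i a + 1).negOnePow • formBracket n (LieAlg m G) (s a x) (s b x) := rfl
        rw [hop, LinearMap.map_smul_of_tower (evalOneZeroL (LieAlg m G) e)]
        rfl
      rw [Finset.sum_congr rfl fun a _ => (hterm {a} (Finset.singleton_nonempty a)).trans (h1 a),
        Finset.sum_congr rfl fun a _ => Finset.sum_congr rfl fun b _ => if_congr Iff.rfl
          ((hterm {a, b} (Finset.insert_nonempty _ _))) rfl]
      rw [Finset.sum_congr rfl fun a _ => Finset.sum_congr rfl fun b _ =>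
        ite_congr rfl (fun hab => h2 a b hab) fun _ => rfl]
      rw [← hquad, Finset.sum_sub_distrib, Finset.sum_neg_distrib]
      abel
    · intro I hI1 hI2
      by_cases hI : I.Nonempty
      · rw [hterm I hI]
        have hop : (higgsDGLA P θ).listOp (I.sort.map fun j => (i j, s j)) = 0 := by
          refine listOp_eq_zero _ ?_ ?_ <;> simpa
        rw [hop]
        simp
      · rw [if_neg hI]
        rfl

end Morphism

end

theorem proposition4 {n m : ℕ}
    {X : Type u} [TopologicalSpace X] [ChartedSpace (Fin n → ℂ) X]
    [IsManifold 𝓘(ℂ, Fin n → ℂ) ω X]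
    {G : Type v} [TopologicalSpace G] [ChartedSpace (Fin m → ℂ) G] [Group G]
    [LieGroup 𝓘(ℂ, Fin m → ℂ) ω G]
    (P : HolPrincipalBundle.{u, v, w} n m X G) (θ : HiggsField P)
    (d : ℕ) (p : LieAlg m G → ℂ) (hp : IsHomogPoly d p)
    (hinv : ∀ (g : G) (Y : LieAlg m G), p (Ad g Y) = p Y) :
    (higgsDGLA P θ).IsDGLA ∧ (symDGLA n X d).IsDGLA ∧
      IsLInftyMorphism (higgsDGLA P θ).toLInfty (symDGLA n X d).toLInfty (hitchinMap θ p) := by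
  exact ⟨higgsDGLA_isDGLA θ, symDGLA_isDGLA, hitchinMap_isLInftyMorphism hp hinv⟩
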